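/- **Model.** Algorithms are programs for a unit-cost random access machine over $\mathbb Z$ (finitely many registers, finitely many unbounded arrays; $+,-,\cdot$, integer division, load, store, sequencing, and "if" and "while" with tests "register $>0$"; each instruction and each test costs one step). For $m,n,l\in\mathbb Z_{\ge0}$ consider mixed-integer programs $$\max\{c^{\mathsf T}x+d^{\mathsf T}y:\ Ax+By=b,\ x\ge 0,\ y\ge 0,\ x\in\mathbb Z^n,\ y\in\mathbb R^l\}\qquad(*)$$ with $A\in\mathbb Z^{m\times n}$, $B\in\mathbb Z^{m\times l}$, $b\in\mathbb Z^m$, $c\in\mathbb Z^n$, $d\in\mathbb Z^l$. To *solve* $(*)$ means to halt, started from any memory that contains the input (and is arbitrary elsewhere), and to report correctly that $(*)$ is infeasible, or that its objective is unbounded above on the feasible set, or to return an optimal solution $(x,y)$, with $y$ rational. The running time on an input is the number of integers in the input plus the number of steps (the supremum over all such initial memories). For an algorithm $P$, integers $m,l\ge0$, $\Delta\ge1$ and a magnitude bound $M\in\mathbb Z_{\ge0}\cup\{\infty\}$, let $\kappa_{P,M}(m,l,\Delta)\in\mathbb Z_{\ge 0}\cup\{\infty\}$ be the worst-case running time of $P$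 over all problems $(*)$ with $m$ equations, only $m$ integer variables and $l$ continuous variables, in which all entries of $A$ are at most $\Delta$, and all entries of $B,b,c,d$ at most $M$, in absolute value. **Theorem 4.** There is an absolute constant $C$ such that for every algorithm $P$ there is an algorithm $Q$ with the following property. Let $m,l\ge0$, $\Delta\ge1$, $M\in\mathbb Z_{\ge0}\cup\{\infty\}$, and suppose that $P$ solves all problems $(*)$ with $m$ equations, $m$ integer and $l$ continuous variables in which the entries of $A$ are bounded by $\Delta$ and those of $B,b,c,d$ by $M$ in absolute value. Then, for every $n\ge1$, $Q$ solves every problem $(*)$ with $m$ equations, $n$ integer and $l$ continuous variables in which the entries of $A$ are bounded by $\Delta$ in absolute value, those of $B,b,c,d$ by $M$, and moreover $|b_i|+n\Delta(m+2)(m\Delta)^m\le M$ for all $i$, in time at most $$C\cdot 2^{2m}\,\Delta^{m^3+3m^2+2m}\,n^{m^3+5m^2+6m+1}\cdot\kappa_{P,M}(m,l,\Delta).$$ (For $M=\infty$ there is no restriction on $B,b,c,d$.) -/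

import Mathlib

open scoped Matrix

/-! The machine model: a unit-cost random access machine over the integers, programmed by
structured programs with finitely many registers and finitely many (unbounded) arrays. -/

/-- The arithmetic instructions. -/
inductive ArithOp where
  | add | sub | mul | div

/-- Value of an arithmetic instruction (`div` is integer division with remainder
`0 ≤ r < |t|`, and it returns `0` if the divisor is `0`). -/
def ArithOp.eval : ArithOp → ℤ → ℤ → ℤ
  | .add, s, t => s + t
  | .sub, s, t => s - t
  | .mul, s, t => s * t
  | .div, s, t => s / t

/-- Programs. Registers and arrays are named by natural numbers, arrays are indexed by integers. -/
inductive Prog where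
  /-- do nothing -/
  | nop : Prog
  /-- `r := k` -/
  | const (r : ℕ) (k : ℤ) : Prog
  /-- `r := s o t`, where `r, s, t` are registers -/
  | arith (o : ArithOp) (r s t : ℕ) : Prog
  /-- `r := a[i]`, where `r, i` are registers and `a` is an array -/
  | load (r a i : ℕ) : Prog
  /-- `a[i] := s`, where `i, s` are registers and `a` is an array -/
  | store (a i s : ℕ) : Prog
  /-- first `p`, then `q` -/
  | seq (p q : Prog) : Prog
  /-- if register `r` is positive then `p` else `q` -/
  | ite (r : ℕ) (p q : Prog) : Prog
  /-- while register `r` is positive do `p` -/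
  | loop (r : ℕ) (p : Prog) : Prog

/-- The memory of the machine. -/
structure Mem where
  /-- contents of the registers -/
  reg : ℕ → ℤ
  /-- contents of the arrays -/
  arr : ℕ → ℤ → ℤ

/-- Overwrite a register. -/
def Mem.setReg (σ : Mem) (r : ℕ) (v : ℤ) : Mem :=
  { σ with reg := Function.update σ.reg r v }

/-- Overwrite an array cell. -/
def Mem.setArr (σ : Mem) (a : ℕ) (i v : ℤ) : Mem :=
  { σ with arr := Function.update σ.arr a (Function.update (σ.arr a) i v) }

/-- `Exec p σ t τ`: started in the memory `σ`, the program `p` halts after exactly `t` steps in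
the memory `τ`. Every instruction and every test of a register takes one step. -/
inductive Exec : Prog → Mem → ℕ → Mem → Prop
  | nop (σ : Mem) : Exec .nop σ 1 σ
  | const (r : ℕ) (k : ℤ) (σ : Mem) : Exec (.const r k) σ 1 (σ.setReg r k)
  | arith (o : ArithOp) (r s t : ℕ) (σ : Mem) :
      Exec (.arith o r s t) σ 1 (σ.setReg r (o.eval (σ.reg s) (σ.reg t)))
  | load (r a i : ℕ) (σ : Mem) : Exec (.load r a i) σ 1 (σ.setReg r (σ.arr a (σ.reg i)))
  | store (a i s : ℕ) (σ : Mem) : Exec (.store a i s) σ 1 (σ.setArr a (σ.reg i) (σ.reg s))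
  | seq {p q : Prog} {σ τ ρ : Mem} {t u : ℕ} (hp : Exec p σ t τ) (hq : Exec q τ u ρ) :
      Exec (.seq p q) σ (t + u) ρ
  | ite_pos {r : ℕ} {p q : Prog} {σ τ : Mem} {t : ℕ} (hr : 0 < σ.reg r) (hp : Exec p σ t τ) :
      Exec (.ite r p q) σ (t + 1) τ
  | ite_neg {r : ℕ} {p q : Prog} {σ τ : Mem} {t : ℕ} (hr : ¬ 0 < σ.reg r) (hq : Exec q σ t τ) :
      Exec (.ite r p q) σ (t + 1) τ
  | loop_pos {r : ℕ} {p : Prog} {σ τ ρ : Mem} {t u : ℕ} (hr : 0 < σ.reg r) (hp : Exec p σ t τ)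
      (hl : Exec (.loop r p) τ u ρ) : Exec (.loop r p) σ (t + u + 1) ρ
  | loop_neg {r : ℕ} {p : Prog} {σ : Mem} (hr : ¬ 0 < σ.reg r) : Exec (.loop r p) σ 1 σ

/-- The machine is deterministic, so that the number of steps is well defined. -/
theorem Exec.unique {p : Prog} {σ τ : Mem} {t : ℕ} (h : Exec p σ t τ) :
    ∀ {u : ℕ} {ρ : Mem}, Exec p σ u ρ → t = u ∧ τ = ρ := by
  induction h with
  | nop | const | arith | load | store => intro u ρ h'; cases h'; exact ⟨rfl, rfl⟩
  | seq _ _ ih₁ ih₂ =>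
    intro u ρ h'
    cases h' with
    | seq hp hq =>
      obtain ⟨rfl, rfl⟩ := ih₁ hp
      obtain ⟨rfl, rfl⟩ := ih₂ hq
      exact ⟨rfl, rfl⟩
  | ite_pos hr _ ih =>
    intro u ρ h'
    cases h' with
    | ite_pos _ hp => obtain ⟨rfl, rfl⟩ := ih hp; exact ⟨rfl, rfl⟩
    | ite_neg hn _ => exact absurd hr hn
  | ite_neg hr _ ih =>
    intro u ρ h'
    cases h' with
    | ite_pos hn _ => exact absurd hn hr
    | ite_neg _ hp => obtain ⟨rfl, rfl⟩ := ih hp; exact ⟨rfl, rfl⟩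
  | loop_pos hr _ _ ih₁ ih₂ =>
    intro u ρ h'
    cases h' with
    | loop_pos _ hp hq =>
      obtain ⟨rfl, rfl⟩ := ih₁ hp
      obtain ⟨rfl, rfl⟩ := ih₂ hq
      exact ⟨rfl, rfl⟩
    | loop_neg hn => exact absurd hr hn
  | loop_neg hr =>
    intro u ρ h'
    cases h' with
    | loop_pos hn _ _ => exact absurd hn hr
    | loop_neg _ => exact ⟨rfl, rfl⟩

/-- Number of steps of `p` started in the memory `σ` (`⊤` if `p` does not halt). -/
noncomputable def Prog.steps (p : Prog) (σ : Mem) : ℕ∞ :=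
  ⨅ (t : ℕ) (τ : Mem) (_ : Exec p σ t τ), (t : ℕ∞)

/-- The data of a mixed-integer program
`max {cᵀ x + dᵀ y : A x + B y = b, x ≥ 0, y ≥ 0, x ∈ ℤⁿ, y ∈ ℝˡ}`
with `m` equations, `n` integer variables and `l` continuous variables. -/
structure MIP (m n l : ℕ) where
  A : Matrix (Fin m) (Fin n) ℤ
  B : Matrix (Fin m) (Fin l) ℤ
  b : Fin m → ℤ
  c : Fin n → ℤ
  d : Fin l → ℤ

namespace MIP

variable {m n l : ℕ}

/-- `(x, y)` is a feasible point. -/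
def Feasible (I : MIP m n l) (x : Fin n → ℤ) (y : Fin l → ℝ) : Prop :=
  (I.A.map (Int.cast : ℤ → ℝ)) *ᵥ (fun j => (x j : ℝ)) + (I.B.map (Int.cast : ℤ → ℝ)) *ᵥ y
      = (fun i => (I.b i : ℝ)) ∧
    (∀ j, 0 ≤ x j) ∧ (∀ k, 0 ≤ y k)

/-- The objective value of `(x, y)`. -/
noncomputable def value (I : MIP m n l) (x : Fin n → ℤ) (y : Fin l → ℝ) : ℝ :=
  ∑ j, (I.c j : ℝ) * (x j : ℝ) + ∑ k, (I.d k : ℝ) * y k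

/-- `(x, y)` is an optimal solution. -/
def IsOptimal (I : MIP m n l) (x : Fin n → ℤ) (y : Fin l → ℝ) : Prop :=
  I.Feasible x y ∧ ∀ x' y', I.Feasible x' y' → I.value x' y' ≤ I.value x y

/-- There is no feasible point. -/
def IsInfeasible (I : MIP m n l) : Prop := ∀ x y, ¬ I.Feasible x y

/-- There are feasible points of arbitrarily large objective value. -/
def IsUnbounded (I : MIP m n l) : Prop := ∀ K : ℝ, ∃ x y, I.Feasible x y ∧ K < I.value x y

/-- All entries of `A` are at most `Δ`, and all entries of `B, b, c, d` at most `M`, in absolute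
value (`M = ⊤`: no condition on `B, b, c, d`). -/
def Bounded (I : MIP m n l) (Δ : ℕ) (M : ℕ∞) : Prop :=
  (∀ i j, (I.A i j).natAbs ≤ Δ) ∧ (∀ i k, ((I.B i k).natAbs : ℕ∞) ≤ M) ∧
    (∀ i, ((I.b i).natAbs : ℕ∞) ≤ M) ∧ (∀ j, ((I.c j).natAbs : ℕ∞) ≤ M) ∧
    (∀ k, ((I.d k).natAbs : ℕ∞) ≤ M)

/-- The memory `σ` holds the input `I`: the dimensions are in the registers 0, 1, 2, the matrices
(row by row) and vectors `A, B, b, c, d` in the arrays 0, …, 4. Nothing is assumed about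
the rest of the memory. -/
def Loaded (I : MIP m n l) (σ : Mem) : Prop :=
  σ.reg 0 = m ∧ σ.reg 1 = n ∧ σ.reg 2 = l ∧
    (∀ (i : Fin m) (j : Fin n), σ.arr 0 ((i : ℤ) * (n : ℤ) + (j : ℤ)) = I.A i j) ∧
    (∀ (i : Fin m) (k : Fin l), σ.arr 1 ((i : ℤ) * (l : ℤ) + (k : ℤ)) = I.B i k) ∧
    (∀ i : Fin m, σ.arr 2 (i : ℤ) = I.b i) ∧
    (∀ j : Fin n, σ.arr 3 (j : ℤ) = I.c j) ∧
    (∀ k : Fin l, σ.arr 4 (k : ℤ) = I.d k)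

/-- The memory `τ` holds a correct answer for `I`: register 0 is 0 if `I` is infeasible, 2 if `I`
is unbounded, and 1 if an optimal solution `(x, y)` is returned; then `x` is in array 0, the
numerators of the rational vector `y` are in array 1, and their common denominator is
in register 1. -/
def Answered (I : MIP m n l) (τ : Mem) : Prop :=
  (τ.reg 0 = 0 ∧ I.IsInfeasible) ∨
  (τ.reg 0 = 1 ∧ 0 < τ.reg 1 ∧
    I.IsOptimal (fun j => τ.arr 0 (j : ℤ)) (fun k => (τ.arr 1 (k : ℤ) : ℝ) / (τ.reg 1 : ℝ))) ∨
  (τ.reg 0 = 2 ∧ I.IsUnbounded)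

/-- The program `p` solves the instance `I`. -/
def SolvedBy (I : MIP m n l) (p : Prog) : Prop :=
  ∀ σ, I.Loaded σ → ∃ t τ, Exec p σ t τ ∧ I.Answered τ

/-- The number of integers in the input. -/
def size (_ : MIP m n l) : ℕ := 3 + m * n + m * l + m + n + l

/-- Running time of `p` on the input `I`: one unit for each integer of the input (loading it), and
one for each step. -/
noncomputable def time (I : MIP m n l) (p : Prog) : ℕ∞ :=
  (I.size : ℕ∞) + ⨆ (σ : Mem) (_ : I.Loaded σ), p.steps σ

end MIP

/-- Worst-case running time of `p` over all mixed-integer programs with `m` equations, `n` integer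
variables and `l` continuous variables whose data are bounded by `Δ` and `M`. -/
noncomputable def worstCaseTime (p : Prog) (m n l Δ : ℕ) (M : ℕ∞) : ℕ∞ :=
  ⨆ (I : MIP m n l) (_ : I.Bounded Δ M), I.time p

/-!
A vector with more than `m` large entries is redundant. By Siegel's lemma, any `m + 1` columns of `A`
satisfy a linear relation `A z = 0` with `|z j| ≤ u := ((m + 1) D) ^ m`, where `D ≤ Δ` is the largest
absolute value of an entry of `A` (or 1). Unless a nonnegative relation of this size improves the
objective (then the program is infeasible or unbounded), a feasible point with more than `m` entries
above `u` can be moved along a relation supported on them, without loss, until one of them drops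
to at most `u` (`exists_few_large`). So it suffices to consider `x = x₀ + z` with `0 ≤ x₀ ≤ u` and
`z ≥ 0` supported on `m` columns `s` (`MIP.exists_small_split`), and for given `x₀` and `s` the best
`(z, y)` is a solution of a program with only `m` integer variables and right-hand side `b - A x₀`
(`MIP.restrict`). The magnitude condition of the theorem makes the given algorithm `P` applicable
to it (`MIP.restrict_bounded`).

The restricted program depends on `x₀` only through `A x₀`, whose entries are bounded by `n D u`.
Reading vectors of this size as digits in the base `W = 2 n D u + 1` turns `A x₀` into a single
number, additively and injectively (`horner_sum`, `horner_injective`). A dynamic program (`Table`)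
finds, for each number `k` with `|k| ≤ W ^ m`, whether it is attained by a small `x₀`, and then one with
maximal `c x₀`. The entry for `k = 0` also tells whether a small nonnegative relation improves the
objective. The algorithm fills the table, and for all `n ^ m` choices of columns and all attained
codes it runs `P` on the restricted program and keeps the best answer. It takes
`O(W ^ m (u + 1) n ^ (m + 1))` times the worst-case time of `P`; the size of the input of `P` is part of
that time and pays for the preparation of the input. For `n ≤ m` no entry has to be large, and
`u = 0` will do.

The machine programs are written in a small structured language (`Cmd`) with expressions, counting
loops and calls of a machine program on a reserved part of the memory. Weakest preconditions that count
steps (`Cmd.wp`) are sound for the translation to machine programs (`Cmd.exec_code`), so that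
each command is specified by its result and a bound on its time.

Memory layout: registers 0–2 and arrays 0–4 hold the input, registers 3–7 and arrays 5–8 the parameters
and the table, register 8 the optimum for the code 0, registers 9–12 and arrays 11, 12 the
findings of the search. Registers 13–16 control the search, arrays 9, 10 hold the current columns and
the current vector, and registers 20–30 and 49 are local. Registers 50–99 are scratch space of the
translation. Registers from 100 and arrays from 40 on belong to `P`.
-/

/-! ### A structured language above the machine -/

/-- Arithmetic expressions over registers and array cells. -/
inductive RExpr where
  | reg (r : ℕ)
  | num (k : ℤ)
  | bin (o : ArithOp) (e f : RExpr)
  | get (a : ℕ) (e : RExpr)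

namespace RExpr

instance : Add RExpr := ⟨bin .add⟩
instance : Sub RExpr := ⟨bin .sub⟩
instance : Mul RExpr := ⟨bin .mul⟩
instance : Div RExpr := ⟨bin .div⟩
instance (k : ℕ) : OfNat RExpr k := ⟨num k⟩

/-- The value of an expression. -/
def eval : RExpr → Mem → ℤ
  | reg r, σ => σ.reg r
  | num k, _ => k
  | bin o e f, σ => o.eval (e.eval σ) (f.eval σ)
  | get a e, σ => σ.arr a (e.eval σ)

/-- The number of steps that the evaluation of an expression takes. -/
def cost : RExpr → ℕ
  | reg _ => 2
  | num _ => 1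
  | bin _ e f => e.cost + (f.cost + 1)
  | get _ e => e.cost + 1

/-- Code that evaluates an expression into register `t`, with registers from `t` upwards
as scratch space. -/
def code : RExpr → ℕ → Prog
  | reg r, t => .seq (.const t 0) (.arith .add t r t)
  | num k, t => .const t k
  | bin o e f, t => .seq (e.code t) (.seq (f.code (t + 1)) (.arith o t t (t + 1)))
  | get a e, t => .seq (e.code t) (.load t a t)

/-- The expression reads no scratch register (these are 50, …, 99), and `code` does not run out
of them. -/
def ok : RExpr → ℕ → Bool
  | reg r, t => (r < 50 || 100 ≤ r) && t < 100
  | num _, t => t < 100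
  | bin _ e f, t => e.ok t && f.ok (t + 1)
  | get _ e, t => e.ok t

@[simp] theorem eval_reg (r : ℕ) (σ : Mem) : (reg r).eval σ = σ.reg r := rfl
@[simp] theorem eval_get (a : ℕ) (e : RExpr) (σ : Mem) : (get a e).eval σ = σ.arr a (e.eval σ) :=
  rfl
@[simp] theorem eval_add (e f : RExpr) (σ : Mem) : (e + f).eval σ = e.eval σ + f.eval σ := rfl
@[simp] theorem eval_sub (e f : RExpr) (σ : Mem) : (e - f).eval σ = e.eval σ - f.eval σ := rfl
@[simp] theorem eval_mul (e f : RExpr) (σ : Mem) : (e * f).eval σ = e.eval σ * f.eval σ := rfl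
@[simp] theorem eval_div (e f : RExpr) (σ : Mem) : (e / f).eval σ = e.eval σ / f.eval σ := rfl
@[simp] theorem eval_two (σ : Mem) : (2 : RExpr).eval σ = 2 := rfl
@[simp] theorem eval_zero (σ : Mem) : (0 : RExpr).eval σ = 0 := rfl
@[simp] theorem eval_one (σ : Mem) : (1 : RExpr).eval σ = 1 := rfl
@[simp] theorem cost_reg (r : ℕ) : (reg r).cost = 2 := rfl
@[simp] theorem cost_get (a : ℕ) (e : RExpr) : (get a e).cost = e.cost + 1 := rfl
@[simp] theorem cost_add (e f : RExpr) : (e + f).cost = e.cost + (f.cost + 1) := rfl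
@[simp] theorem cost_sub (e f : RExpr) : (e - f).cost = e.cost + (f.cost + 1) := rfl
@[simp] theorem cost_mul (e f : RExpr) : (e * f).cost = e.cost + (f.cost + 1) := rfl
@[simp] theorem cost_div (e f : RExpr) : (e / f).cost = e.cost + (f.cost + 1) := rfl
@[simp] theorem cost_two : (2 : RExpr).cost = 1 := rfl
@[simp] theorem cost_zero : (0 : RExpr).cost = 1 := rfl
@[simp] theorem cost_one : (1 : RExpr).cost = 1 := rfl

end RExpr

namespace Mem

/-- Two memories agree up to the scratch registers. -/
def Agree (σ τ : Mem) : Prop := σ.arr = τ.arr ∧ ∀ r, r < 50 ∨ 100 ≤ r → σ.reg r = τ.reg r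

theorem Agree.refl (σ : Mem) : Agree σ σ := ⟨rfl, fun _ _ => rfl⟩

theorem Agree.trans {σ τ ρ : Mem} (h : Agree σ τ) (h' : Agree τ ρ) : Agree σ ρ :=
  ⟨h.1.trans h'.1, fun r hr => (h.2 r hr).trans (h'.2 r hr)⟩

@[simp] theorem reg_setReg (σ : Mem) (r s : ℕ) (v : ℤ) :
    (σ.setReg r v).reg s = if s = r then v else σ.reg s := by
  simp [setReg, Function.update_apply]

@[simp] theorem arr_setReg (σ : Mem) (r : ℕ) (v : ℤ) : (σ.setReg r v).arr = σ.arr := rfl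

@[simp] theorem reg_setArr (σ : Mem) (a : ℕ) (i v : ℤ) : (σ.setArr a i v).reg = σ.reg := rfl

@[simp] theorem arr_setArr (σ : Mem) (a b : ℕ) (i v z : ℤ) :
    (σ.setArr a i v).arr b z = if b = a ∧ z = i then v else σ.arr b z := by
  by_cases h : b = a
  · subst h; simp [setArr, Function.update_apply]
  · simp [setArr, h]

theorem arr_setArr_ne (σ : Mem) {a b : ℕ} (i v : ℤ) (h : b ≠ a) :
    (σ.setArr a i v).arr b = σ.arr b := by
  simp [setArr, h]

/-- The part of the memory that is reserved for a subroutine: registers from 100 and arrays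
from 40 on, renumbered from 0. -/
def inner (σ : Mem) : Mem := ⟨fun r => σ.reg (r + 100), fun a => σ.arr (a + 40)⟩

/-- Replace the part of the memory that is reserved for a subroutine. -/
def withInner (σ ρ : Mem) : Mem :=
  ⟨fun r => if r < 100 then σ.reg r else ρ.reg (r - 100),
    fun a => if a < 40 then σ.arr a else ρ.arr (a - 40)⟩

@[simp] theorem inner_withInner (σ ρ : Mem) : (σ.withInner ρ).inner = ρ := by
  simp [inner, withInner]

@[simp] theorem withInner_inner (σ : Mem) : σ.withInner σ.inner = σ := by
  rcases σ with ⟨f, g⟩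
  simp only [inner, withInner, Mem.mk.injEq]
  constructor
  · funext r; split_ifs with h
    · rfl
    · rw [Nat.sub_add_cancel (by omega)]
  · funext r; split_ifs with h
    · rfl
    · rw [Nat.sub_add_cancel (by omega)]

end Mem

/-- The program `p` with registers renumbered from 100 and arrays from 40 on. -/
def Prog.shift : Prog → Prog
  | .nop => .nop
  | .const r k => .const (r + 100) k
  | .arith o r s t => .arith o (r + 100) (s + 100) (t + 100)
  | .load r a i => .load (r + 100) (a + 40) (i + 100)
  | .store a i s => .store (a + 40) (i + 100) (s + 100)
  | .seq p q => .seq p.shift q.shift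
  | .ite r p q => .ite (r + 100) p.shift q.shift
  | .loop r p => .loop (r + 100) p.shift

theorem Mem.withInner_setReg (σ ρ : Mem) (r : ℕ) (v : ℤ) :
    (σ.withInner ρ).setReg (r + 100) v = σ.withInner (ρ.setReg r v) := by
  simp only [withInner, setReg, Mem.mk.injEq, and_true]
  funext s
  simp only [Function.update_apply]
  split_ifs <;> first | rfl | omega

theorem Mem.withInner_setArr (σ ρ : Mem) (a : ℕ) (i v : ℤ) :
    (σ.withInner ρ).setArr (a + 40) i v = σ.withInner (ρ.setArr a i v) := by
  simp only [withInner, setArr, Mem.mk.injEq, true_and]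
  funext s
  simp only [Function.update_apply]
  split_ifs <;> first | rfl | omega

/-- The renumbered program does to the reserved part of the memory what the program does to the
memory, and leaves the rest alone. -/
theorem Exec.shift {p : Prog} {ρ ρ' : Mem} {t : ℕ} (h : Exec p ρ t ρ') (σ : Mem) :
    Exec p.shift (σ.withInner ρ) t (σ.withInner ρ') := by
  have hreg : ∀ (ρ : Mem) r, (σ.withInner ρ).reg (r + 100) = ρ.reg r := by
    intro ρ r; simp [Mem.withInner]
  have harr : ∀ (ρ : Mem) a, (σ.withInner ρ).arr (a + 40) = ρ.arr a := by
    intro ρ r; simp [Mem.withInner]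
  induction h with
  | nop ρ => exact .nop _
  | const r k ρ => rw [← Mem.withInner_setReg]; exact .const _ _ _
  | arith o r s t ρ =>
    rw [← Mem.withInner_setReg, ← hreg ρ s, ← hreg ρ t]; exact .arith _ _ _ _ _
  | load r a i ρ =>
    rw [← Mem.withInner_setReg, ← hreg ρ i, ← harr ρ a]; exact .load _ _ _ _
  | store a i s ρ =>
    rw [← Mem.withInner_setArr, ← hreg ρ i, ← hreg ρ s]; exact .store _ _ _ _
  | seq _ _ ih₁ ih₂ => exact .seq ih₁ ih₂
  | ite_pos hr _ ih => exact .ite_pos (by rwa [hreg]) ih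
  | ite_neg hr _ ih => exact .ite_neg (by rwa [hreg]) ih
  | loop_pos hr _ _ ih₁ ih₂ => exact .loop_pos (by rwa [hreg]) ih₁ ih₂
  | loop_neg hr => exact .loop_neg (by rwa [hreg])

theorem RExpr.lt_of_ok (e : RExpr) : ∀ {t : ℕ}, e.ok t = true → t < 100 := by
  induction e with
  | reg r => intro t h; simp [ok] at h; omega
  | num k => intro t h; simpa [ok] using h
  | bin o e f ihe _ => intro t h; simp only [ok, Bool.and_eq_true] at h; exact ihe h.1
  | get a e ih => intro t h; exact ih h

/-- The code of an expression computes its value; it is correct even if the scratch registers of the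
actual memory `σ₀` differ from those of the memory `σ` that the value refers to. -/
theorem RExpr.exec_code (e : RExpr) : ∀ (t : ℕ) (σ₀ σ : Mem), e.ok t = true → 50 ≤ t →
    Mem.Agree σ₀ σ → ∃ τ, Exec (e.code t) σ₀ e.cost τ ∧ τ.arr = σ₀.arr ∧ τ.reg t = e.eval σ ∧
      ∀ r, r < t ∨ 100 ≤ r → τ.reg r = σ₀.reg r := by
  induction e with
  | reg r =>
    intro t σ₀ σ hok ht hσ
    simp only [ok, Bool.and_eq_true, Bool.or_eq_true, decide_eq_true_eq] at hok
    refine ⟨_, .seq (.const _ _ _) (.arith _ _ _ _ _), rfl, ?_, ?_⟩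
    · have : r ≠ t := by omega
      simp [ArithOp.eval, this, hσ.2 r hok.1]
    · intro s hs
      have : s ≠ t := by omega
      simp [this]
  | num k =>
    intro t σ₀ σ hok ht hσ
    simp only [ok, decide_eq_true_eq] at hok
    refine ⟨_, .const _ _ _, rfl, by simp [eval], ?_⟩
    intro s hs
    have : s ≠ t := by omega
    simp [this]
  | bin o e f ihe ihf =>
    intro t σ₀ σ hok ht hσ
    simp only [ok, Bool.and_eq_true] at hok
    obtain ⟨τ, h₁, h₂, h₃, h₄⟩ := ihe t σ₀ σ hok.1 ht hσ
    have hτ : Mem.Agree τ σ :=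
      Mem.Agree.trans ⟨h₂, fun r hr => h₄ r (by omega)⟩ hσ
    obtain ⟨ρ, g₁, g₂, g₃, g₄⟩ := ihf (t + 1) τ σ hok.2 (by omega) hτ
    have := lt_of_ok e hok.1
    refine ⟨_, (Exec.seq h₁ (Exec.seq g₁ (.arith _ _ _ _ _))), ?_, ?_, ?_⟩
    · simp [g₂, h₂]
    · simp [g₃, g₄ t (by omega), h₃, eval]
    · intro r hr
      have : r ≠ t := by omega
      simp [this, g₄ r (by omega), h₄ r hr]
  | get a e ih =>
    intro t σ₀ σ hok ht hσ
    obtain ⟨τ, h₁, h₂, h₃, h₄⟩ := ih t σ₀ σ hok ht hσ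
    have := lt_of_ok e hok
    refine ⟨_, (Exec.seq h₁ (.load _ _ _ _)), ?_, ?_, ?_⟩
    · simp [h₂]
    · simp [h₃, h₂, hσ.1]
    · intro r hr
      have : r ≠ t := by omega
      simp [this, h₄ r hr]

/-- Structured commands: assignments, counting loops and calls of a subroutine. -/
inductive Cmd where
  /-- assign a register -/
  | set (r : ℕ) (e : RExpr)
  /-- assign an array cell -/
  | put (a : ℕ) (e f : RExpr)
  | seq (c d : Cmd)
  /-- test whether the value of an expression is positive -/
  | ite (e : RExpr) (c d : Cmd)
  /-- `for i = 0, …, h - 1` where `i` and `h` are registers -/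
  | loop (i h : ℕ) (c : Cmd)
  /-- run a program on the part of the memory reserved for it -/
  | call (p : Prog)

namespace Cmd

/-- Whether a command may change register `r`, apart from scratch registers. -/
def wr : Cmd → ℕ → Bool
  | set s _, r => s == r
  | put _ _ _, _ => false
  | seq c d, r => c.wr r || d.wr r
  | ite _ c d, r => c.wr r || d.wr r
  | loop i _ c, r => i == r || c.wr r
  | call _, r => 100 ≤ r

/-- Whether a command may change array `b`. -/
def wa : Cmd → ℕ → Bool
  | set _ _, _ => false
  | put a _ _, b => a == b
  | seq c d, b => c.wa b || d.wa b
  | ite _ c d, b => c.wa b || d.wa b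
  | loop _ _ c, b => c.wa b
  | call _, b => 40 ≤ b

/-- Static conditions: expressions and assignments respect the scratch space, and loop bodies change
neither the counter nor the bound. -/
def ok : Cmd → Bool
  | set r e => (r < 50 || 100 ≤ r) && e.ok 50
  | put _ e f => e.ok 50 && f.ok 51
  | seq c d => c.ok && d.ok
  | ite e c d => e.ok 50 && c.ok && d.ok
  | loop i h c => i < 50 && h < 50 && i != h && !c.wr i && !c.wr h && c.ok
  | call _ => true

/-- The machine program of a command. -/
def code : Cmd → Prog
  | set r e => .seq (e.code 50) (.seq (.const 51 0) (.arith .add r 50 51))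
  | put a e f => .seq (e.code 50) (.seq (f.code 51) (.store a 50 51))
  | seq c d => .seq c.code d.code
  | ite e c d => .seq (e.code 50) (.ite 50 c.code d.code)
  | loop i h c => .seq (.const i 0) (.seq (.arith .sub 50 h i) (.loop 50
      (.seq c.code (.seq (.const 50 1) (.seq (.arith .add i i 50) (.arith .sub 50 h i))))))
  | call p => p.shift

/-- Iteration of a predicate transformer, for the meaning of a loop with counter `i`. -/
def wpLoop (w : (ℕ → Mem → Prop) → Mem → Prop) (i : ℕ) :
    ℕ → (ℕ → Mem → Prop) → Mem → Prop
  | 0, Q, σ => Q 1 σ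
  | N + 1, Q, σ => w (fun t τ => wpLoop w i N (fun u ρ => Q (t + 3 + u + 1) ρ)
      (τ.setReg i (τ.reg i + 1))) σ

/-- Weakest precondition: `c.wp Q σ` says that `c`, started in `σ`, halts after some number `t` of
steps in some memory `τ` with `Q t τ`. Scratch registers are left out of account. -/
def wp : Cmd → (ℕ → Mem → Prop) → Mem → Prop
  | set r e, Q, σ => Q (e.cost + 2) (σ.setReg r (e.eval σ))
  | put a e f, Q, σ => Q (e.cost + (f.cost + 1)) (σ.setArr a (e.eval σ) (f.eval σ))
  | seq c d, Q, σ => c.wp (fun t τ => d.wp (fun u ρ => Q (t + u) ρ) τ) σ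
  | ite e c d, Q, σ => (0 < e.eval σ → c.wp (fun t τ => Q (e.cost + (t + 1)) τ) σ) ∧
      (¬ 0 < e.eval σ → d.wp (fun t τ => Q (e.cost + (t + 1)) τ) σ)
  | loop i h c, Q, σ =>
      wpLoop c.wp i (σ.reg h).toNat (fun t τ => Q (1 + (1 + t)) τ) (σ.setReg i 0)
  | call p, Q, σ => ∃ t ρ, Exec p σ.inner t ρ ∧ Q t (σ.withInner ρ)

theorem wpLoop_mono {w : (ℕ → Mem → Prop) → Mem → Prop}
    (hw : ∀ (Q R : ℕ → Mem → Prop) σ, (∀ t τ, Q t τ → R t τ) → w Q σ → w R σ)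
    (i N : ℕ) : ∀ {Q R : ℕ → Mem → Prop} {σ}, (∀ t τ, Q t τ → R t τ) →
      wpLoop w i N Q σ → wpLoop w i N R σ := by
  induction N with
  | zero => intro Q R σ h; exact h _ _
  | succ N ih => intro Q R σ h; exact hw _ _ _ fun t τ => ih fun u ρ => h _ _

theorem wp_mono (c : Cmd) : ∀ {Q R : ℕ → Mem → Prop} {σ : Mem}, (∀ t τ, Q t τ → R t τ) →
    c.wp Q σ → c.wp R σ := by
  induction c with
  | set | put => intro Q R σ h; exact h _ _
  | seq c d ihc ihd => intro Q R σ h; exact ihc fun t τ => ihd fun u ρ => h _ _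
  | ite e c d ihc ihd =>
    intro Q R σ h hc
    exact ⟨fun he => ihc (fun _ _ => h _ _) (hc.1 he), fun he => ihd (fun _ _ => h _ _) (hc.2 he)⟩
  | loop i h c ih =>
    intro Q R σ h hc
    exact wpLoop_mono (w := c.wp) (fun _ _ _ h => ih h) _ _ (fun _ _ => h _ _) hc
  | call p =>
    rintro Q R σ h ⟨t, ρ, h₁, h₂⟩
    exact ⟨t, ρ, h₁, h _ _ h₂⟩

/-- `τ` differs from `σ` only where `c` may write. -/
structure Frame (c : Cmd) (σ τ : Mem) : Prop where
  reg : ∀ r, c.wr r = false → τ.reg r = σ.reg r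
  arr : ∀ a, c.wa a = false → τ.arr a = σ.arr a

/-- A command changes the memory only where it may write. -/
theorem wp_frame (c : Cmd) : ∀ {Q : ℕ → Mem → Prop} {σ : Mem}, c.wp Q σ →
    c.wp (fun t τ => Q t τ ∧ c.Frame σ τ) σ := by
  induction c with
  | set r e =>
    intro Q σ h
    refine ⟨h, fun s hs => ?_, fun a _ => rfl⟩
    have : s ≠ r := by rintro rfl; simp [wr] at hs
    simp [this]
  | put a e f =>
    intro Q σ h
    refine ⟨h, fun s hs => rfl, fun b hb => ?_⟩
    have : b ≠ a := by rintro rfl; simp [wa] at hb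
    exact Mem.arr_setArr_ne _ _ _ this
  | seq c d ihc ihd =>
    intro Q σ h
    refine wp_mono c ?_ (ihc h)
    rintro t τ ⟨h₁, h₂⟩
    refine wp_mono d ?_ (ihd h₁)
    rintro u ρ ⟨h₃, h₄⟩
    refine ⟨h₃, fun r hr => ?_, fun a ha => ?_⟩
    · simp only [wr, Bool.or_eq_false_iff] at hr
      rw [h₄.reg r hr.2, h₂.reg r hr.1]
    · simp only [wa, Bool.or_eq_false_iff] at ha
      rw [h₄.arr a ha.2, h₂.arr a ha.1]
  | ite e c d ihc ihd =>
    intro Q σ h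
    refine ⟨fun he => wp_mono c ?_ (ihc (h.1 he)), fun he => wp_mono d ?_ (ihd (h.2 he))⟩ <;>
    · rintro t τ ⟨h₁, h₂⟩
      refine ⟨h₁, fun r hr => ?_, fun a ha => ?_⟩
      · simp only [wr, Bool.or_eq_false_iff] at hr
        exact h₂.reg r (by simp [hr])
      · simp only [wa, Bool.or_eq_false_iff] at ha
        exact h₂.arr a (by simp [ha])
  | loop i h c ih =>
    have key : ∀ N (Q : ℕ → Mem → Prop) σ, wpLoop c.wp i N Q σ →
        wpLoop c.wp i N (fun t τ => Q t τ ∧ (loop i h c).Frame σ τ) σ := by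
      intro N
      induction N with
      | zero => intro Q σ hQ; exact ⟨hQ, fun _ _ => rfl, fun _ _ => rfl⟩
      | succ N ihN =>
        intro Q σ hQ
        refine wp_mono c ?_ (ih hQ)
        rintro t τ ⟨h₁, h₂⟩
        refine wpLoop_mono (w := c.wp) (fun _ _ _ h => wp_mono c h) i N ?_ (ihN _ _ h₁)
        rintro u ρ ⟨h₃, h₄⟩
        refine ⟨h₃, fun r hr => ?_, fun a ha => ?_⟩
        · have hr' := hr
          simp only [wr, Bool.or_eq_false_iff, beq_eq_false_iff_ne] at hr'
          rw [h₄.reg r hr, Mem.reg_setReg, if_neg (Ne.symm hr'.1), h₂.reg r hr'.2]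
        · rw [h₄.arr a ha, Mem.arr_setReg, h₂.arr a ha]
    intro Q σ hQ
    refine wpLoop_mono (w := c.wp) (fun _ _ _ h => wp_mono c h) i _ ?_ (key _ _ _ hQ)
    rintro u ρ ⟨h₃, h₄⟩
    refine ⟨h₃, fun r hr => ?_, fun a ha => ?_⟩
    · have hr' := hr
      simp only [wr, Bool.or_eq_false_iff, beq_eq_false_iff_ne] at hr'
      rw [h₄.reg r hr, Mem.reg_setReg, if_neg (Ne.symm hr'.1)]
    · rw [h₄.arr a ha, Mem.arr_setReg]
  | call p =>
    rintro Q σ ⟨t, ρ, h₁, h₂⟩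
    refine ⟨t, ρ, h₁, h₂, fun r hr => ?_, fun a ha => ?_⟩
    · simp only [wr, decide_eq_false_iff_not, not_le] at hr
      simp [Mem.withInner, hr]
    · simp only [wa, decide_eq_false_iff_not, not_le] at ha
      simp [Mem.withInner, ha]

/-- The rule for counting loops: an invariant `Inv k t τ` may speak of the number `k` of completed
rounds and of the time `t` spent so far. -/
theorem wp_loop {i h : ℕ} {c : Cmd} {Q : ℕ → Mem → Prop} {σ : Mem}
    (hok : (loop i h c).ok = true) (n : ℕ) (hn : σ.reg h = n) (Inv : ℕ → ℕ → Mem → Prop)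
    (h0 : Inv 0 3 (σ.setReg i 0))
    (hs : ∀ k, k < n → ∀ t τ, τ.reg i = (k : ℤ) → (loop i h c).Frame σ τ → Inv k t τ →
      c.wp (fun u τ' => Inv (k + 1) (t + u + 4) (τ'.setReg i (k + 1))) τ)
    (hQ : ∀ t τ, τ.reg i = (n : ℤ) → (loop i h c).Frame σ τ → Inv n t τ → Q t τ) :
    (loop i h c).wp Q σ := by
  simp only [ok, Bool.and_eq_true, decide_eq_true_eq, bne_iff_ne, Bool.not_eq_true'] at hok
  obtain ⟨⟨⟨⟨⟨_, _⟩, _⟩, hwi⟩, _⟩, _⟩ := hok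
  have key : ∀ (N k t : ℕ) (τ : Mem), k + N = n → τ.reg i = (k : ℤ) → (loop i h c).Frame σ τ → Inv k t τ →
      ∀ R : ℕ → Mem → Prop, (∀ t' τ, τ.reg i = (n : ℤ) → (loop i h c).Frame σ τ →
        Inv n (t + t') τ → R (t' + 1) τ) →
      wpLoop c.wp i N R τ := by
    intro N
    induction N with
    | zero =>
      intro k t τ hk hi hF hI R hR
      obtain rfl : k = n := by omega
      exact hR 0 τ hi hF hI
    | succ N ihN =>
      intro k t τ hk hi hF hI R hR
      refine wp_mono c ?_ (wp_frame c (hs k (by omega) t τ hi hF hI))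
      rintro u τ' ⟨h₁, h₂⟩
      have hi' : τ'.reg i = k := by rw [h₂.reg i hwi, hi]
      rw [hi']
      refine ihN (k + 1) (t + u + 4) _ (by omega) (by simp) ?_ h₁ _ ?_
      · refine ⟨fun r hr => ?_, fun a ha => ?_⟩
        · have hr' := hr
          simp only [wr, Bool.or_eq_false_iff, beq_eq_false_iff_ne] at hr'
          rw [Mem.reg_setReg, if_neg (Ne.symm hr'.1), h₂.reg r hr'.2, hF.reg r hr]
        · rw [Mem.arr_setReg, h₂.arr a ha, hF.arr a ha]
      · intro t' ρ g₁ g₂ g₃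
        have := hR (u + t' + 4) ρ g₁ g₂ (by convert g₃ using 1; omega)
        convert this using 1; omega
  have hF0 : (loop i h c).Frame σ (σ.setReg i 0) := by
    refine ⟨fun r hr => ?_, fun a ha => rfl⟩
    simp only [wr, Bool.or_eq_false_iff, beq_eq_false_iff_ne] at hr
    rw [Mem.reg_setReg, if_neg (Ne.symm hr.1)]
  have := key n 0 3 (σ.setReg i 0) (by omega) (by simp) hF0 h0
    (fun t τ => Q (1 + (1 + t)) τ) (by
      intro t' τ h₁ h₂ h₃
      have := hQ _ τ h₁ h₂ h₃
      convert this using 1; omega)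
  simpa only [wp, hn, Int.toNat_natCast] using this

/-- The meaning of a command is what its machine program does. -/
theorem exec_code (c : Cmd) : ∀ {Q : ℕ → Mem → Prop} {σ₀ σ : Mem}, c.ok = true →
    Mem.Agree σ₀ σ → c.wp Q σ →
    ∃ t τ₀ τ, Exec c.code σ₀ t τ₀ ∧ Mem.Agree τ₀ τ ∧ Q t τ := by
  induction c with
  | set r e =>
    intro Q σ₀ σ hok hA hQ
    simp only [ok, Bool.and_eq_true, Bool.or_eq_true, decide_eq_true_eq] at hok
    obtain ⟨τ, h₁, h₂, h₃, h₄⟩ := e.exec_code 50 σ₀ σ hok.2 le_rfl hA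
    refine ⟨_, _, _, .seq h₁ (.seq (.const _ _ _) (.arith _ _ _ _ _)), ⟨?_, ?_⟩, hQ⟩
    · simp [h₂, hA.1]
    · intro s hs
      have : s ≠ 51 := by omega
      by_cases hsr : s = r
      · simp [hsr, h₃, ArithOp.eval]
      · simp [hsr, this, h₄ s hs, hA.2 s hs]
  | put a e f =>
    intro Q σ₀ σ hok hA hQ
    simp only [ok, Bool.and_eq_true] at hok
    obtain ⟨τ, h₁, h₂, h₃, h₄⟩ := e.exec_code 50 σ₀ σ hok.1 le_rfl hA
    obtain ⟨ρ, g₁, g₂, g₃, g₄⟩ := f.exec_code 51 τ σ hok.2 (by norm_num)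
      (Mem.Agree.trans ⟨h₂, fun r hr => h₄ r hr⟩ hA)
    refine ⟨_, _, _, .seq h₁ (.seq g₁ (.store _ _ _ _)), ⟨?_, ?_⟩, hQ⟩
    · funext b
      simp only [Mem.setArr, g₃, g₄ 50 (by norm_num), h₃, g₂, h₂, hA.1]
    · intro s hs
      simp [g₄ s (by omega), h₄ s hs, hA.2 s hs]
  | seq c d ihc ihd =>
    intro Q σ₀ σ hok hA hQ
    simp only [ok, Bool.and_eq_true] at hok
    obtain ⟨t, τ₀, τ, h₁, h₂, h₃⟩ := ihc hok.1 hA hQ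
    obtain ⟨u, ρ₀, ρ, g₁, g₂, g₃⟩ := ihd hok.2 h₂ h₃
    exact ⟨_, _, _, .seq h₁ g₁, g₂, g₃⟩
  | ite e c d ihc ihd =>
    intro Q σ₀ σ hok hA hQ
    simp only [ok, Bool.and_eq_true] at hok
    obtain ⟨τ, h₁, h₂, h₃, h₄⟩ := e.exec_code 50 σ₀ σ hok.1.1 le_rfl hA
    have hA' : Mem.Agree τ σ := Mem.Agree.trans ⟨h₂, fun r hr => h₄ r hr⟩ hA
    by_cases he : 0 < e.eval σ
    · obtain ⟨t, τ₀, τ, g₁, g₂, g₃⟩ := ihc hok.1.2 hA' (hQ.1 he)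
      exact ⟨_, _, _, .seq h₁ (.ite_pos (by rwa [h₃]) g₁), g₂, g₃⟩
    · obtain ⟨t, τ₀, τ, g₁, g₂, g₃⟩ := ihd hok.2 hA' (hQ.2 he)
      exact ⟨_, _, _, .seq h₁ (.ite_neg (by rwa [h₃]) g₁), g₂, g₃⟩
  | loop i h c ih =>
    intro Q σ₀ σ hok hA hQ
    simp only [ok, Bool.and_eq_true, decide_eq_true_eq, bne_iff_ne, Bool.not_eq_true'] at hok
    obtain ⟨⟨⟨⟨⟨hi, hh⟩, hih⟩, hwi⟩, hwh⟩, hc⟩ := hok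
    have key : ∀ N (R : ℕ → Mem → Prop) (τ₀ τ : Mem), Mem.Agree τ₀ τ →
        (τ.reg h - τ.reg i).toNat = N → τ₀.reg 50 = τ.reg h - τ.reg i →
        wpLoop c.wp i N R τ → ∃ t ρ₀ ρ, Exec (.loop 50
          (.seq c.code (.seq (.const 50 1) (.seq (.arith .add i i 50) (.arith .sub 50 h i)))))
          τ₀ t ρ₀ ∧ Mem.Agree ρ₀ ρ ∧ R t ρ := by
      intro N
      induction N with
      | zero =>
        intro R τ₀ τ hA hN h50 hw
        exact ⟨1, τ₀, τ, .loop_neg (by omega), hA, hw⟩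
      | succ N ihN =>
        intro R τ₀ τ hA hN h50 hw
        obtain ⟨t, τ₁, τ', h₁, h₂, h₃, h₄⟩ := ih hc hA (wp_frame c hw)
        have e₁ : τ'.reg i = τ.reg i := h₄.reg i hwi
        have e₂ : τ'.reg h = τ.reg h := h₄.reg h hwh
        have f₁ : τ₁.reg i = τ'.reg i := h₂.2 i (.inl hi)
        have f₂ : τ₁.reg h = τ'.reg h := h₂.2 h (.inl hh)
        have n₁ : i ≠ 50 := by omega
        have n₂ : h ≠ 50 := by omega
        have n₃ : h ≠ i := Ne.symm hih
        have hA' : Mem.Agree (((τ₁.setReg 50 1).setReg i (τ'.reg i + 1)).setReg 50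
            (τ'.reg h - (τ'.reg i + 1))) (τ'.setReg i (τ'.reg i + 1)) := by
          refine ⟨by simpa using h₂.1, fun r hr => ?_⟩
          have : r ≠ 50 := by omega
          by_cases hri : r = i
          · simp [hri, n₁]
          · simp [this, hri, h₂.2 r hr]
        obtain ⟨u, ρ₀, ρ, g₁, g₂, g₃⟩ := ihN _ _ _ hA' (by simp [n₃]; omega) (by simp [n₃]) h₃
        refine ⟨t + 3 + u + 1, ρ₀, ρ, .loop_pos (by omega) (.seq h₁ (.seq (.const _ _ _)
          (.seq (.arith _ _ _ _ _) (.arith _ _ _ _ _)))) ?_, g₂, g₃⟩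
        simpa [ArithOp.eval, n₁, n₂, n₃, f₁, f₂] using g₁
    have n₃ : h ≠ i := Ne.symm hih
    have hA' : Mem.Agree ((σ₀.setReg i 0).setReg 50 (σ.reg h)) (σ.setReg i 0) := by
      refine ⟨by simp [hA.1], fun r hr => ?_⟩
      have : r ≠ 50 := by omega
      simp [this, hA.2 r hr]
    obtain ⟨t, ρ₀, ρ, g₁, g₂, g₃⟩ := key (σ.reg h).toNat _ _ _ hA' (by simp [n₃]) (by simp [n₃]) hQ
    refine ⟨_, _, _, .seq (.const _ _ _) (.seq (.arith _ _ _ _ _) ?_), g₂, g₃⟩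
    simpa [ArithOp.eval, n₃, hA.2 h (.inl hh)] using g₁
  | call p =>
    rintro Q σ₀ σ hok hA ⟨t, ρ, h₁, h₂⟩
    have : σ₀.inner = σ.inner := by
      simp only [Mem.inner, Mem.mk.injEq, hA.1, and_true]
      funext r; exact hA.2 _ (.inr (by omega))
    rw [← this] at h₁
    refine ⟨t, σ₀.withInner ρ, σ.withInner ρ, ?_, ⟨?_, ?_⟩, h₂⟩
    · have := h₁.shift σ₀
      rwa [Mem.withInner_inner] at this
    · simp [Mem.withInner, hA.1]
    · intro r hr
      by_cases h : r < 100
      · have : r < 50 ∨ 100 ≤ r := hr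
        simp [Mem.withInner, h, hA.2 r hr]
      · simp [Mem.withInner, h]

end Cmd

/-! ### Few large entries suffice -/

open scoped Matrix.Norms.Elementwise in
/-- Siegel's lemma on `m + 1` columns: among more than `m` columns of an integer matrix with `m` rows
there is a linear relation with small coefficients. -/
theorem exists_small_kernel_vector {m n : ℕ} (A : Matrix (Fin m) (Fin n) ℤ) {D : ℕ} (hD : 1 ≤ D)
    (hA : ∀ i j, (A i j).natAbs ≤ D) (T : Finset (Fin n)) (hT : m < T.card) :
    ∃ z : Fin n → ℤ, z ≠ 0 ∧ A *ᵥ z = 0 ∧ (∀ j, j ∉ T → z j = 0) ∧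
      ∀ j, |z j| ≤ ((((m + 1) * D) ^ m : ℕ) : ℤ) := by
  classical
  rcases Nat.eq_zero_or_pos m with rfl | hm
  · obtain ⟨j, hj⟩ := Finset.card_pos.1 hT
    refine ⟨Pi.single j 1, by simp, funext fun i => i.elim0, fun k hk => ?_, fun k => ?_⟩
    · have : k ≠ j := by rintro rfl; exact hk hj
      simp [this]
    · by_cases h : k = j
      · subst h; simp
      · simp [h]
  obtain ⟨S, hST, hS⟩ := Finset.exists_subset_card_eq (n := m + 1) (s := T) hT
  let e : Fin (m + 1) ≃ S := (S.equivFinOfCardEq hS).symm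
  obtain ⟨t, ht0, htA, htn⟩ := Int.Matrix.exists_ne_zero_int_vec_norm_le
    (A.submatrix id (fun i => (e i : Fin n))) (by simp) (by simpa using hm)
  have hnorm : max 1 ‖A.submatrix id (fun i => (e i : Fin n))‖ ≤ (D : ℝ) := by
    refine max_le (by exact_mod_cast hD) ?_
    rw [Matrix.norm_le_iff (by positivity)]
    intro i j
    rw [Int.norm_eq_abs, ← Int.cast_abs, Int.abs_eq_natAbs]
    exact_mod_cast hA _ _
  have hbound : ∀ i, |t i| ≤ ((((m + 1) * D) ^ m : ℕ) : ℤ) := by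
    intro i
    have h1 : ‖t i‖ ≤ ((m + 1 : ℕ) * (D : ℝ)) ^ m := by
      refine (norm_le_pi_norm t i).trans (htn.trans ?_)
      have : ((Fintype.card (Fin m) : ℝ) / (Fintype.card (Fin (m + 1)) - Fintype.card (Fin m)))
          = (m : ℝ) := by simp
      rw [this, Real.rpow_natCast, Fintype.card_fin]
      gcongr
    rw [Int.norm_eq_abs, ← Int.cast_abs] at h1
    exact_mod_cast h1
  refine ⟨fun j => if h : j ∈ S then t (e.symm ⟨j, h⟩) else 0, ?_, ?_, ?_, ?_⟩
  · obtain ⟨i, hi⟩ := Function.ne_iff.1 ht0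
    refine Function.ne_iff.2 ⟨e i, ?_⟩
    simpa using hi
  · rw [← htA]
    funext i
    simp only [Matrix.mulVec, dotProduct, Matrix.submatrix_apply, id]
    have : ∑ j, A i j * (if h : j ∈ S then t (e.symm ⟨j, h⟩) else 0)
        = ∑ j ∈ S.attach, A i j * t (e.symm j) := by
      rw [← Finset.sum_subset (Finset.subset_univ S), ← Finset.sum_attach]
      · refine Finset.sum_congr rfl fun j _ => ?_
        simp
      · intro j _ hj
        simp [hj]
    rw [this, ← Finset.univ_eq_attach]
    exact (e.sum_comp (fun j : S => A i j * t (e.symm j))).symm.trans (by simp)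
  · intro j hj
    have : j ∉ S := fun h => hj (hST h)
    simp [this]
  · intro j
    by_cases h : j ∈ S
    · simpa [h] using hbound _
    · simp [h]

/-- Unless a small nonnegative kernel vector improves the objective, every nonnegative integer vector
can be moved along kernel vectors, without loss in the objective, to one with at most `m`
entries above `u`: while there are more, the large entries carry a small kernel vector,
and moving along it makes one of them small. -/
theorem exists_few_large {m n : ℕ} (A : Matrix (Fin m) (Fin n) ℤ) (c : Fin n → ℤ) (u : ℤ)
    (hu : ∀ T : Finset (Fin n), m < T.card → ∃ z : Fin n → ℤ, z ≠ 0 ∧ A *ᵥ z = 0 ∧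
      (∀ j, j ∉ T → z j = 0) ∧ ∀ j, |z j| ≤ u)
    (hc : ∀ z : Fin n → ℤ, A *ᵥ z = 0 → (∀ j, 0 ≤ z j) → (∀ j, z j ≤ u) → c ⬝ᵥ z ≤ 0)
    (x : Fin n → ℤ) (hx : ∀ j, 0 ≤ x j) :
    ∃ x' : Fin n → ℤ, (∀ j, 0 ≤ x' j) ∧ A *ᵥ x' = A *ᵥ x ∧ c ⬝ᵥ x ≤ c ⬝ᵥ x' ∧
      (Finset.univ.filter fun j => u < x' j).card ≤ m := by
  induction hN : (Finset.univ.filter fun j => u < x j).card using Nat.strong_induction_on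
    generalizing x with
  | _ N ih =>
  by_cases hNm : N ≤ m
  · exact ⟨x, hx, rfl, le_rfl, hN ▸ hNm⟩
  set T := Finset.univ.filter fun j => u < x j with hTdef
  obtain ⟨z, hz0, hzA, hzT, hzu, hzc, k, hk⟩ : ∃ z : Fin n → ℤ, z ≠ 0 ∧ A *ᵥ z = 0 ∧
      (∀ j, j ∉ T → z j = 0) ∧ (∀ j, |z j| ≤ u) ∧ 0 ≤ c ⬝ᵥ z ∧ ∃ k, z k < 0 := by
    obtain ⟨z, hz0, hzA, hzT, hzu⟩ := hu T (by omega)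
    wlog hcz : 0 ≤ c ⬝ᵥ z generalizing z
    · exact this (-z) (by simpa using hz0) (by simp [Matrix.mulVec_neg, hzA])
        (fun j hj => by simp [hzT j hj]) (fun j => by simpa using hzu j)
        (by rw [dotProduct_neg]; omega)
    by_cases hneg : ∃ k, z k < 0
    · exact ⟨z, hz0, hzA, hzT, hzu, hcz, hneg⟩
    push Not at hneg
    have hcz0 := hc z hzA hneg fun j => (le_abs_self _).trans (hzu j)
    refine ⟨-z, by simpa using hz0, by simp [Matrix.mulVec_neg, hzA],
        (fun j hj => by simp [hzT j hj]), (fun j => by simpa using hzu j),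
        (by rw [dotProduct_neg]; omega), ?_⟩
    obtain ⟨k, hk⟩ := Function.ne_iff.1 hz0
    have := hneg k
    have hk' : z k ≠ 0 := hk
    exact ⟨k, by simp; omega⟩
  have hkT : k ∈ T := by by_contra h; have := hzT k h; omega
  have hex : ∃ s : ℕ, ∃ j ∈ T, x j + s * z j ≤ u := by
    have hxk := hx k
    have hu0 := (abs_nonneg _).trans (hzu k)
    refine ⟨(x k).toNat, k, hkT, ?_⟩
    rw [Int.toNat_of_nonneg hxk]
    nlinarith
  classical
  let s := Nat.find hex
  obtain ⟨j₀, hj₀, hs⟩ := Nat.find_spec hex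
  have hspos : 0 < s := by
    rcases Nat.eq_zero_or_pos s with h | h
    · have h0 : Nat.find hex = 0 := h
      rw [h0] at hs
      simp only [hTdef, Finset.mem_filter] at hj₀
      simp at hs
      omega
    · exact h
  have hmin : ∀ j ∈ T, u < x j + ((s - 1 : ℕ) : ℤ) * z j := by
    intro j hj
    have := Nat.find_min hex (m := s - 1) (by omega)
    push Not at this
    exact this j hj
  have hcast : ((s - 1 : ℕ) : ℤ) = (s : ℤ) - 1 := by omega
  have hnn : ∀ j, 0 ≤ x j + (s : ℤ) * z j := by
    intro j
    by_cases hj : j ∈ T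
    · have h1 := hmin j hj
      have h2 := (abs_le.1 (hzu j)).1
      rw [hcast] at h1
      nlinarith
    · rw [hzT j hj]; simpa using hx j
  have hlt : (Finset.univ.filter fun j => u < x j + (s : ℤ) * z j).card < N := by
    rw [← hN]
    refine Finset.card_lt_card (Finset.ssubset_iff_subset_ne.2 ⟨fun j hj => ?_, fun h => ?_⟩)
    · by_contra hjT
      simp only [Finset.mem_filter, Finset.mem_univ, true_and] at hj
      rw [hzT j hjT] at hj
      exact hjT (by simp [hTdef]; omega)
    · rw [← h] at hj₀
      simp only [Finset.mem_filter, Finset.mem_univ, true_and] at hj₀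
      exact absurd hs (not_le.2 hj₀)
  obtain ⟨x', h1, h2, h3, h4⟩ := ih _ hlt (fun j => x j + (s : ℤ) * z j) hnn rfl
  have e : (fun j => x j + (s : ℤ) * z j) = x + (s : ℤ) • z := by funext j; simp
  rw [e] at h2 h3
  refine ⟨x', h1, ?_, le_trans ?_ h3, h4⟩
  · rw [h2, Matrix.mulVec_add, Matrix.mulVec_smul, hzA]; simp
  · rw [dotProduct_add, dotProduct_smul]
    have : 0 ≤ (s : ℤ) • (c ⬝ᵥ z) := by positivity
    omega

/-! ### Positional encoding of columns -/

/-- The number with digits `v 0, …, v (k - 1)` in base `W`. -/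
def horner (W : ℤ) (v : ℕ → ℤ) : ℕ → ℤ
  | 0 => 0
  | k + 1 => horner W v k * W + v k

theorem horner_sum {ι : Type*} (W : ℤ) (s : Finset ι) (v : ι → ℕ → ℤ) (x : ι → ℤ) (k : ℕ) :
    ∑ j ∈ s, horner W (v j) k * x j = horner W (fun i => ∑ j ∈ s, v j i * x j) k := by
  induction k with
  | zero => simp [horner]
  | succ k ih =>
    simp only [horner]
    rw [← ih, Finset.sum_mul, ← Finset.sum_add_distrib]
    exact Finset.sum_congr rfl fun j _ => by ring

theorem horner_abs_le {V : ℤ} {v : ℕ → ℤ} {k : ℕ} (hv : ∀ i < k, |v i| ≤ V) :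
    2 * |horner (2 * V + 1) v k| + 1 ≤ (2 * V + 1) ^ k := by
  induction k with
  | zero => simp [horner]
  | succ k ih =>
    have h1 := ih fun i hi => hv i (by omega)
    have h2 := hv k (by omega)
    have hV : 0 ≤ V := (abs_nonneg _).trans h2
    have h3 : |horner (2 * V + 1) v k * (2 * V + 1) + v k| ≤
        |horner (2 * V + 1) v k| * (2 * V + 1) + V := by
      refine (abs_add_le _ _).trans ?_
      rw [abs_mul, abs_of_nonneg (by omega : 0 ≤ 2 * V + 1)]
      omega
    simp only [horner]
    rw [pow_succ]
    nlinarith [mul_le_mul_of_nonneg_right h1 (by omega : 0 ≤ 2 * V + 1)]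

/-- In the odd base `2 V + 1`, digits in `[-V, V]` are determined by the number. -/
theorem horner_injective {V : ℤ} {v w : ℕ → ℤ} {k : ℕ} (hv : ∀ i < k, |v i| ≤ V)
    (hw : ∀ i < k, |w i| ≤ V) (h : horner (2 * V + 1) v k = horner (2 * V + 1) w k) :
    ∀ i < k, v i = w i := by
  induction k with
  | zero => intro i hi; omega
  | succ k ih =>
    simp only [horner] at h
    have h1 := abs_le.1 (hv k (by omega))
    have h2 := abs_le.1 (hw k (by omega))
    have hd : (2 * V + 1) ∣ v k - w k :=
      ⟨horner (2 * V + 1) w k - horner (2 * V + 1) v k, by linear_combination h⟩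
    have h0 : v k - w k = 0 :=
      Int.eq_zero_of_abs_lt_dvd hd (by rw [abs_lt]; constructor <;> omega)
    have hh : horner (2 * V + 1) v k = horner (2 * V + 1) w k := by
      have : (horner (2 * V + 1) v k - horner (2 * V + 1) w k) * (2 * V + 1) = 0 := by
        linear_combination h - h0
      rcases mul_eq_zero.1 this with h | h <;> omega
    intro i hi
    rcases Nat.lt_succ_iff_lt_or_eq.1 hi with hi | rfl
    · exact ih (fun i hi => hv i (by omega)) (fun i hi => hw i (by omega)) hh i hi
    · omega

/-! ### The table of small solutions -/

/-- The index in the table of the entry for the level `j ≤ n` and the value `k`. -/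
def tableIdx (n : ℕ) (k : ℤ) (j : ℕ) : ℤ := k * (n + 1) + j

theorem tableIdx_inj {n : ℕ} {k k' : ℤ} {j j' : ℕ} (hj : j ≤ n) (hj' : j' ≤ n) :
    tableIdx n k j = tableIdx n k' j' ↔ k = k' ∧ j = j' := by
  refine ⟨fun h => ?_, by rintro ⟨rfl, rfl⟩; rfl⟩
  simp only [tableIdx] at h
  have hk : k = k' := by
    by_contra hne
    rcases lt_or_gt_of_ne hne with h' | h'
    · have : (k + 1) * ((n : ℤ) + 1) ≤ k' * (n + 1) :=
        mul_le_mul_of_nonneg_right (by omega) (by omega)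
      rw [add_mul] at this
      omega
    · have : (k' + 1) * ((n : ℤ) + 1) ≤ k * (n + 1) :=
        mul_le_mul_of_nonneg_right (by omega) (by omega)
      rw [add_mul] at this
      omega
  subst hk
  exact ⟨rfl, by omega⟩

/-- What flag `F`, optimum `O` and last entry `w` have to be for the level `j + 1` and the value `k`,
given flags `f` and optima `v` of the level `j`. -/
structure IsEntry (n : ℕ) (u : ℤ) (a c : ℕ → ℤ) (f v : ℤ → ℤ) (j : ℕ) (k F O w : ℤ) : Prop where
  pred : 0 < F → 0 ≤ w ∧ w ≤ u ∧ 0 < f (tableIdx n (k - w * a j) j) ∧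
    O = v (tableIdx n (k - w * a j) j) + w * c j
  best : ∀ t, 0 ≤ t → t ≤ u → 0 < f (tableIdx n (k - t * a j) j) →
    0 < F ∧ v (tableIdx n (k - t * a j) j) + t * c j ≤ O

/-- The table of a dynamic program for `max ∑ c_j x_j` subject to `∑ a_j x_j = k`, `0 ≤ x_j ≤ u`,
filled in up to the level `J`, and for the level `J + 1` up to the value `- K + N`, exclusively. At the
level `j` only `x_0, …, x_{j-1}` are used; `f` tells whether `k` is attained, `v` is
the optimum, and `w` is the last entry of an optimal solution. -/
structure Table (n : ℕ) (K u : ℤ) (a c : ℕ → ℤ) (f v w : ℤ → ℤ) (J N : ℕ) : Prop where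
  base : 0 < f 0 ∧ v 0 = 0
  base_ne : ∀ k, |k| ≤ 2 * K → 0 < f (tableIdx n k 0) → k = 0
  outside : ∀ j ≤ n, ∀ k, |k| ≤ 2 * K → 0 < f (tableIdx n k j) → |k| ≤ K
  entry : ∀ j < J, ∀ k, |k| ≤ K → IsEntry n u a c f v j k (f (tableIdx n k (j + 1)))
    (v (tableIdx n k (j + 1))) (w (tableIdx n k (j + 1)))
  entry_last : ∀ k, |k| ≤ K → k < - K + N → IsEntry n u a c f v J k (f (tableIdx n k (J + 1)))
    (v (tableIdx n k (J + 1))) (w (tableIdx n k (J + 1)))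

theorem Table.succ {n : ℕ} {K u : ℤ} {a c : ℕ → ℤ} {f v w : ℤ → ℤ} {J N : ℕ}
    (h : Table n K u a c f v w J N) (hN : 2 * K < N) : Table n K u a c f v w (J + 1) 0 where
  base := h.base
  base_ne := h.base_ne
  outside := h.outside
  entry j hj k hk := by
    rcases Nat.lt_succ_iff_lt_or_eq.1 hj with hj | rfl
    · exact h.entry j hj k hk
    · have := abs_le.1 hk
      exact h.entry_last k hk (by omega)
  entry_last k hk hk' := by
    have := abs_le.1 hk
    push_cast at hk'
    omega

/-- Fill in one more entry. -/
theorem Table.update {n : ℕ} {K u : ℤ} {a c : ℕ → ℤ} {f v w : ℤ → ℤ} {J N : ℕ}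
    (h : Table n K u a c f v w J N) (hJ : J < n) (hN : N ≤ 2 * K) {F O w' : ℤ}
    (he : IsEntry n u a c f v J (-K + N) F O w') :
    Table n K u a c (Function.update f (tableIdx n (-K + N) (J + 1)) F)
      (Function.update v (tableIdx n (-K + N) (J + 1)) O)
      (Function.update w (tableIdx n (-K + N) (J + 1)) w') J (N + 1) := by
  have hne : ∀ (g : ℤ → ℤ) (x k : ℤ) (j : ℕ), j ≤ n → (k ≠ -K + N ∨ j ≠ J + 1) →
      Function.update g (tableIdx n (-K + N) (J + 1)) x (tableIdx n k j) = g (tableIdx n k j) := by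
    intro g x k j hj hkj
    refine Function.update_of_ne ?_ _ _
    rw [Ne, tableIdx_inj hj (by omega)]
    rintro ⟨rfl, rfl⟩
    simp at hkj
  have hz : ∀ (g : ℤ → ℤ) (x : ℤ),
      Function.update g (tableIdx n (-K + N) (J + 1)) x 0 = g 0 := by
    intro g x
    simpa [tableIdx] using hne g x 0 0 (by omega) (.inr (by omega))
  have hent : ∀ j ≤ J, ∀ k F' O' w'', IsEntry n u a c f v j k F' O' w'' →
      IsEntry n u a c (Function.update f (tableIdx n (-K + N) (J + 1)) F)
        (Function.update v (tableIdx n (-K + N) (J + 1)) O) j k F' O' w'' := by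
    intro j hj k F' O' w'' h
    constructor
    · rw [hne _ _ _ j (by omega) (.inr (by omega)), hne _ _ _ j (by omega) (.inr (by omega))]
      exact h.pred
    · intro t
      rw [hne _ _ _ j (by omega) (.inr (by omega)), hne _ _ _ j (by omega) (.inr (by omega))]
      exact h.best t
  refine ⟨?_, ?_, ?_, ?_, ?_⟩
  · rw [hz, hz]; exact h.base
  · intro k
    rw [hne _ _ _ 0 (by omega) (.inr (by omega))]
    exact h.base_ne k
  · intro j hj k hk
    by_cases hkj : k ≠ -K + N ∨ j ≠ J + 1
    · rw [hne _ _ _ j hj hkj]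
      exact h.outside j hj k hk
    · push Not at hkj
      intro _
      rw [hkj.1, abs_le]
      omega
  · intro j hj k hk
    have hjJ : k ≠ -K + N ∨ j + 1 ≠ J + 1 := .inr (by omega)
    rw [hne _ _ _ (j + 1) (by omega) hjJ, hne _ _ _ (j + 1) (by omega) hjJ,
      hne _ _ _ (j + 1) (by omega) hjJ]
    exact hent j (by omega) _ _ _ _ (h.entry j hj k hk)
  · intro k hk hk'
    by_cases hkN : k = -K + N
    · subst hkN
      simp only [Function.update_self]
      exact hent J le_rfl _ _ _ _ he
    · rw [hne _ _ _ (J + 1) (by omega) (.inl hkN), hne _ _ _ (J + 1) (by omega) (.inl hkN),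
        hne _ _ _ (J + 1) (by omega) (.inl hkN)]
      push_cast at hk'
      exact hent J le_rfl _ _ _ _ (h.entry_last k hk (by omega))

/-- The table knows of every vector with entries in `[0, u]` all of whose partial sums lie in `[-K, K]`.
-/
theorem Table.complete {n : ℕ} {K u : ℤ} {a c : ℕ → ℤ} {f v w : ℤ → ℤ} {J N : ℕ}
    (h : Table n K u a c f v w J N) (x : ℕ → ℤ) (hx0 : ∀ j, 0 ≤ x j) (hxu : ∀ j, x j ≤ u)
    (hK : ∀ j ≤ J, |∑ i ∈ Finset.range j, a i * x i| ≤ K) :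
    ∀ j ≤ J, 0 < f (tableIdx n (∑ i ∈ Finset.range j, a i * x i) j) ∧
      ∑ i ∈ Finset.range j, c i * x i ≤ v (tableIdx n (∑ i ∈ Finset.range j, a i * x i) j) := by
  intro j
  induction j with
  | zero => intro _; simpa [tableIdx] using ⟨h.base.1, h.base.2.ge⟩
  | succ j ih =>
    intro hj
    obtain ⟨h1, h2⟩ := ih (by omega)
    have e : ∑ i ∈ Finset.range j, a i * x i
        = ∑ i ∈ Finset.range (j + 1), a i * x i - x j * a j := by
      rw [Finset.sum_range_succ]; ring
    rw [e] at h1 h2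
    obtain ⟨h3, h4⟩ := (h.entry j (by omega) _ (hK (j + 1) hj)).best (x j) (hx0 j) (hxu j) h1
    refine ⟨h3, ?_⟩
    rw [Finset.sum_range_succ (fun i => c i * x i)]
    linarith [mul_comm (c j) (x j)]

/-- One step of reading off an optimal solution. -/
theorem Table.step {n : ℕ} {K u : ℤ} {a c : ℕ → ℤ} {f v w : ℤ → ℤ} {J N : ℕ}
    (h : Table n K u a c f v w J N) (hJ : J ≤ n) (ha : ∀ j < J, u * |a j| ≤ K) {j : ℕ} (hj : j < J)
    {k : ℤ} (hk : |k| ≤ K) (hf : 0 < f (tableIdx n k (j + 1))) {t : ℤ}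
    (ht : t = w (tableIdx n k (j + 1))) :
    0 ≤ t ∧ t ≤ u ∧ |k - t * a j| ≤ K ∧ 0 < f (tableIdx n (k - t * a j) j) ∧
      v (tableIdx n k (j + 1)) = v (tableIdx n (k - t * a j) j) + t * c j := by
  subst ht
  obtain ⟨h1, h2, h3, h4⟩ := (h.entry j hj k hk).pred hf
  refine ⟨h1, h2, ?_, h3, h4⟩
  refine h.outside j (by omega) _ ?_ h3
  refine (abs_sub _ _).trans ?_
  rw [abs_mul, abs_of_nonneg h1]
  have := mul_le_mul_of_nonneg_right h2 (abs_nonneg (a j))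
  have := ha j hj
  omega

/-! ### Splitting a mixed-integer program -/

namespace MIP

variable {m n l : ℕ}

theorem map_mulVec_intCast (A : Matrix (Fin m) (Fin n) ℤ) (x : Fin n → ℤ) :
    (A.map (Int.cast : ℤ → ℝ)) *ᵥ (fun j => (x j : ℝ)) = fun i => (((A *ᵥ x) i : ℤ) : ℝ) := by
  funext i
  simp [Matrix.mulVec, dotProduct]

theorem feasible_iff (I : MIP m n l) (x : Fin n → ℤ) (y : Fin l → ℝ) :
    I.Feasible x y ↔ (∀ i, (((I.A *ᵥ x) i : ℤ) : ℝ) + ((I.B.map (Int.cast : ℤ → ℝ)) *ᵥ y) i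
      = (I.b i : ℝ)) ∧ (∀ j, 0 ≤ x j) ∧ ∀ k, 0 ≤ y k := by
  rw [Feasible, map_mulVec_intCast]
  exact and_congr_left' funext_iff

theorem value_eq (I : MIP m n l) (x : Fin n → ℤ) (y : Fin l → ℝ) :
    I.value x y = ((I.c ⬝ᵥ x : ℤ) : ℝ) + ∑ k, (I.d k : ℝ) * y k := by
  simp [value, dotProduct]

/-- The program that remains when the integer variables are fixed to `x`, except that the
columns `s 0, …, s (m - 1)` may be added with nonnegative multiplicities. -/
def restrict (I : MIP m n l) (s : Fin m → Fin n) (x : Fin n → ℤ) : MIP m m l where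
  A := I.A.submatrix id s
  B := I.B
  b := I.b - I.A *ᵥ x
  c := I.c ∘ s
  d := I.d

/-- Add the multiplicities `z` of the columns `s` to `x`. -/
def lift (s : Fin m → Fin n) (x : Fin n → ℤ) (z : Fin m → ℤ) : Fin n → ℤ :=
  fun j => x j + ∑ i, if s i = j then z i else 0

theorem dotProduct_lift (c : Fin n → ℤ) (s : Fin m → Fin n) (x : Fin n → ℤ) (z : Fin m → ℤ) :
    c ⬝ᵥ lift s x z = c ⬝ᵥ x + (c ∘ s) ⬝ᵥ z := by
  simp only [dotProduct, lift, mul_add, Finset.sum_add_distrib, Finset.mul_sum, Function.comp]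
  rw [Finset.sum_comm]
  simp

theorem mulVec_lift (A : Matrix (Fin m) (Fin n) ℤ) (s : Fin m → Fin n) (x : Fin n → ℤ)
    (z : Fin m → ℤ) : A *ᵥ lift s x z = A *ᵥ x + A.submatrix id s *ᵥ z := by
  funext i
  exact dotProduct_lift (A i) s x z

theorem value_lift (I : MIP m n l) (s : Fin m → Fin n) (x : Fin n → ℤ) (z : Fin m → ℤ)
    (y : Fin l → ℝ) :
    I.value (lift s x z) y = ((I.c ⬝ᵥ x : ℤ) : ℝ) + (I.restrict s x).value z y := by
  simp only [value_eq, dotProduct_lift, restrict]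
  push_cast
  ring

theorem feasible_lift {I : MIP m n l} {s : Fin m → Fin n} {x : Fin n → ℤ} (hx : ∀ j, 0 ≤ x j)
    {z : Fin m → ℤ} {y : Fin l → ℝ} (h : (I.restrict s x).Feasible z y) :
    I.Feasible (lift s x z) y := by
  rw [feasible_iff] at h ⊢
  refine ⟨fun i => ?_, fun j => add_nonneg (hx j) (Finset.sum_nonneg fun i _ => ?_), h.2.2⟩
  · have := h.1 i
    simp only [restrict, Pi.sub_apply, Int.cast_sub] at this
    rw [mulVec_lift, Pi.add_apply, Int.cast_add]
    linarith
  · split_ifs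
    · exact h.2.1 i
    · exact le_rfl

/-- A nonnegative vector with at most `m` entries above `u` is the sum of a vector with entries in
`[0, u]` and of a nonnegative combination of `m` unit vectors. -/
theorem exists_eq_lift (hn : 1 ≤ n) {u : ℤ} (hu : 0 ≤ u) {x : Fin n → ℤ} (hx : ∀ j, 0 ≤ x j)
    (hcard : (Finset.univ.filter fun j => u < x j).card ≤ m) :
    ∃ (s : Fin m → Fin n) (x₀ : Fin n → ℤ) (z : Fin m → ℤ), (∀ j, 0 ≤ x₀ j) ∧ (∀ j, x₀ j ≤ u) ∧
      (∀ i, 0 ≤ z i) ∧ lift s x₀ z = x := by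
  classical
  set T := Finset.univ.filter fun j => u < x j with hT
  obtain ⟨g⟩ : Nonempty (T ↪ Fin m) := Function.Embedding.nonempty_of_card_le (by simpa using hcard)
  refine ⟨fun i => if h : ∃ j, g j = i then (h.choose : Fin n) else ⟨0, hn⟩,
    fun j => if u < x j then 0 else x j,
    fun i => if h : ∃ j, g j = i then x (h.choose : Fin n) else 0, ?_, ?_, ?_, ?_⟩
  · intro j; dsimp only; split_ifs <;> simp [hx]
  · intro j; dsimp only; split_ifs <;> omega
  · intro i; dsimp only; split_ifs <;> simp [hx]
  · have hg : ∀ (j : T) (h : ∃ j', g j' = g j), h.choose = j := fun j h => g.injective h.choose_spec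
    funext j
    simp only [lift]
    by_cases hj : u < x j
    · have hjT : j ∈ T := by simp [hT, hj]
      rw [if_pos hj, zero_add, Finset.sum_eq_single (g ⟨j, hjT⟩)]
      · have h : ∃ j', g j' = g ⟨j, hjT⟩ := ⟨_, rfl⟩
        have h' := hg _ h
        simp only [dif_pos h, h', if_true]
      · intro i _ hi
        by_cases h : ∃ j', g j' = i
        · rw [dif_pos h, if_neg]
          rintro rfl
          exact hi h.choose_spec.symm
        · simp [h]
      · simp
    · rw [if_neg hj, Finset.sum_eq_zero, add_zero]
      intro i _
      by_cases h : ∃ j', g j' = i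
      · rw [dif_pos h, if_neg]
        rintro rfl
        have := h.choose.2
        simp only [hT, Finset.mem_filter] at this
        exact hj this.2
      · simp [h]

end MIP

/-! ### Small vectors and the search over restricted programs -/

/-- The bound on the small entries; no entry needs to be large if `n ≤ m`. -/
def smallBound (m n D : ℕ) : ℕ := if m < n then ((m + 1) * D) ^ m else 0

/-- A bound on the entries of `A x` for a small vector `x`. -/
def rhsBound (m n D : ℕ) : ℕ := n * D * smallBound m n D

/-- The base of the positional encoding of small right-hand sides. -/
def encBase (m n D : ℕ) : ℕ := 2 * rhsBound m n D + 1

namespace MIP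

variable {m n l : ℕ}

/-- The positional encoding of a vector. -/
def enc (W : ℕ) (v : Fin m → ℤ) : ℤ := horner W (fun i => if h : i < m then v ⟨i, h⟩ else 0) m

/-- The encoding of a column of the matrix. -/
def colCode (I : MIP m n l) (D : ℕ) (j : Fin n) : ℤ := enc (encBase m n D) fun i => I.A i j

theorem sum_colCode (I : MIP m n l) (D : ℕ) (x : Fin n → ℤ) :
    ∑ j, I.colCode D j * x j = enc (encBase m n D) (I.A *ᵥ x) := by
  simp only [colCode, enc]
  rw [horner_sum]
  congr 1
  funext i
  split_ifs
  · rfl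
  · simp

/-- All entries are between 0 and `smallBound`. -/
def Small (m D : ℕ) (x : Fin n → ℤ) : Prop := ∀ j, 0 ≤ x j ∧ x j ≤ smallBound m n D

theorem Small.abs_mulVec_le {A : Matrix (Fin m) (Fin n) ℤ} {D : ℕ}
    (hA : ∀ i j, (A i j).natAbs ≤ D) {x : Fin n → ℤ} (hx : Small m D x) (i : Fin m) :
    |(A *ᵥ x) i| ≤ (rhsBound m n D : ℤ) := by
  have h : ∀ j ∈ Finset.univ, |A i j * x j| ≤ (D : ℤ) * (smallBound m n D : ℤ) := by
    intro j _
    rw [abs_mul, abs_of_nonneg (hx j).1, Int.abs_eq_natAbs]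
    exact mul_le_mul (by exact_mod_cast hA i j) (hx j).2 (hx j).1 (by positivity)
  have h' := (Finset.abs_sum_le_sum_abs (fun j => A i j * x j) Finset.univ).trans
    (Finset.sum_le_sum h)
  rw [Finset.sum_const, Finset.card_univ, Fintype.card_fin, nsmul_eq_mul, ← mul_assoc] at h'
  rw [rhsBound]
  push_cast
  exact h'

theorem abs_enc_le {D : ℕ} {v : Fin m → ℤ} (hv : ∀ i, |v i| ≤ (rhsBound m n D : ℤ)) :
    |enc (encBase m n D) v| ≤ ((encBase m n D ^ m : ℕ) : ℤ) := by
  have := horner_abs_le (V := rhsBound m n D) (v := fun i => if h : i < m then v ⟨i, h⟩ else 0)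
    (k := m) (fun i hi => by simpa [hi] using hv _)
  have h0 := abs_nonneg (enc (encBase m n D) v)
  simp only [enc, encBase] at this h0 ⊢
  push_cast at this h0 ⊢
  omega

theorem enc_injective {D : ℕ} {v w : Fin m → ℤ} (hv : ∀ i, |v i| ≤ (rhsBound m n D : ℤ))
    (hw : ∀ i, |w i| ≤ (rhsBound m n D : ℤ))
    (h : enc (encBase m n D) v = enc (encBase m n D) w) : v = w := by
  funext i
  have := horner_injective (V := rhsBound m n D) (v := fun i => if h : i < m then v ⟨i, h⟩ else 0)
    (w := fun i => if h : i < m then w ⟨i, h⟩ else 0) (k := m)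
    (fun i hi => by simpa [hi] using hv _) (fun i hi => by simpa [hi] using hw _)
    (by simpa [enc, encBase] using h) i i.2
  simpa using this

/-- Solutions of the restricted program extend to all small vectors with the same code. -/
theorem restrict_feasible {I : MIP m n l} {D : ℕ} (hA : ∀ i j, (I.A i j).natAbs ≤ D)
    {s : Fin m → Fin n} {x x' : Fin n → ℤ} {z : Fin m → ℤ} {y : Fin l → ℝ} (hx : Small m D x)
    (hx' : Small m D x') (hz : ∀ i, 0 ≤ z i)
    (hcode : ∑ j, I.colCode D j * x j = ∑ j, I.colCode D j * x' j)
    (h : I.Feasible (lift s x z) y) : (I.restrict s x').Feasible z y := by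
  rw [sum_colCode, sum_colCode] at hcode
  have hAx := enc_injective (hx.abs_mulVec_le hA) (hx'.abs_mulVec_le hA) hcode
  rw [feasible_iff] at h ⊢
  refine ⟨fun i => ?_, hz, h.2.2⟩
  have := h.1 i
  rw [mulVec_lift, hAx, Pi.add_apply, Int.cast_add] at this
  simp only [restrict, Pi.sub_apply, Int.cast_sub]
  linarith

/-- If no small kernel vector improves the objective `c`, every feasible point is dominated by one of the
form `lift s x₀ z` with `x₀` small. For `c = 0` the condition is void, so that this applies
to feasibility as well. -/
theorem exists_small_split {I : MIP m n l} {D : ℕ} (hn : 1 ≤ n) (hD : 1 ≤ D)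
    (hA : ∀ i j, (I.A i j).natAbs ≤ D) (c : Fin n → ℤ)
    (hc : ∀ z : Fin n → ℤ, I.A *ᵥ z = 0 → Small m D z → c ⬝ᵥ z ≤ 0)
    {x : Fin n → ℤ} {y : Fin l → ℝ} (h : I.Feasible x y) :
    ∃ (s : Fin m → Fin n) (x₀ : Fin n → ℤ) (z : Fin m → ℤ), Small m D x₀ ∧ (∀ i, 0 ≤ z i) ∧
      I.Feasible (lift s x₀ z) y ∧ c ⬝ᵥ x ≤ c ⬝ᵥ lift s x₀ z := by
  obtain ⟨x', h1, h2, h3, h4⟩ := exists_few_large I.A c (smallBound m n D) (by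
      intro T hT
      have : m < n := hT.trans_le (by simpa using Finset.card_le_univ T)
      simpa only [smallBound, if_pos this] using exists_small_kernel_vector I.A hD hA T hT)
    (fun z hz h0 hu => hc z hz fun j => ⟨h0 j, hu j⟩) x ((feasible_iff I x y).1 h).2.1
  obtain ⟨s, x₀, z, g1, g2, g3, g4⟩ := exists_eq_lift (m := m) hn (Int.natCast_nonneg _) h1 h4
  refine ⟨s, x₀, z, fun j => ⟨g1 j, g2 j⟩, g3, ?_, ?_⟩
  · rw [g4, feasible_iff, h2]
    exact ⟨((feasible_iff I x y).1 h).1, h1, ((feasible_iff I x y).1 h).2.2⟩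
  · rw [g4]; exact h3

/-- A feasible point together with a nonnegative kernel vector that improves the objective. -/
theorem isUnbounded_of_direction {I : MIP m n l} {x : Fin n → ℤ} {y : Fin l → ℝ}
    (h : I.Feasible x y) {z : Fin n → ℤ} (hz : I.A *ᵥ z = 0) (hz0 : ∀ j, 0 ≤ z j)
    (hc : 0 < I.c ⬝ᵥ z) : I.IsUnbounded := by
  intro K
  obtain ⟨N, hN⟩ := exists_nat_gt (K - I.value x y)
  refine ⟨x + (N : ℤ) • z, y, ?_, ?_⟩
  · rw [feasible_iff] at h ⊢
    refine ⟨fun i => ?_, fun j => ?_, h.2.2⟩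
    · rw [Matrix.mulVec_add, Matrix.mulVec_smul, hz]
      simpa using h.1 i
    · have := mul_nonneg (Int.natCast_nonneg N) (hz0 j)
      have := h.2.1 j
      simp only [Pi.add_apply, Pi.smul_apply, smul_eq_mul]
      omega
  · rw [value_eq] at hN ⊢
    rw [dotProduct_add, dotProduct_smul]
    have h1 : (1 : ℝ) ≤ ((I.c ⬝ᵥ z : ℤ) : ℝ) := by exact_mod_cast hc
    have h2 : (N : ℝ) ≤ N * ((I.c ⬝ᵥ z : ℤ) : ℝ) := le_mul_of_one_le_right (by positivity) h1
    push_cast [smul_eq_mul]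
    linarith

theorem isUnbounded_of_restrict {I : MIP m n l} {s : Fin m → Fin n} {x : Fin n → ℤ}
    (hx : ∀ j, 0 ≤ x j) (h : (I.restrict s x).IsUnbounded) : I.IsUnbounded := by
  intro K
  obtain ⟨z, y, h1, h2⟩ := h (K - ((I.c ⬝ᵥ x : ℤ) : ℝ))
  exact ⟨_, y, feasible_lift hx h1, by rw [value_lift]; linarith⟩

/-- The outcome of the search over restricted programs: `(xb, yb)` is the best point found so far
(if `hb`), and `un` tells whether an unbounded program was met. -/
structure Searched (I : MIP m n l) (un hb : Prop) (xb : Fin n → ℤ) (yb : Fin l → ℝ)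
    (s : Fin m → Fin n) (x : Fin n → ℤ) : Prop where
  found : ¬ un → ∀ z y, (I.restrict s x).Feasible z y → hb ∧
    I.value (lift s x z) y ≤ I.value xb yb

section Outcome

variable {I : MIP m n l} {D : ℕ} {un hb : Prop} {xb : Fin n → ℤ} {yb : Fin l → ℝ}

theorem isInfeasible_of_search (hn : 1 ≤ n) (hD : 1 ≤ D) (hA : ∀ i j, (I.A i j).natAbs ≤ D)
    (hS : ∀ (s : Fin m → Fin n) (x : Fin n → ℤ), Small m D x → ∃ x', Small m D x' ∧
      ∑ j, I.colCode D j * x j = ∑ j, I.colCode D j * x' j ∧ I.c ⬝ᵥ x ≤ I.c ⬝ᵥ x' ∧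
      I.Searched un hb xb yb s x')
    (hun : ¬ un) (hhb : ¬ hb) : I.IsInfeasible := by
  intro x y h
  obtain ⟨s, x₀, z, h1, h2, h3, -⟩ := exists_small_split hn hD hA 0 (by simp) h
  obtain ⟨x', g1, g2, -, g4⟩ := hS s x₀ h1
  exact hhb (g4.found hun z y (restrict_feasible hA h1 g1 h2 g2 h3)).1

theorem isOptimal_of_search (hn : 1 ≤ n) (hD : 1 ≤ D) (hA : ∀ i j, (I.A i j).natAbs ≤ D)
    (hS : ∀ (s : Fin m → Fin n) (x : Fin n → ℤ), Small m D x → ∃ x', Small m D x' ∧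
      ∑ j, I.colCode D j * x j = ∑ j, I.colCode D j * x' j ∧ I.c ⬝ᵥ x ≤ I.c ⬝ᵥ x' ∧
      I.Searched un hb xb yb s x')
    (hc : ∀ z : Fin n → ℤ, I.A *ᵥ z = 0 → Small m D z → I.c ⬝ᵥ z ≤ 0)
    (hun : ¬ un) (hb : I.Feasible xb yb) : I.IsOptimal xb yb := by
  refine ⟨hb, fun x y h => ?_⟩
  obtain ⟨s, x₀, z, h1, h2, h3, h4⟩ := exists_small_split hn hD hA I.c hc h
  obtain ⟨x', g1, g2, g3, g4⟩ := hS s x₀ h1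
  refine le_trans ?_ (g4.found hun z y (restrict_feasible hA h1 g1 h2 g2 h3)).2
  rw [value_eq, value_eq]
  rw [dotProduct_lift] at h4 ⊢
  have : ((I.c ⬝ᵥ x : ℤ) : ℝ) ≤ ((I.c ⬝ᵥ x' + (I.c ∘ s) ⬝ᵥ z : ℤ) : ℝ) := by
    exact_mod_cast h4.trans (by omega)
  linarith

end Outcome

/-- The restricted programs are within the range of the given algorithm, since
`((m + 1) * Δ) ^ m ≤ (m + 2) * (m * Δ) ^ m`. -/
theorem restrict_bounded {I : MIP m n l} {Δ D : ℕ} {M : ℕ∞} (hDΔ : D ≤ Δ)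
    (hI : I.Bounded Δ M) (hA : ∀ i j, (I.A i j).natAbs ≤ D)
    (hM : ∀ i, ((I.b i).natAbs : ℕ∞) + ((n * Δ * ((m + 2) * (m * Δ) ^ m) : ℕ) : ℕ∞) ≤ M)
    (s : Fin m → Fin n) {x : Fin n → ℤ} (hx : Small m D x) : (I.restrict s x).Bounded Δ M := by
  refine ⟨fun i j => hI.1 _ _, hI.2.1, fun i => ?_, fun j => hI.2.2.2.1 _, hI.2.2.2.2⟩
  refine le_trans ?_ (hM i)
  have h1 := hx.abs_mulVec_le hA i
  have h2 : rhsBound m n D ≤ n * Δ * ((m + 2) * (m * Δ) ^ m) := by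
    unfold rhsBound
    refine Nat.mul_le_mul (Nat.mul_le_mul le_rfl hDΔ) ?_
    unfold smallBound
    split_ifs
    · have h3 : (m + 1) ^ m ≤ (m + 2) * m ^ m := by
        rw [add_pow]
        calc ∑ k ∈ Finset.range (m + 1), m ^ k * 1 ^ (m - k) * m.choose k
            ≤ ∑ _k ∈ Finset.range (m + 1), m ^ m := by
              refine Finset.sum_le_sum fun k hk => ?_
              have hk' : k ≤ m := by simpa [Nat.lt_succ_iff] using hk
              rw [one_pow, mul_one, ← Nat.choose_symm hk']
              calc m ^ k * m.choose (m - k) ≤ m ^ k * m ^ (m - k) :=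
                    Nat.mul_le_mul le_rfl (Nat.choose_le_pow _ _)
                _ = m ^ m := by rw [← pow_add]; congr 1; omega
          _ = (m + 1) * m ^ m := by simp
          _ ≤ _ := Nat.mul_le_mul (by omega) le_rfl
      calc ((m + 1) * D) ^ m ≤ ((m + 1) * Δ) ^ m := by gcongr
        _ = (m + 1) ^ m * Δ ^ m := mul_pow _ _ _
        _ ≤ (m + 2) * m ^ m * Δ ^ m := Nat.mul_le_mul h3 le_rfl
        _ = _ := by rw [mul_pow]; ring
    · exact Nat.zero_le _
  have h3 : ((I.restrict s x).b i).natAbs ≤ (I.b i).natAbs + n * Δ * ((m + 2) * (m * Δ) ^ m) := by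
    simp only [restrict, Pi.sub_apply]
    rw [Int.abs_eq_natAbs] at h1
    omega
  exact_mod_cast h3

end MIP

/-! ### Rules for common loops -/

namespace Cmd

theorem wp_seq (c d : Cmd) (Q : ℕ → Mem → Prop) (σ : Mem) :
    (seq c d).wp Q σ = c.wp (fun t τ => d.wp (fun u ρ => Q (t + u) ρ) τ) σ := rfl

theorem wp_set (r : ℕ) (e : RExpr) (Q : ℕ → Mem → Prop) (σ : Mem) :
    (set r e).wp Q σ = Q (e.cost + 2) (σ.setReg r (e.eval σ)) := rfl

theorem wp_put (a : ℕ) (e f : RExpr) (Q : ℕ → Mem → Prop) (σ : Mem) :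
    (put a e f).wp Q σ = Q (e.cost + (f.cost + 1)) (σ.setArr a (e.eval σ) (f.eval σ)) := rfl

theorem wp_ite (e : RExpr) (c d : Cmd) (Q : ℕ → Mem → Prop) (σ : Mem) :
    (ite e c d).wp Q σ = ((0 < e.eval σ → c.wp (fun t τ => Q (e.cost + (t + 1)) τ) σ) ∧
      (¬ 0 < e.eval σ → d.wp (fun t τ => Q (e.cost + (t + 1)) τ) σ)) := rfl

/-- Use a specification of a command together with its frame. -/
theorem wp_use {c : Cmd} {P Q : ℕ → Mem → Prop} {σ : Mem} (h : c.wp P σ)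
    (hQ : ∀ t τ, c.Frame σ τ → P t τ → Q t τ) : c.wp Q σ :=
  wp_mono c (fun t τ h => hQ t τ h.2 h.1) (wp_frame c h)

/-- The loop rule for invariants that do not mention the time. -/
theorem wp_loop' {i h : ℕ} {c : Cmd} {σ : Mem} (hok : (loop i h c).ok = true) (n : ℕ)
    (hn : σ.reg h = n) (T : ℕ) (Inv : ℕ → Mem → Prop) (h0 : Inv 0 (σ.setReg i 0))
    (hs : ∀ k, k < n → ∀ τ, τ.reg i = (k : ℤ) → (loop i h c).Frame σ τ → Inv k τ →
      c.wp (fun u τ' => u ≤ T ∧ Inv (k + 1) (τ'.setReg i (k + 1))) τ) :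
    (loop i h c).wp (fun t τ => t ≤ 3 + n * (T + 4) ∧ Inv n τ) σ := by
  refine wp_loop hok n hn (fun k t τ => t ≤ 3 + k * (T + 4) ∧ Inv k τ) ⟨by simp, h0⟩ ?_ ?_
  · rintro k hk t τ hi hF ⟨ht, hI⟩
    refine wp_mono c ?_ (hs k hk τ hi hF hI)
    rintro u τ' ⟨hu, hI'⟩
    refine ⟨?_, hI'⟩
    rw [Nat.succ_mul]
    omega
  · rintro t τ - - h
    exact h

/-- A loop that fills an array. -/
theorem wp_fill {i h a : ℕ} {e : RExpr} {σ : Mem} (hok : (loop i h (put a (.reg i) e)).ok = true)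
    (n : ℕ) (hn : σ.reg h = n) (f : ℕ → ℤ)
    (he : ∀ k < n, ∀ τ, τ.reg i = (k : ℤ) → (loop i h (put a (.reg i) e)).Frame σ τ →
      e.eval τ = f k) :
    (loop i h (put a (.reg i) e)).wp (fun t τ => t ≤ 3 + n * (e.cost + 7) ∧
      ∀ k < n, τ.arr a (k : ℤ) = f k) σ := by
  refine wp_use (wp_loop' hok n hn (e.cost + 3) (fun k τ => ∀ j < k, τ.arr a (j : ℤ) = f j)
    (by simp) ?_) ?_
  · intro k hk τ hi hF hI
    rw [wp_put]
    refine ⟨by simp; omega, fun j hj => ?_⟩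
    by_cases hjk : j = k
    · subst hjk
      simp [hi, he j hk τ hi hF]
    · have : (j : ℤ) ≠ k := by exact_mod_cast hjk
      simp [hi, this, hI j (by omega)]
  · rintro t τ hF ⟨h1, h2⟩
    exact ⟨h1, h2⟩

/-- A loop that accumulates a sum. -/
theorem wp_sum {i h r : ℕ} {e : RExpr} {σ : Mem} (hok : (loop i h (set r (.reg r + e))).ok = true)
    (n : ℕ) (hn : σ.reg h = n) (f : ℕ → ℤ)
    (he : ∀ k < n, ∀ τ, τ.reg i = (k : ℤ) → (loop i h (set r (.reg r + e))).Frame σ τ →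
      e.eval τ = f k) :
    (loop i h (set r (.reg r + e))).wp (fun t τ => t ≤ 3 + n * (e.cost + 9) ∧
      τ.reg r = σ.reg r + ∑ k ∈ Finset.range n, f k) σ := by
  have hri : r ≠ i := by
    simp only [ok, Bool.and_eq_true, Bool.not_eq_true', wr, beq_eq_false_iff_ne] at hok
    exact hok.1.1.2
  refine wp_use (wp_loop' hok n hn (e.cost + 5)
    (fun k τ => τ.reg r = σ.reg r + ∑ j ∈ Finset.range k, f j) (by simp [hri]) ?_) ?_
  · intro k hk τ hi hF hI
    rw [wp_set]
    refine ⟨by simp; omega, ?_⟩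
    simp [hri, hI, he k hk τ hi hF, Finset.sum_range_succ]
    ring
  · rintro t τ hF ⟨h1, h2⟩
    exact ⟨h1, h2⟩

/-- No operation; register 49 serves no other purpose. -/
def skip : Cmd := set 49 0

end Cmd

/-! ### Computing the parameters -/

section Program

open RExpr (reg get)

local infixr:60 " ;; " => Cmd.seq

/-- Register 3 becomes the maximum of 1 and of the absolute values in the matrix. -/
def maxCmd : Cmd :=
  .set 20 (reg 0 * reg 1) ;; .set 3 1 ;; .loop 21 20 (
    .ite (get 0 (reg 21) - reg 3) (.set 3 (get 0 (reg 21))) .skip ;;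
    .ite (0 - get 0 (reg 21) - reg 3) (.set 3 (0 - get 0 (reg 21))) .skip)

theorem wp_maxCmd {σ : Mem} {m n : ℕ} (h0 : σ.reg 0 = m) (h1 : σ.reg 1 = n) :
    maxCmd.wp (fun t τ => t ≤ 20 + m * n * 40 ∧ ∃ D : ℕ, 1 ≤ D ∧ τ.reg 3 = D ∧
      (∀ p < m * n, (σ.arr 0 (p : ℤ)).natAbs ≤ D) ∧
      ∀ D' : ℕ, 1 ≤ D' → (∀ p < m * n, (σ.arr 0 (p : ℤ)).natAbs ≤ D') → D ≤ D') σ := by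
  rw [maxCmd, Cmd.wp_seq, Cmd.wp_set, Cmd.wp_seq, Cmd.wp_set]
  refine Cmd.wp_use (Cmd.wp_loop' rfl (m * n) (by simp [h0, h1]) 32
    (fun k τ => ∃ D : ℕ, 1 ≤ D ∧ τ.reg 3 = D ∧ (∀ p < k, (σ.arr 0 (p : ℤ)).natAbs ≤ D) ∧
      ∀ D' : ℕ, 1 ≤ D' → (∀ p < k, (σ.arr 0 (p : ℤ)).natAbs ≤ D') → D ≤ D')
    ⟨1, le_rfl, by simp, by simp, fun D' h _ => h⟩ ?_) ?_
  · rintro k hk τ hi hF ⟨D, hD, h3, hle, hmin⟩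
    have hA : τ.arr 0 = σ.arr 0 := hF.arr 0 rfl
    have key : ∀ (v : ℤ) (τ' : Mem), v = max (D : ℤ) |σ.arr 0 (k : ℤ)| → τ'.reg 3 = v →
        ∃ D : ℕ, 1 ≤ D ∧ (τ'.setReg 21 (k + 1)).reg 3 = D ∧
        (∀ p < k + 1, (σ.arr 0 (p : ℤ)).natAbs ≤ D) ∧
        ∀ D' : ℕ, 1 ≤ D' → (∀ p < k + 1, (σ.arr 0 (p : ℤ)).natAbs ≤ D') → D ≤ D' := by
      rintro v τ' rfl hτ'
      refine ⟨max D (σ.arr 0 (k : ℤ)).natAbs, le_max_of_le_left hD, ?_, ?_, ?_⟩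
      · simp [hτ']
      · intro p hp
        rcases Nat.lt_succ_iff_lt_or_eq.1 hp with hp | rfl
        · exact le_max_of_le_left (hle p hp)
        · exact le_max_right _ _
      · intro D' h1 h2
        exact max_le (hmin D' h1 fun p hp => h2 p (by omega)) (h2 k (by omega))
    simp only [Cmd.wp_seq, Cmd.wp_ite, Cmd.wp_set, Cmd.skip]
    refine ⟨fun g1 => ⟨fun g2 => ⟨by simp, key _ _ ?_ rfl⟩, fun g2 => ⟨by simp, key _ _ ?_ rfl⟩⟩,
      fun g1 => ⟨fun g2 => ⟨by simp, key _ _ ?_ rfl⟩, fun g2 => ⟨by simp, key _ _ ?_ rfl⟩⟩⟩ <;>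
    · simp [hi, h3, hA] at g1 g2 ⊢
      rw [abs_eq_max_neg]
      omega
  · rintro t τ hF ⟨ht, h⟩
    refine ⟨?_, h⟩
    simp
    omega

/-- From the maximal entry in register 3, compute the bound on small entries (register 4), the base
of the encoding (5), the bound on codes (6), and `n + 1` (7). -/
def boundCmd : Cmd :=
  .set 4 0 ;; .ite (reg 1 - reg 0)
    (.set 4 1 ;; .loop 20 0 (.set 4 (reg 4 * ((reg 0 + 1) * reg 3)))) .skip ;;
  .set 5 (2 * (reg 1 * reg 3 * reg 4) + 1) ;; .set 6 1 ;; .loop 20 0 (.set 6 (reg 6 * reg 5)) ;;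
  .set 7 (reg 1 + 1)

theorem wp_boundCmd {σ : Mem} {m n D : ℕ} (h0 : σ.reg 0 = m) (h1 : σ.reg 1 = n)
    (h3 : σ.reg 3 = D) :
    boundCmd.wp (fun t τ => t ≤ 80 + m * 40 ∧ τ.reg 4 = smallBound m n D ∧
      τ.reg 5 = encBase m n D ∧ τ.reg 6 = (encBase m n D ^ m : ℕ) ∧ τ.reg 7 = n + 1) σ := by
  have hu : (Cmd.ite (reg 1 - reg 0)
      (.set 4 1 ;; .loop 20 0 (.set 4 (reg 4 * ((reg 0 + 1) * reg 3)))) .skip).wp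
      (fun t τ => t ≤ 30 + m * 20 ∧ τ.reg 4 = smallBound m n D) (σ.setReg 4 0) := by
    rw [Cmd.wp_ite, Cmd.wp_seq, Cmd.wp_set, Cmd.skip, Cmd.wp_set]
    refine ⟨fun g => ?_, fun g => ⟨by simp; omega, ?_⟩⟩
    · refine Cmd.wp_use (Cmd.wp_loop' rfl m (by simp [h0]) 12
        (fun k τ => τ.reg 4 = (((m + 1) * D) ^ k : ℕ)) (by simp) ?_) ?_
      · intro k hk τ hi hF hI
        rw [Cmd.wp_set]
        have e0 : τ.reg 0 = m := by rw [hF.reg 0 rfl]; simp [h0]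
        have e3 : τ.reg 3 = D := by rw [hF.reg 3 rfl]; simp [h3]
        refine ⟨by simp, ?_⟩
        simp [hI, e0, e3, pow_succ]
      · rintro t τ hF ⟨ht, h⟩
        refine ⟨by simp; omega, ?_⟩
        have : m < n := by simp [h0, h1] at g; omega
        rw [h, smallBound, if_pos this]
    · have : ¬ m < n := by simp [h0, h1] at g; omega
      simp [smallBound, this]
  rw [boundCmd, Cmd.wp_seq, Cmd.wp_set, Cmd.wp_seq]
  refine Cmd.wp_use hu ?_
  rintro t₁ τ₁ hF₁ ⟨ht₁, h4⟩
  have e0 : τ₁.reg 0 = m := by rw [hF₁.reg 0 rfl]; simp [h0]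
  have e1 : τ₁.reg 1 = n := by rw [hF₁.reg 1 rfl]; simp [h1]
  have e3 : τ₁.reg 3 = D := by rw [hF₁.reg 3 rfl]; simp [h3]
  rw [Cmd.wp_seq, Cmd.wp_set, Cmd.wp_seq, Cmd.wp_set, Cmd.wp_seq]
  have h5 : 2 * ((n : ℤ) * D * smallBound m n D) + 1 = encBase m n D := by
    simp [encBase, rhsBound]
  refine Cmd.wp_use (Cmd.wp_loop' rfl m (by simp [e0]) 7
        (fun k τ => τ.reg 6 = (encBase m n D ^ k : ℕ)) (by simp) ?_) ?_
  · intro k hk τ hi hF hI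
    rw [Cmd.wp_set]
    have e5 : τ.reg 5 = encBase m n D := by rw [hF.reg 5 rfl]; simp [e1, e3, h4, h5]
    exact ⟨by simp, by simp [hI, e5, pow_succ]⟩
  · rintro t τ hF ⟨ht, h⟩
    rw [Cmd.wp_set]
    refine ⟨by simp; omega, ?_, ?_, ?_, ?_⟩
    · simp [hF.reg 4 rfl, h4]
    · simp [hF.reg 5 rfl, h4, e1, e3, h5]
    · simp [h]
    · simp [hF.reg 1 rfl, e1]

/-- Array 5 becomes the array of the codes of the columns. -/
def codeCmd : Cmd :=
  .loop 20 1 (.set 22 0 ;;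
    .loop 21 0 (.set 22 (reg 22 * reg 5 + get 0 (reg 21 * reg 1 + reg 20))) ;;
    .put 5 (reg 20) (reg 22))

theorem wp_codeCmd {σ : Mem} {m n W : ℕ} (h0 : σ.reg 0 = m) (h1 : σ.reg 1 = n)
    (h5 : σ.reg 5 = W) :
    codeCmd.wp (fun t τ => t ≤ 3 + n * (20 + m * 30) ∧ ∀ j < n,
      τ.arr 5 (j : ℤ) = horner W (fun i => σ.arr 0 (i * n + j)) m) σ := by
  refine Cmd.wp_use (Cmd.wp_loop' rfl n h1 (16 + m * 30) (fun k τ => ∀ j < k,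
    τ.arr 5 (j : ℤ) = horner W (fun i => σ.arr 0 (i * n + j)) m) (by simp) ?_) ?_
  · intro k hk τ hi hF hI
    rw [Cmd.wp_seq, Cmd.wp_set, Cmd.wp_seq]
    refine Cmd.wp_use (Cmd.wp_loop' rfl m (by simp [hF.reg 0 rfl, h0]) 17
      (fun j τ => τ.reg 22 = horner W (fun i => σ.arr 0 (i * n + k)) j) (by simp [horner]) ?_) ?_
    · intro j hj ρ hi' hF' hI'
      rw [Cmd.wp_set]
      refine ⟨by simp, ?_⟩
      simp [horner, hI', hF'.reg 5 rfl, hF.reg 5 rfl, h5, hF'.reg 1 rfl, hF.reg 1 rfl, h1, hi',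
        hF'.reg 20 rfl, hi, hF'.arr 0 rfl, hF.arr 0 rfl]
    · rintro t ρ hF' ⟨ht, h⟩
      rw [Cmd.wp_put]
      have e : ρ.reg 20 = k := by rw [hF'.reg 20 rfl]; simp [hi]
      refine ⟨by simp; omega, fun j hj => ?_⟩
      by_cases hjk : j = k
      · subst hjk; simp [e, h]
      · have : (j : ℤ) ≠ k := by exact_mod_cast hjk
        simp [e, this]
        rw [hF'.arr 5 rfl, Mem.arr_setReg, hI j (by omega)]
  · rintro t τ - ⟨ht, h⟩
    exact ⟨by nlinarith, h⟩

/-! ### The dynamic program -/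

/-- Clear the flags of the table (array 6) and enter the empty sum. -/
def tableInitCmd : Cmd :=
  .set 20 ((2 * reg 6 + 1) * reg 7) ;; .set 22 (2 * reg 20 + 1) ;;
  .loop 21 22 (.put 6 (reg 21 - reg 20) 0) ;; .put 6 0 1 ;; .put 7 0 0

theorem wp_tableInitCmd {σ : Mem} {n K : ℕ} (u : ℤ) (a c : ℕ → ℤ) (h6 : σ.reg 6 = K)
    (h7 : σ.reg 7 = n + 1) :
    tableInitCmd.wp (fun t τ => t ≤ 60 + (2 * K + 1) * (n + 1) * 40 ∧
      Table n K u a c (τ.arr 6) (τ.arr 7) (τ.arr 8) 0 0) σ := by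
  rw [tableInitCmd, Cmd.wp_seq, Cmd.wp_set, Cmd.wp_seq, Cmd.wp_set, Cmd.wp_seq]
  refine Cmd.wp_use (Cmd.wp_loop' rfl (2 * ((2 * K + 1) * (n + 1)) + 1)
    (by simp [h6, h7]) 7 (fun k τ => ∀ z : ℤ, -((2 * K + 1) * (n + 1)) ≤ z →
      z < -((2 * K + 1) * (n + 1)) + k → τ.arr 6 z = 0) ?_ ?_) ?_
  · intro z h1 h2
    push_cast at h2
    omega
  · intro k hk τ hi hF hI
    rw [Cmd.wp_put]
    have e : τ.reg 20 = (2 * K + 1) * (n + 1) := by rw [hF.reg 20 rfl]; simp [h6, h7]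
    refine ⟨by simp, fun z h1 h2 => ?_⟩
    by_cases hz : z = k - (2 * K + 1) * (n + 1)
    · simp [hi, e, hz]
    · push_cast at h2
      simp [hi, e, hz]
      exact hI z h1 (by omega)
  · rintro t τ - ⟨ht, h⟩
    rw [Cmd.wp_seq, Cmd.wp_put, Cmd.wp_put]
    have hf : ∀ z : ℤ, z ≠ 0 → |z| ≤ (2 * K + 1) * (n + 1) →
        ((τ.setArr 6 0 1).setArr 7 0 0).arr 6 z = 0 := by
      intro z h0 hz
      have := abs_le.1 hz
      simp [h0]
      exact h z this.1 (by push_cast; omega)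
    have hidx : ∀ (k : ℤ) (j : ℕ), j ≤ n → |k| ≤ 2 * (K : ℤ) →
        |tableIdx n k j| ≤ (2 * K + 1) * (n + 1) := by
      intro k j hj hk
      rw [tableIdx]
      refine (abs_add_le _ _).trans ?_
      rw [abs_mul, abs_of_nonneg (by positivity : (0 : ℤ) ≤ (n : ℤ) + 1),
        abs_of_nonneg (by positivity : (0 : ℤ) ≤ (j : ℤ))]
      have := mul_le_mul_of_nonneg_right hk (by positivity : (0 : ℤ) ≤ (n : ℤ) + 1)
      nlinarith
    refine ⟨by simp; nlinarith, ?_, ?_, ?_, ?_, ?_⟩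
    · constructor <;> simp
    · intro k hk hpos
      by_contra hk0
      simp only [RExpr.eval_zero, RExpr.eval_one] at hpos
      rw [hf _ ?_ (hidx k 0 (by omega) hk)] at hpos
      · exact absurd hpos (lt_irrefl _)
      · intro h0
        exact hk0 ((tableIdx_inj (n := n) (k' := 0) (j := 0) (j' := 0) (by omega) (by omega)).1
          (by rw [h0]; simp [tableIdx])).1
    · intro j hj k hk hpos
      by_contra hk0
      simp only [RExpr.eval_zero, RExpr.eval_one] at hpos
      rw [hf _ ?_ (hidx k j (by omega) hk)] at hpos
      · exact absurd hpos (lt_irrefl _)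
      · intro h0
        have := ((tableIdx_inj (n := n) (k' := 0) (j' := 0) hj (by omega)).1
          (by rw [h0]; simp [tableIdx])).1
        simp [this] at hk0
    · intro j hj; omega
    · intro k hk hk'
      have := abs_le.1 hk
      push_cast at hk'
      omega

/-- Compute the table entry (registers 25, 26, 27) for the level after register 20 and the value in
register 24. Register 28 is one more than the bound on small entries. -/
def entryCmd : Cmd :=
  .set 25 0 ;; .set 26 0 ;; .set 27 0 ;;
  .loop 22 28 (.set 29 ((reg 24 - reg 22 * get 5 (reg 20)) * reg 7 + reg 20) ;;
    .ite (get 6 (reg 29))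
      (.set 30 (get 7 (reg 29) + reg 22 * get 3 (reg 20)) ;;
        .ite (1 - reg 25) (.set 25 1 ;; .set 26 (reg 30) ;; .set 27 (reg 22))
          (.ite (reg 30 - reg 26) (.set 26 (reg 30) ;; .set 27 (reg 22)) .skip))
      .skip)

theorem wp_entryCmd {σ : Mem} {n u j : ℕ} {k : ℤ} {a c : ℕ → ℤ} (h28 : σ.reg 28 = u + 1)
    (h7 : σ.reg 7 = n + 1) (h20 : σ.reg 20 = j) (h24 : σ.reg 24 = k) (ha : σ.arr 5 j = a j)
    (hc : σ.arr 3 j = c j) :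
    entryCmd.wp (fun t τ => t ≤ 20 + (u + 1) * 80 ∧
      IsEntry n u a c (σ.arr 6) (σ.arr 7) j k (τ.reg 25) (τ.reg 26) (τ.reg 27)) σ := by
  rw [entryCmd, Cmd.wp_seq, Cmd.wp_set, Cmd.wp_seq, Cmd.wp_set, Cmd.wp_seq, Cmd.wp_set]
  refine Cmd.wp_use (Cmd.wp_loop' rfl (u + 1) (by simp [h28]) 70 (fun r τ =>
    IsEntry n (r - 1) a c (σ.arr 6) (σ.arr 7) j k (τ.reg 25) (τ.reg 26) (τ.reg 27)) ?_ ?_) ?_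
  · constructor
    · simp
    · intro t h1 h2
      push_cast at h2
      omega
  · intro r hr τ hi hF hI
    simp only [Cmd.wp_seq, Cmd.wp_ite, Cmd.wp_set, Cmd.skip]
    have e6 : τ.arr 6 = σ.arr 6 := hF.arr 6 rfl
    have e7 : τ.arr 7 = σ.arr 7 := hF.arr 7 rfl
    have e5 : τ.arr 5 = σ.arr 5 := hF.arr 5 rfl
    have e3 : τ.arr 3 = σ.arr 3 := hF.arr 3 rfl
    have r24 : τ.reg 24 = k := by rw [hF.reg 24 rfl]; simp [h24]
    have r7 : τ.reg 7 = n + 1 := by rw [hF.reg 7 rfl]; simp [h7]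
    have r20 : τ.reg 20 = j := by rw [hF.reg 20 rfl]; simp [h20]
    have hidx : (k - r * a j) * ((n : ℤ) + 1) + j = tableIdx n (k - r * a j) j := rfl
    -- an old value of `t` satisfies `t ≤ r - 1`, the new one is `r`
    have hsucc : ∀ F O w : ℤ,
        (0 < F → 0 ≤ w ∧ w ≤ r ∧ 0 < σ.arr 6 (tableIdx n (k - w * a j) j) ∧
          O = σ.arr 7 (tableIdx n (k - w * a j) j) + w * c j) →
        (∀ t, 0 ≤ t → t ≤ (r : ℤ) - 1 → 0 < σ.arr 6 (tableIdx n (k - t * a j) j) →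
          0 < F ∧ σ.arr 7 (tableIdx n (k - t * a j) j) + t * c j ≤ O) →
        (0 < σ.arr 6 (tableIdx n (k - r * a j) j) →
          0 < F ∧ σ.arr 7 (tableIdx n (k - r * a j) j) + r * c j ≤ O) →
        IsEntry n ((r + 1 : ℕ) - 1) a c (σ.arr 6) (σ.arr 7) j k F O w := by
      intro F O w h1 h2 h3
      refine ⟨fun h => by simpa using h1 h, fun t ht0 ht => ?_⟩
      by_cases htr : t = r
      · subst htr; exact h3
      · exact h2 t ht0 (by push_cast at ht; omega)
    simp only [RExpr.eval_get, RExpr.eval_add, RExpr.eval_mul, RExpr.eval_sub, RExpr.eval_reg,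
      RExpr.eval_one, Mem.reg_setReg, Mem.arr_setReg, Nat.reduceEqDiff, reduceIte, r24, r7, r20, hi, e6, e7, e5, e3,
      ha, hc, hidx]
    refine ⟨fun g => ⟨fun g2 => ⟨by simp, hsucc _ _ _ ?_ ?_ ?_⟩, fun g2 => ⟨fun g3 => ⟨by simp,
      hsucc _ _ _ ?_ ?_ ?_⟩, fun g3 => ⟨by simp, hsucc _ _ _ ?_ ?_ ?_⟩⟩⟩,
      fun g => ⟨by simp, hsucc _ _ _ ?_ ?_ ?_⟩⟩
    · intro _; exact ⟨by omega, le_rfl, g, rfl⟩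
    · intro t h1 h2 h3
      have := (hI.best t h1 h2 h3).1
      omega
    · intro _; exact ⟨by omega, le_rfl⟩
    · intro _; exact ⟨by omega, le_rfl, g, rfl⟩
    · intro t h1 h2 h3
      have := (hI.best t h1 h2 h3)
      exact ⟨this.1, by omega⟩
    · intro _; exact ⟨by omega, le_rfl⟩
    · intro h
      obtain ⟨h1, h2, h3⟩ := hI.pred h
      exact ⟨h1, by omega, h3⟩
    · exact hI.best
    · intro _; exact ⟨by omega, by omega⟩
    · intro h
      obtain ⟨h1, h2, h3⟩ := hI.pred h
      exact ⟨h1, by omega, h3⟩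
    · exact hI.best
    · intro h; exact absurd h g
  · rintro t τ - ⟨ht, h⟩
    refine ⟨by simp; omega, ?_⟩
    simpa using h

/-- Fill in the levels of the table: flags, optima and last entries are in the arrays 6, 7, 8. -/
def levelsCmd : Cmd :=
  .set 28 (reg 4 + 1) ;; .set 23 (2 * reg 6 + 1) ;; .loop 20 1 (.loop 21 23 (
    .set 24 (0 - reg 6 + reg 21) ;; entryCmd ;; .set 29 (reg 24 * reg 7 + (reg 20 + 1)) ;;
    .put 6 (reg 29) (reg 25) ;; .put 7 (reg 29) (reg 26) ;; .put 8 (reg 29) (reg 27)))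

theorem wp_levelsCmd {σ : Mem} {n u K : ℕ} {a c : ℕ → ℤ} (h1 : σ.reg 1 = n) (h4 : σ.reg 4 = u)
    (h6 : σ.reg 6 = K) (h7 : σ.reg 7 = n + 1) (ha : ∀ j < n, σ.arr 5 j = a j)
    (hc : ∀ j < n, σ.arr 3 j = c j)
    (hT : Table n K u a c (σ.arr 6) (σ.arr 7) (σ.arr 8) 0 0) :
    levelsCmd.wp (fun t τ => t ≤ 30 + n * (20 + (2 * K + 1) * (80 + (u + 1) * 80)) ∧
      Table n K u a c (τ.arr 6) (τ.arr 7) (τ.arr 8) n 0) σ := by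
  rw [levelsCmd, Cmd.wp_seq, Cmd.wp_set, Cmd.wp_seq, Cmd.wp_set]
  refine Cmd.wp_use (Cmd.wp_loop' rfl n (by simp [h1]) (3 + (2 * K + 1) * (70 + (u + 1) * 80))
    (fun j τ => Table n K u a c (τ.arr 6) (τ.arr 7) (τ.arr 8) j 0) hT ?_) ?_
  · intro j hj τ hi hF hI
    have r6 : τ.reg 6 = K := by rw [hF.reg 6 rfl]; simp [h6]
    refine Cmd.wp_use (Cmd.wp_loop' rfl (2 * K + 1) (by rw [hF.reg 23 rfl]; simp [h6])
      (66 + (u + 1) * 80)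
      (fun r τ => Table n K u a c (τ.arr 6) (τ.arr 7) (τ.arr 8) j r) hI ?_) ?_
    · intro r hr ρ hi' hF' hI'
      rw [Cmd.wp_seq, Cmd.wp_set, Cmd.wp_seq]
      have q6 : ρ.reg 6 = K := by rw [hF'.reg 6 rfl, r6]
      have q7 : ρ.reg 7 = n + 1 := by rw [hF'.reg 7 rfl, hF.reg 7 rfl]; simp [h7]
      have q20 : ρ.reg 20 = j := by rw [hF'.reg 20 rfl, hi]
      refine Cmd.wp_use (wp_entryCmd (n := n) (u := u) (j := j) (k := -K + r) (a := a) (c := c)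
        ?_ ?_ ?_ ?_ ?_ ?_) ?_
      · simp [hF'.reg 28 rfl, hF.reg 28 rfl, h4]
      · simp [q7]
      · simp [q20]
      · simp [q6, hi']
      · simp [hF'.arr 5 rfl, hF.arr 5 rfl, ha j hj]
      · simp [hF'.arr 3 rfl, hF.arr 3 rfl, hc j hj]
      · rintro t π hF'' ⟨ht, he⟩
        simp only [Cmd.wp_seq, Cmd.wp_set, Cmd.wp_put]
        have p24 : π.reg 24 = -K + r := by rw [hF''.reg 24 rfl]; simp [q6, hi']
        have p7 : π.reg 7 = n + 1 := by rw [hF''.reg 7 rfl]; simp [q7]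
        have p20 : π.reg 20 = j := by rw [hF''.reg 20 rfl]; simp [q20]
        have hidx : (-(K : ℤ) + r) * ((n : ℤ) + 1) + (j + 1) = tableIdx n (-K + r) (j + 1) := by
          simp [tableIdx]
        refine ⟨by simp; omega, ?_⟩
        have := hI'.update hj (by omega) he
        convert this using 1 <;>
        · funext z
          simp [Function.update_apply, p24, p7, p20, hidx]
          simp [hF''.arr 6 rfl, hF''.arr 7 rfl, hF''.arr 8 rfl]
    · rintro t ρ - ⟨ht, h⟩
      exact ⟨by linarith, h.succ (by push_cast; omega)⟩
  · rintro t τ - ⟨ht, h⟩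
    refine ⟨?_, h⟩
    simp
    nlinarith

/-- Read off an optimal small solution for the value in register 16 into array 10. -/
def readCmd : Cmd :=
  .set 24 (reg 16) ;; .loop 21 1 (.set 25 (reg 1 - 1 - reg 21) ;;
    .set 26 (get 8 (reg 24 * reg 7 + (reg 25 + 1))) ;; .put 10 (reg 25) (reg 26) ;;
    .set 24 (reg 24 - reg 26 * get 5 (reg 25)))

theorem wp_readCmd {σ : Mem} {n u K : ℕ} {a c : ℕ → ℤ} {k : ℤ} (h1 : σ.reg 1 = n)
    (h7 : σ.reg 7 = n + 1) (h16 : σ.reg 16 = k) (ha : ∀ j < n, σ.arr 5 j = a j)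
    (hT : Table n K u a c (σ.arr 6) (σ.arr 7) (σ.arr 8) n 0) (hu : ∀ j < n, u * |a j| ≤ K)
    (hk : |k| ≤ K) (hf : 0 < σ.arr 6 (tableIdx n k n)) :
    readCmd.wp (fun t τ => t ≤ 10 + n * 60 ∧
      (∀ j < n, 0 ≤ τ.arr 10 (j : ℤ) ∧ τ.arr 10 (j : ℤ) ≤ u) ∧
      ∑ j ∈ Finset.range n, a j * τ.arr 10 j = k ∧
      ∑ j ∈ Finset.range n, c j * τ.arr 10 j = σ.arr 7 (tableIdx n k n)) σ := by
  rw [readCmd, Cmd.wp_seq, Cmd.wp_set]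
  refine Cmd.wp_use (Cmd.wp_loop' rfl n (by simp [h1]) 50 (fun r τ =>
    |τ.reg 24| ≤ K ∧ 0 < σ.arr 6 (tableIdx n (τ.reg 24) (n - r)) ∧
    (∀ j, n - r ≤ j → j < n → 0 ≤ τ.arr 10 (j : ℤ) ∧ τ.arr 10 (j : ℤ) ≤ u) ∧
    τ.reg 24 + ∑ j ∈ Finset.Ico (n - r) n, a j * τ.arr 10 j = k ∧
    σ.arr 7 (tableIdx n (τ.reg 24) (n - r)) + ∑ j ∈ Finset.Ico (n - r) n, c j * τ.arr 10 j
      = σ.arr 7 (tableIdx n k n)) ?_ ?_) ?_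
  · refine ⟨by simpa [h16], by simpa [h16], fun j _ _ => by omega, by simp [h16], by simp [h16]⟩
  · rintro r hr τ hi hF ⟨i1, i2, i3, i4, i5⟩
    simp only [Cmd.wp_seq, Cmd.wp_set, Cmd.wp_put]
    obtain ⟨j, hj⟩ : ∃ j, n - r = j + 1 := ⟨n - r - 1, by omega⟩
    have hj' : n - (r + 1) = j := by omega
    have e1 : τ.reg 1 = n := by rw [hF.reg 1 rfl]; simp [h1]
    have e7 : τ.reg 7 = n + 1 := by rw [hF.reg 7 rfl]; simp [h7]
    have e8 : τ.arr 8 = σ.arr 8 := hF.arr 8 rfl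
    have e5 : τ.arr 5 = σ.arr 5 := hF.arr 5 rfl
    have hjn : (n : ℤ) - 1 - r = j := by omega
    rw [hj] at i2 i3 i4 i5
    have hidx : τ.reg 24 * ((n : ℤ) + 1) + (j + 1) = tableIdx n (τ.reg 24) (j + 1) := by
      simp [tableIdx]
    obtain ⟨s1, s2, s3, s4, s5⟩ := hT.step le_rfl hu (by omega : j < n) i1 i2 rfl
    set t := σ.arr 8 (tableIdx n (τ.reg 24) (j + 1)) with htdef
    refine ⟨by simp, ?_⟩
    have hsum : ∀ b : ℕ → ℤ, ∑ i ∈ Finset.Ico j n, (if i = j then b i * t else b i * τ.arr 10 i)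
        = b j * t + ∑ i ∈ Finset.Ico (j + 1) n, b i * τ.arr 10 i := by
      intro b
      rw [Finset.sum_eq_sum_Ico_succ_bot (by omega), if_pos rfl]
      congr 1
      refine Finset.sum_congr rfl fun i hi => if_neg ?_
      simp at hi
      omega
    simp [hi, e1, e7, e8, e5, hjn, hidx, hj', ← htdef, ha j (by omega)]
    refine ⟨s3, s4, ?_, ?_, ?_⟩
    · intro i h1 h2
      by_cases hij : i = j
      · subst hij; simp [s1, s2]
      · simp [hij, i3 i (by omega) h2]
    · rw [hsum]
      linarith
    · rw [hsum]
      linarith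
  · rintro t τ - ⟨ht, i1, i2, i3, i4, i5⟩
    simp only [Nat.sub_self] at i1 i2 i3 i4 i5
    have hz : τ.reg 24 = 0 := hT.base_ne _ (by omega) i2
    rw [hz] at i4 i5
    have h0 : σ.arr 7 (tableIdx n 0 0) = 0 := by simpa [tableIdx] using hT.base.2
    refine ⟨by simp; omega, fun j hj => i3 j (Nat.zero_le _) hj, ?_, ?_⟩
    · rw [Finset.range_eq_Ico]; linarith
    · rw [h0] at i5; rw [Finset.range_eq_Ico]; linarith

/-! ### Solving one restricted program -/

/-- Write the base `n` digits of register 15 into array 9. -/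
def digitsCmd : Cmd :=
  .set 24 (reg 15) ;;
  .loop 21 0 (.put 9 (reg 21) (reg 24 - reg 24 / reg 1 * reg 1) ;; .set 24 (reg 24 / reg 1))

theorem wp_digitsCmd {σ : Mem} {m n p : ℕ} (h0 : σ.reg 0 = m) (h1 : σ.reg 1 = n)
    (h15 : σ.reg 15 = p) :
    digitsCmd.wp (fun t τ => t ≤ 10 + m * 30 ∧ ∀ i < m, τ.arr 9 (i : ℤ) = (p / n ^ i % n : ℕ)) σ := by
  rw [digitsCmd, Cmd.wp_seq, Cmd.wp_set]
  refine Cmd.wp_use (Cmd.wp_loop' rfl m (by simp [h0]) 26 (fun k τ => τ.reg 24 = (p / n ^ k : ℕ) ∧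
    ∀ i < k, τ.arr 9 (i : ℤ) = (p / n ^ i % n : ℕ)) (by simp [h15]) ?_) ?_
  · rintro k hk τ hi hF ⟨i1, i2⟩
    have e1 : τ.reg 1 = n := by rw [hF.reg 1 rfl]; simp [h1]
    rw [Cmd.wp_seq, Cmd.wp_put, Cmd.wp_set]
    refine ⟨by simp, ?_, fun i hik => ?_⟩
    · simp only [RExpr.eval_div, RExpr.eval_reg, Mem.reg_setReg, Mem.reg_setArr, i1, e1]
      simp only [Nat.reduceEqDiff, reduceIte]
      rw [pow_succ, ← Nat.div_div_eq_div_mul]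
      exact_mod_cast rfl
    · by_cases h : i = k
      · subst h
        simp [hi, i1, e1, Int.emod_def, mul_comm]
      · have : (i : ℤ) ≠ k := by exact_mod_cast h
        simp [hi, this, i2 i (by omega)]
  · rintro t τ - ⟨ht, -, h⟩
    exact ⟨by simp; omega, h⟩

/-- Write the program that is restricted to the columns in array 9 and to the fixed values in
array 10 to where the subroutine expects its input. -/
def buildCmd : Cmd :=
  .set 20 (reg 0 * reg 0) ;;
  .loop 21 20 (.put 40 (reg 21)
    (get 0 (reg 21 / reg 0 * reg 1 + get 9 (reg 21 - reg 21 / reg 0 * reg 0)))) ;;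
  .set 20 (reg 0 * reg 2) ;;
  .loop 21 20 (.put 41 (reg 21) (get 1 (reg 21))) ;;
  .loop 21 0 (.set 24 0 ;;
    .loop 22 1 (.set 24 (reg 24 + get 0 (reg 21 * reg 1 + reg 22) * get 10 (reg 22))) ;;
    .put 42 (reg 21) (get 2 (reg 21) - reg 24)) ;;
  .loop 21 0 (.put 43 (reg 21) (get 3 (get 9 (reg 21)))) ;;
  .loop 21 2 (.put 44 (reg 21) (get 4 (reg 21))) ;;
  .set 100 (reg 0) ;; .set 101 (reg 0) ;; .set 102 (reg 2)

theorem wp_buildCmd {m n l : ℕ} {I : MIP m n l} {σ : Mem} (hL : I.Loaded σ) {s : Fin m → Fin n}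
    {x : Fin n → ℤ} (hs : ∀ i : Fin m, σ.arr 9 (i : ℤ) = (s i : ℕ))
    (hx : ∀ j : Fin n, σ.arr 10 (j : ℤ) = x j) :
    buildCmd.wp (fun t τ => t ≤ 60 + 40 * (m * m + m * l + m * (n + 1) + m + l) ∧
      (I.restrict s x).Loaded τ.inner) σ := by
  obtain ⟨h0, h1, h2, hA, hB, hb, hc, hd⟩ := hL
  rw [buildCmd, Cmd.wp_seq, Cmd.wp_set, Cmd.wp_seq]
  refine Cmd.wp_use (Cmd.wp_fill rfl (m * m) (by simp [h0])
    (fun p => σ.arr 0 ((p / m : ℕ) * n + σ.arr 9 (p % m : ℕ))) ?_) ?_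
  · intro k hk τ hi hF
    have e0 : τ.reg 0 = m := by rw [hF.reg 0 rfl]; simp [h0]
    have e1 : τ.reg 1 = n := by rw [hF.reg 1 rfl]; simp [h1]
    simp [hi, e0, e1, hF.arr 0 rfl, hF.arr 9 rfl, Int.emod_def, mul_comm]
  rintro t₁ τ₁ hF₁ ⟨ht₁, H₁⟩
  have e0 : τ₁.reg 0 = m := by rw [hF₁.reg 0 rfl]; simp [h0]
  have e1 : τ₁.reg 1 = n := by rw [hF₁.reg 1 rfl]; simp [h1]
  have e2 : τ₁.reg 2 = l := by rw [hF₁.reg 2 rfl]; simp [h2]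
  rw [Cmd.wp_seq, Cmd.wp_set, Cmd.wp_seq]
  refine Cmd.wp_use (Cmd.wp_fill rfl (m * l) (by simp [e0, e2]) (fun p => σ.arr 1 p) ?_) ?_
  · intro k hk τ hi hF
    simp [hi, hF.arr 1 rfl, hF₁.arr 1 rfl]
  rintro t₂ τ₂ hF₂ ⟨ht₂, H₂⟩
  rw [Cmd.wp_seq]
  have g0 : τ₂.reg 0 = m := by rw [hF₂.reg 0 rfl]; simp [e0]
  have g1 : τ₂.reg 1 = n := by rw [hF₂.reg 1 rfl]; simp [e1]
  have g2 : τ₂.reg 2 = l := by rw [hF₂.reg 2 rfl]; simp [e2]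
  refine Cmd.wp_use (Cmd.wp_loop' rfl m g0 (20 + n * 30) (fun k τ => ∀ i < k,
    τ.arr 42 (i : ℤ) = σ.arr 2 (i : ℤ) -
      ∑ j ∈ Finset.range n, σ.arr 0 (i * n + j) * σ.arr 10 j) (by simp) ?_) ?_
  · intro k hk τ hi hF hI
    rw [Cmd.wp_seq, Cmd.wp_set, Cmd.wp_seq]
    refine Cmd.wp_use (Cmd.wp_sum rfl n (by simp [hF.reg 1 rfl, g1])
      (fun j => σ.arr 0 (k * n + j) * σ.arr 10 j) ?_) ?_
    · intro j hj ρ hi' hF'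
      simp [hi', hF'.reg 21 rfl, hi, hF'.reg 1 rfl, hF.reg 1 rfl, g1, hF'.arr 0 rfl, hF.arr 0 rfl,
        hF₂.arr 0 rfl, hF₁.arr 0 rfl, hF'.arr 10 rfl, hF.arr 10 rfl, hF₂.arr 10 rfl, hF₁.arr 10 rfl]
    · rintro t ρ hF' ⟨ht, h⟩
      rw [Cmd.wp_put]
      have e : ρ.reg 21 = k := by rw [hF'.reg 21 rfl]; simp [hi]
      simp at ht h
      refine ⟨by simp; omega, fun i hik => ?_⟩
      by_cases hik' : i = k
      · subst hik'
        simp [e, h, hF'.arr 2 rfl, hF.arr 2 rfl, hF₂.arr 2 rfl, hF₁.arr 2 rfl]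
      · have : (i : ℤ) ≠ k := by exact_mod_cast hik'
        simp [e, this]
        rw [hF'.arr 42 rfl, Mem.arr_setReg, hI i (by omega)]
  rintro t₃ τ₃ hF₃ ⟨ht₃, H₃⟩
  rw [Cmd.wp_seq]
  refine Cmd.wp_use (Cmd.wp_fill rfl m (by simp [hF₃.reg 0 rfl, g0])
    (fun i => σ.arr 3 (σ.arr 9 i)) ?_) ?_
  · intro k hk τ hi hF
    simp [hi, hF.arr 3 rfl, hF₃.arr 3 rfl, hF₂.arr 3 rfl, hF₁.arr 3 rfl,
      hF.arr 9 rfl, hF₃.arr 9 rfl, hF₂.arr 9 rfl, hF₁.arr 9 rfl]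
  rintro t₄ τ₄ hF₄ ⟨ht₄, H₄⟩
  rw [Cmd.wp_seq]
  refine Cmd.wp_use (Cmd.wp_fill rfl l (by simp [hF₄.reg 2 rfl, hF₃.reg 2 rfl, g2])
    (fun k => σ.arr 4 k) ?_) ?_
  · intro k hk τ hi hF
    simp [hi, hF.arr 4 rfl, hF₄.arr 4 rfl, hF₃.arr 4 rfl, hF₂.arr 4 rfl, hF₁.arr 4 rfl]
  rintro t₅ τ₅ hF₅ ⟨ht₅, H₅⟩
  simp only [Cmd.wp_seq, Cmd.wp_set]
  have f0 : τ₅.reg 0 = m := by rw [hF₅.reg 0 rfl, hF₄.reg 0 rfl, hF₃.reg 0 rfl, g0]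
  have f2 : τ₅.reg 2 = l := by rw [hF₅.reg 2 rfl, hF₄.reg 2 rfl, hF₃.reg 2 rfl, g2]
  refine ⟨?_, ?_, ?_, ?_, ?_, ?_, ?_, ?_, ?_⟩
  · simp at ht₁ ht₂ ht₃ ht₄ ht₅ ⊢
    nlinarith
  · simp [Mem.inner, f0]
  · simp [Mem.inner, f0]
  · simp [Mem.inner, f2]
  · intro i j
    have hlt : (i : ℕ) * m + j < m * m := by
      have := Nat.mul_le_mul_right m (Nat.succ_le_of_lt i.2)
      have := j.2
      rw [Nat.succ_mul] at *
      omega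
    have := H₁ _ hlt
    have hm : 0 < m := i.pos
    rw [Nat.add_comm, Nat.add_mul_div_right _ _ hm, Nat.add_mul_mod_self_right,
      Nat.div_eq_of_lt j.2, Nat.mod_eq_of_lt j.2, hs, zero_add] at this
    simp only [Mem.inner, Mem.arr_setReg, hF₅.arr 40 rfl, hF₄.arr 40 rfl, hF₃.arr 40 rfl,
      hF₂.arr 40 rfl]
    push_cast at this
    rw [add_comm, this]
    exact hA i (s j)
  · intro i k
    have hlt : (i : ℕ) * l + k < m * l := by
      have := Nat.mul_le_mul_right l (Nat.succ_le_of_lt i.2)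
      have := k.2
      rw [Nat.succ_mul] at *
      omega
    have := H₂ _ hlt
    simp only [Mem.inner, Mem.arr_setReg, hF₅.arr 41 rfl, hF₄.arr 41 rfl, hF₃.arr 41 rfl]
    push_cast at this
    rw [this]
    exact hB i k
  · intro i
    simp only [Mem.inner, Mem.arr_setReg, hF₅.arr 42 rfl, hF₄.arr 42 rfl]
    rw [H₃ _ i.2, hb, Finset.sum_range]
    simp only [MIP.restrict, Pi.sub_apply, Matrix.mulVec, dotProduct]
    congr 1
    exact Finset.sum_congr rfl fun j _ => by rw [hA, hx]
  · intro j
    simp only [Mem.inner, Mem.arr_setReg, hF₅.arr 43 rfl]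
    rw [H₄ _ j.2, hs]
    exact hc (s j)
  · intro k
    simp only [Mem.inner, Mem.arr_setReg]
    rw [H₅ _ k.2]
    exact hd k

/-- Add the answer of the subroutine to array 10. -/
def liftCmd : Cmd :=
  .loop 21 0 (.put 10 (get 9 (reg 21)) (get 10 (get 9 (reg 21)) + get 40 (reg 21)))

theorem wp_liftCmd {m n : ℕ} {σ : Mem} (h0 : σ.reg 0 = m) {s : Fin m → Fin n}
    {x : Fin n → ℤ} {z : Fin m → ℤ} (hs : ∀ i : Fin m, σ.arr 9 (i : ℤ) = (s i : ℕ))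
    (hx : ∀ j : Fin n, σ.arr 10 (j : ℤ) = x j) (hz : ∀ i : Fin m, σ.arr 40 (i : ℤ) = z i) :
    liftCmd.wp (fun t τ => t ≤ 3 + m * 30 ∧ ∀ j : Fin n, τ.arr 10 (j : ℤ) = MIP.lift s x z j) σ := by
  refine Cmd.wp_use (Cmd.wp_loop' rfl m h0 26 (fun k τ => ∀ j : Fin n, τ.arr 10 (j : ℤ) =
    x j + ∑ i ∈ Finset.range k, if σ.arr 9 (i : ℤ) = (j : ℤ) then σ.arr 40 (i : ℤ) else 0)
    (by simp [hx]) ?_) ?_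
  · intro k hk τ hi hF hI
    rw [Cmd.wp_put]
    refine ⟨by simp, fun j => ?_⟩
    have e9 := hs ⟨k, hk⟩
    simp only at e9
    have e := hI (s ⟨k, hk⟩)
    simp only [Mem.arr_setReg, Mem.arr_setArr, RExpr.eval_get, RExpr.eval_add, RExpr.eval_reg, hi,
      hF.arr 9 rfl, hF.arr 40 rfl, true_and, e9, Finset.sum_range_succ]
    split_ifs with h1 h2 h2
    · have : j = s ⟨k, hk⟩ := Fin.ext (by exact_mod_cast h1)
      subst this
      rw [e]
      ring
    · exact absurd h1.symm h2
    · exact absurd h2.symm h1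
    · simp [hI j]
  · rintro t τ - ⟨ht, h⟩
    refine ⟨by omega, fun j => ?_⟩
    rw [h, MIP.lift, Finset.sum_range]
    congr 1
    refine Finset.sum_congr rfl fun i _ => ?_
    rw [hs, hz]
    refine if_congr ?_ rfl rfl
    simp [Fin.ext_iff]

/-- Compute the objective value of array 10 and of the continuous part of the answer, up to the common
denominator in register 101, in register 24. -/
def valueCmd : Cmd :=
  .set 24 0 ;; .loop 21 1 (.set 24 (reg 24 + get 3 (reg 21) * get 10 (reg 21))) ;;
  .set 24 (reg 24 * reg 101) ;; .loop 21 2 (.set 24 (reg 24 + get 4 (reg 21) * get 41 (reg 21)))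

theorem wp_valueCmd {m n l : ℕ} {I : MIP m n l} {σ : Mem} (hL : I.Loaded σ)
    {x : Fin n → ℤ} (hx : ∀ j : Fin n, σ.arr 10 (j : ℤ) = x j) (hden : 0 < σ.reg 101) :
    valueCmd.wp (fun t τ => t ≤ 20 + n * 20 + l * 20 ∧ (τ.reg 24 : ℝ) =
      I.value x (fun k => (σ.arr 41 (k : ℤ) : ℝ) / (σ.reg 101 : ℝ)) * σ.reg 101) σ := by
  obtain ⟨h0, h1, h2, hA, hB, hb, hc, hd⟩ := hL
  rw [valueCmd, Cmd.wp_seq, Cmd.wp_set, Cmd.wp_seq]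
  refine Cmd.wp_use (Cmd.wp_sum rfl n (by simp [h1]) (fun j => σ.arr 3 j * σ.arr 10 j) ?_) ?_
  · intro k hk τ hi hF
    simp [hi, hF.arr 3 rfl, hF.arr 10 rfl]
  rintro t₁ τ₁ hF₁ ⟨ht₁, H₁⟩
  rw [Cmd.wp_seq, Cmd.wp_set]
  refine Cmd.wp_use (Cmd.wp_sum rfl l (by simp [hF₁.reg 2 rfl, h2])
    (fun j => σ.arr 4 j * σ.arr 41 j) ?_) ?_
  · intro k hk τ hi hF
    simp [hi, hF.arr 4 rfl, hF.arr 41 rfl, hF₁.arr 4 rfl, hF₁.arr 41 rfl]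
  rintro t₂ τ₂ hF₂ ⟨ht₂, H₂⟩
  simp at ht₁ ht₂ H₁ H₂
  refine ⟨by simp; omega, ?_⟩
  have hden' : (σ.reg 101 : ℝ) ≠ 0 := by exact_mod_cast hden.ne'
  rw [H₂, H₁, hF₁.reg 101 rfl, MIP.value, add_mul, Finset.sum_range, Finset.sum_range]
  push_cast
  congr 1
  · congr 1
    exact Finset.sum_congr rfl fun j _ => by simp [hc, hx]
  · rw [Finset.sum_mul]
    refine Finset.sum_congr rfl fun k _ => ?_
    rw [hd, mul_assoc, div_mul_cancel₀ _ hden']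

/-- The integer part of the best point so far. -/
def bestX (n : ℕ) (σ : Mem) : Fin n → ℤ := fun j => σ.arr 11 (j : ℤ)

/-- The continuous part of the best point so far; register 12 holds the common denominator. -/
noncomputable def bestY (l : ℕ) (σ : Mem) : Fin l → ℝ :=
  fun k => (σ.arr 12 (k : ℤ) : ℝ) / (σ.reg 12 : ℝ)

namespace MIP

variable {m n l : ℕ}

/-- What the search has found is correct: register 9 tells whether the program is known to be unbounded,
register 10 whether there is a best point so far, and register 11 holds its value up to the
denominator in register 12. -/
structure Sound (I : MIP m n l) (σ : Mem) : Prop where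
  unbounded : 0 < σ.reg 9 → I.IsUnbounded
  pos : 0 < σ.reg 10 → 0 < σ.reg 12
  feasible : 0 < σ.reg 10 → I.Feasible (bestX n σ) (bestY l σ)
  value : 0 < σ.reg 10 → (σ.reg 11 : ℝ) = I.value (bestX n σ) (bestY l σ) * σ.reg 12

/-- The findings in `τ` are at least as good as those in `σ`. -/
structure Improved (I : MIP m n l) (σ τ : Mem) : Prop where
  unbounded : 0 < σ.reg 9 → 0 < τ.reg 9
  best : 0 < σ.reg 10 → 0 < τ.reg 10 ∧
    I.value (bestX n σ) (bestY l σ) ≤ I.value (bestX n τ) (bestY l τ)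

/-- The findings cover the restricted program for `s` and `x`. -/
def Covers (I : MIP m n l) (σ : Mem) (s : Fin m → Fin n) (x : Fin n → ℤ) : Prop :=
  I.Searched (0 < σ.reg 9) (0 < σ.reg 10) (bestX n σ) (bestY l σ) s x

theorem Covers.mono {I : MIP m n l} {σ τ : Mem} {s : Fin m → Fin n} {x : Fin n → ℤ}
    (h : I.Covers σ s x) (hστ : I.Improved σ τ) : I.Covers τ s x := by
  refine ⟨fun hu z y hzy => ?_⟩
  obtain ⟨h1, h2⟩ := h.found (fun h => hu (hστ.unbounded h)) z y hzy
  exact ⟨(hστ.best h1).1, h2.trans (hστ.best h1).2⟩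

theorem Improved.refl (I : MIP m n l) (σ : Mem) : I.Improved σ σ := ⟨id, fun h => ⟨h, le_rfl⟩⟩

theorem Improved.trans {I : MIP m n l} {σ τ ρ : Mem} (h : I.Improved σ τ) (h' : I.Improved τ ρ) :
    I.Improved σ ρ :=
  ⟨fun hu => h'.unbounded (h.unbounded hu), fun hb =>
    ⟨(h'.best (h.best hb).1).1, (h.best hb).2.trans (h'.best (h.best hb).1).2⟩⟩

/-- The memories hold the same findings. -/
structure _root_.SameFindings (σ τ : Mem) : Prop where
  reg : ∀ r, 9 ≤ r → r < 13 → τ.reg r = σ.reg r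
  arr : ∀ a, 11 ≤ a → a < 13 → τ.arr a = σ.arr a

theorem _root_.SameFindings.bestX_eq {σ τ : Mem} (h : SameFindings σ τ) : bestX n τ = bestX n σ := by
  funext j; simp [bestX, h.arr 11]

theorem _root_.SameFindings.bestY_eq {σ τ : Mem} (h : SameFindings σ τ) : bestY l τ = bestY l σ := by
  funext j; simp [bestY, h.arr 12, h.reg 12]

theorem Sound.congr {I : MIP m n l} {σ τ : Mem} (hσ : I.Sound σ) (h : SameFindings σ τ) :
    I.Sound τ := by
  refine ⟨?_, ?_, ?_, ?_⟩ <;>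
    simp only [h.reg 9 (by omega) (by omega), h.reg 10 (by omega) (by omega),
      h.reg 11 (by omega) (by omega), h.reg 12 (by omega) (by omega), h.bestX_eq, h.bestY_eq]
  exacts [hσ.1, hσ.2, hσ.3, hσ.4]

theorem _root_.SameFindings.improved {I : MIP m n l} {σ τ : Mem} (h : SameFindings σ τ) :
    I.Improved σ τ := by
  refine ⟨?_, ?_⟩ <;>
    simp only [h.reg 9 (by omega) (by omega), h.reg 10 (by omega) (by omega), h.bestX_eq, h.bestY_eq]
  exacts [id, fun h => ⟨h, le_rfl⟩]

theorem Loaded.congr {I : MIP m n l} {σ τ : Mem} (h : I.Loaded σ)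
    (hr : ∀ r < 3, τ.reg r = σ.reg r) (ha : ∀ a < 5, τ.arr a = σ.arr a) : I.Loaded τ := by
  obtain ⟨h0, h1, h2, hA, hB, hb, hc, hd⟩ := h
  refine ⟨?_, ?_, ?_, ?_, ?_, ?_, ?_, ?_⟩
  · rw [hr 0 (by omega), h0]
  · rw [hr 1 (by omega), h1]
  · rw [hr 2 (by omega), h2]
  · rw [ha 0 (by omega)]; exact hA
  · rw [ha 1 (by omega)]; exact hB
  · rw [ha 2 (by omega)]; exact hb
  · rw [ha 3 (by omega)]; exact hc
  · rw [ha 4 (by omega)]; exact hd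

end MIP

/-- Store the current point as the best one. -/
def saveCmd : Cmd :=
  .set 10 1 ;; .set 11 (reg 24) ;; .set 12 (reg 101) ;;
  .loop 21 1 (.put 11 (reg 21) (get 10 (reg 21))) ;; .loop 21 2 (.put 12 (reg 21) (get 41 (reg 21)))

theorem wp_saveCmd {n l : ℕ} {σ : Mem} (h1 : σ.reg 1 = n) (h2 : σ.reg 2 = l) :
    saveCmd.wp (fun t τ => t ≤ 30 + n * 20 + l * 20 ∧ τ.reg 10 = 1 ∧ τ.reg 11 = σ.reg 24 ∧
      τ.reg 12 = σ.reg 101 ∧ bestX n τ = (fun j : Fin n => σ.arr 10 (j : ℤ)) ∧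
      bestY l τ = fun k : Fin l => (σ.arr 41 (k : ℤ) : ℝ) / (σ.reg 101 : ℝ)) σ := by
  simp only [saveCmd, Cmd.wp_seq, Cmd.wp_set]
  refine Cmd.wp_use (Cmd.wp_fill rfl n (by simp [h1]) (fun k => σ.arr 10 k) ?_) ?_
  · intro k hk τ hi hF
    simp [hi, hF.arr 10 rfl]
  rintro t₁ τ₁ hF₁ ⟨ht₁, H₁⟩
  refine Cmd.wp_use (Cmd.wp_fill rfl l (by simp [hF₁.reg 2 rfl, h2]) (fun k => σ.arr 41 k) ?_) ?_
  · intro k hk τ hi hF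
    simp [hi, hF.arr 41 rfl, hF₁.arr 41 rfl]
  rintro t₂ τ₂ hF₂ ⟨ht₂, H₂⟩
  simp at ht₁ ht₂
  refine ⟨by simp; omega, ?_, ?_, ?_, ?_, ?_⟩
  · simp [hF₂.reg 10 rfl, hF₁.reg 10 rfl]
  · simp [hF₂.reg 11 rfl, hF₁.reg 11 rfl]
  · simp [hF₂.reg 12 rfl, hF₁.reg 12 rfl]
  · funext j
    simp [bestX, hF₂.arr 11 rfl, H₁ j j.2]
  · funext k
    simp [bestY, hF₂.reg 12 rfl, hF₁.reg 12 rfl, H₂ k k.2]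

/-- Record an optimal solution of the restricted program if it is better than the best point so far. -/
def recordCmd : Cmd :=
  liftCmd ;; valueCmd ;;
  .ite (1 - reg 10) saveCmd (.ite (reg 24 * reg 12 - reg 11 * reg 101) saveCmd .skip)

theorem wp_recordCmd {m n l : ℕ} {I : MIP m n l} {σ : Mem} (hL : I.Loaded σ) (hS : I.Sound σ)
    {s : Fin m → Fin n} {x : Fin n → ℤ} {z : Fin m → ℤ}
    (hs : ∀ i : Fin m, σ.arr 9 (i : ℤ) = (s i : ℕ)) (hx : ∀ j : Fin n, σ.arr 10 (j : ℤ) = x j)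
    (hz : ∀ i : Fin m, σ.arr 40 (i : ℤ) = z i) (hx0 : ∀ j, 0 ≤ x j) (hden : 0 < σ.reg 101)
    (hopt : (I.restrict s x).IsOptimal z (fun k => (σ.arr 41 (k : ℤ) : ℝ) / (σ.reg 101 : ℝ))) :
    recordCmd.wp (fun t τ => t ≤ 100 + m * 30 + n * 40 + l * 40 ∧ I.Sound τ ∧ I.Improved σ τ ∧
      I.Covers τ s x) σ := by
  rw [recordCmd, Cmd.wp_seq]
  refine Cmd.wp_use (wp_liftCmd hL.1 hs hx hz) ?_
  rintro t₁ τ₁ hF₁ ⟨ht₁, H₁⟩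
  have hreg : ∀ r, r ≠ 21 → τ₁.reg r = σ.reg r := by
    intro r hr
    refine hF₁.reg r ?_
    simpa [liftCmd, Cmd.wr] using hr.symm
  have harr : ∀ a, a ≠ 10 → τ₁.arr a = σ.arr a := by
    intro a ha
    refine hF₁.arr a ?_
    simpa [liftCmd, Cmd.wa] using ha.symm
  have hL₁ : I.Loaded τ₁ := hL.congr (fun r hr => hreg r (by omega)) fun a ha => harr a (by omega)
  rw [Cmd.wp_seq]
  refine Cmd.wp_use (wp_valueCmd hL₁ H₁ (by rwa [hreg 101 (by omega)])) ?_
  rintro t₂ τ₂ hF₂ ⟨ht₂, H₂⟩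
  have hreg₂ : ∀ r, r ≠ 21 → r ≠ 24 → τ₂.reg r = σ.reg r := by
    intro r hr hr'
    rw [hF₂.reg r (by simp [valueCmd, Cmd.wr, hr.symm, hr'.symm]), hreg r hr]
  have harr₂ : ∀ a, a ≠ 10 → τ₂.arr a = σ.arr a := by
    intro a ha
    rw [hF₂.arr a (by simp [valueCmd, Cmd.wa]), harr a ha]
  have hsame : SameFindings σ τ₂ :=
    ⟨fun r h1 h2 => hreg₂ r (by omega) (by omega), fun a h1 h2 => harr₂ a (by omega)⟩
  rw [harr 41 (by omega), hreg 101 (by omega)] at H₂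
  set X := MIP.lift s x z with hX
  set Y : Fin l → ℝ := fun k => (σ.arr 41 (k : ℤ) : ℝ) / (σ.reg 101 : ℝ) with hY
  have hfeas : I.Feasible X Y := MIP.feasible_lift hx0 hopt.1
  have hle : ∀ z' y', (I.restrict s x).Feasible z' y' →
      I.value (MIP.lift s x z') y' ≤ I.value X Y := by
    intro z' y' h
    rw [hX, MIP.value_lift, MIP.value_lift]
    linarith [hopt.2 z' y' h]
  have hden' : (0 : ℝ) < σ.reg 101 := by exact_mod_cast hden
  have save : (0 < σ.reg 10 → I.value (bestX n σ) (bestY l σ) ≤ I.value X Y) →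
      saveCmd.wp (fun t τ => t ≤ 30 + n * 20 + l * 20 ∧ I.Sound τ ∧ I.Improved σ τ ∧
        I.Covers τ s x) τ₂ := by
    intro himp
    refine Cmd.wp_use (wp_saveCmd (n := n) (l := l) (by rw [hreg₂ 1 (by omega) (by omega), hL.2.1])
      (by rw [hreg₂ 2 (by omega) (by omega), hL.2.2.1])) ?_
    rintro t τ hF ⟨ht, h10, h11, h12, hbx, hby⟩
    have h9 : τ.reg 9 = σ.reg 9 := by rw [hF.reg 9 rfl, hreg₂ 9 (by omega) (by omega)]
    rw [hreg₂ 101 (by omega) (by omega)] at h12 hby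
    rw [harr₂ 41 (by omega)] at hby
    have hbx' : bestX n τ = X := by
      rw [hbx]; funext j; rw [hF₂.arr 10 rfl, H₁]
    have hyb : bestY l τ = Y := hby
    refine ⟨ht, ⟨?_, ?_, ?_, ?_⟩, ⟨?_, ?_⟩, ⟨?_⟩⟩
    · rw [h9]; exact hS.unbounded
    · intro _; rw [h12]; exact hden
    · intro _; rw [hbx', hyb]; exact hfeas
    · intro _; rw [hbx', hyb, h11, h12]; exact H₂
    · rw [h9]; exact id
    · intro h; rw [hbx', hyb]; exact ⟨by omega, himp h⟩
    · intro _ z' y' h; rw [hbx', hyb]; exact ⟨by omega, hle z' y' h⟩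
  rw [Cmd.wp_ite, Cmd.wp_ite]
  have r10 : τ₂.reg 10 = σ.reg 10 := hreg₂ 10 (by omega) (by omega)
  have r11 : τ₂.reg 11 = σ.reg 11 := hreg₂ 11 (by omega) (by omega)
  have r12 : τ₂.reg 12 = σ.reg 12 := hreg₂ 12 (by omega) (by omega)
  have r101 : τ₂.reg 101 = σ.reg 101 := hreg₂ 101 (by omega) (by omega)
  -- cross multiplication, both denominators being positive
  have hcmp : 0 < σ.reg 10 → (0 < τ₂.reg 24 * σ.reg 12 - σ.reg 11 * σ.reg 101 ↔
      I.value (bestX n σ) (bestY l σ) < I.value X Y) := by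
    intro hb
    have hp : (0 : ℝ) < σ.reg 12 := by exact_mod_cast hS.pos hb
    rw [← @Int.cast_pos ℝ]
    push_cast
    rw [H₂, hS.value hb, sub_pos]
    rw [show I.value (bestX n σ) (bestY l σ) * (σ.reg 12 : ℝ) * σ.reg 101
      = I.value (bestX n σ) (bestY l σ) * (σ.reg 101 * σ.reg 12) by ring, mul_assoc]
    exact mul_lt_mul_iff_left₀ (mul_pos hden' hp)
  refine ⟨fun g => ?_, fun g => ⟨fun g' => ?_, fun g' => ?_⟩⟩
  · refine Cmd.wp_mono _ ?_ (save fun h => ?_)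
    · rintro t τ ⟨ht, h⟩
      exact ⟨by simp; omega, h⟩
    · simp [r10] at g; omega
  · refine Cmd.wp_mono _ ?_ (save fun h => ?_)
    · rintro t τ ⟨ht, h⟩
      exact ⟨by simp; omega, h⟩
    · simp only [RExpr.eval_sub, RExpr.eval_mul, RExpr.eval_reg, r11, r12, r101] at g'
      exact ((hcmp h).1 g').le
  · have hb : 0 < σ.reg 10 := by simp [r10] at g; omega
    simp only [RExpr.eval_sub, RExpr.eval_mul, RExpr.eval_reg, r11, r12, r101] at g'
    rw [hcmp hb, not_lt] at g'
    rw [Cmd.skip, Cmd.wp_set]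
    have hsame' : SameFindings σ (τ₂.setReg 49 (RExpr.eval 0 τ₂)) := by
      refine ⟨fun r h1 h2 => ?_, fun a h1 h2 => hsame.arr a h1 h2⟩
      rw [Mem.reg_setReg, if_neg (by omega), hsame.reg r h1 h2]
    refine ⟨by simp; omega, hS.congr hsame', hsame'.improved, ⟨fun _ z' y' h => ?_⟩⟩
    rw [hsame'.bestX_eq, hsame'.bestY_eq, hsame'.reg 10 (by omega) (by omega)]
    exact ⟨hb, (hle z' y' h).trans g'⟩

end Program

/-! ### Using the table -/

namespace MIP

variable {m n l : ℕ}

theorem Small.abs_sum_colCode_le {I : MIP m n l} {D : ℕ} (hA : ∀ i j, (I.A i j).natAbs ≤ D)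
    {x : Fin n → ℤ} (hx : Small m D x) :
    |∑ j, I.colCode D j * x j| ≤ ((encBase m n D ^ m : ℕ) : ℤ) := by
  rw [sum_colCode]
  exact abs_enc_le (hx.abs_mulVec_le hA)

theorem smallBound_mul_abs_colCode_le {I : MIP m n l} {D : ℕ} (hA : ∀ i j, (I.A i j).natAbs ≤ D)
    (j : Fin n) : (smallBound m n D : ℤ) * |I.colCode D j| ≤ ((encBase m n D ^ m : ℕ) : ℤ) := by
  have h : Small m D (Pi.single j (smallBound m n D : ℤ)) := by
    intro i
    by_cases hij : i = j
    · subst hij; simp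
    · simp [hij]
  have := h.abs_sum_colCode_le hA
  rwa [Finset.sum_eq_single j (by intro i _ hi; simp [hi]) (by simp), Pi.single_eq_same, abs_mul,
    mul_comm, abs_of_nonneg (by positivity : (0 : ℤ) ≤ (smallBound m n D : ℤ))] at this

/-- The memory holds the input, the parameters and the complete table. -/
structure Prepared (I : MIP m n l) (D : ℕ) (σ : Mem) : Prop where
  loaded : I.Loaded σ
  u : σ.reg 4 = smallBound m n D
  K : σ.reg 6 = (encBase m n D ^ m : ℕ)
  N : σ.reg 7 = n + 1
  codes : ∀ j : Fin n, σ.arr 5 (j : ℤ) = I.colCode D j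
  table : Table n (encBase m n D ^ m : ℕ) (smallBound m n D) (fun j => σ.arr 5 (j : ℤ))
    (fun j => σ.arr 3 (j : ℤ)) (σ.arr 6) (σ.arr 7) (σ.arr 8) n 0

theorem Prepared.congr {I : MIP m n l} {D : ℕ} {σ τ : Mem} (h : I.Prepared D σ)
    (hr : ∀ r < 8, τ.reg r = σ.reg r) (ha : ∀ a < 9, τ.arr a = σ.arr a) : I.Prepared D τ := by
  refine ⟨h.loaded.congr (fun r h => hr r (by omega)) (fun a h => ha a (by omega)), ?_, ?_, ?_, ?_, ?_⟩
  · rw [hr 4 (by omega), h.u]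
  · rw [hr 6 (by omega), h.K]
  · rw [hr 7 (by omega), h.N]
  · rw [ha 5 (by omega)]; exact h.codes
  · rw [ha 5 (by omega), ha 3 (by omega), ha 6 (by omega), ha 7 (by omega), ha 8 (by omega)]
    exact h.table

theorem Prepared.complete {I : MIP m n l} {D : ℕ} {σ : Mem} (h : I.Prepared D σ)
    (hA : ∀ i j, (I.A i j).natAbs ≤ D) {x : Fin n → ℤ} (hx : Small m D x) :
    0 < σ.arr 6 (tableIdx n (∑ j, I.colCode D j * x j) n) ∧
      I.c ⬝ᵥ x ≤ σ.arr 7 (tableIdx n (∑ j, I.colCode D j * x j) n) := by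
  have hsum : ∀ (f : ℕ → ℤ) (g : Fin n → ℤ), (∀ j : Fin n, f j = g j) →
      ∑ j ∈ Finset.range n, f j * (if h : j < n then x ⟨j, h⟩ else 0) = ∑ j, g j * x j := by
    intro f g hfg
    rw [Finset.sum_range]
    exact Finset.sum_congr rfl fun j _ => by simp [hfg]
  have key := h.table.complete (fun j => if h : j < n then x ⟨j, h⟩ else 0)
    (fun j => by split_ifs; exacts [(hx _).1, le_rfl])
    (fun j => by split_ifs; exacts [(hx _).2, Int.natCast_nonneg _]) ?_ n le_rfl
  · rw [hsum _ _ h.codes, hsum _ I.c h.loaded.2.2.2.2.2.2.1] at key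
    exact key
  · intro j hj
    -- a partial sum is the full sum for a truncated vector, which is also small
    have hx' : Small m D (fun i : Fin n => if (i : ℕ) < j then x i else 0) := by
      intro i
      dsimp only
      split_ifs
      · exact hx i
      · exact ⟨le_rfl, Int.natCast_nonneg _⟩
    have := hx'.abs_sum_colCode_le hA
    convert this using 2
    have e : ∑ i : Fin n, I.colCode D i * (if (i : ℕ) < j then x i else 0) =
        ∑ i ∈ Finset.range n, σ.arr 5 (i : ℤ) *
          (if i < j then (if h : i < n then x ⟨i, h⟩ else 0) else 0) := by
      rw [Finset.sum_range]
      exact Finset.sum_congr rfl fun i _ => by simp [h.codes]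
    rw [e, ← Finset.sum_subset (Finset.range_mono hj)]
    · refine Finset.sum_congr rfl fun i hi => ?_
      rw [if_pos (Finset.mem_range.1 hi)]
    · intro i _ hi
      rw [if_neg (by simpa using hi), mul_zero]

end MIP

section Program

open RExpr (reg get)

local infixr:60 " ;; " => Cmd.seq

/-! ### The search -/

/-- Treat the restricted program given by the number in register 15 of the choice of columns and by the
code in register 16 of the fixed values: solve it with `P` and record the answer. -/
def processCmd (P : Prog) : Cmd :=
  readCmd ;; digitsCmd ;; buildCmd ;; .call P ;;
  .ite (reg 100) (.ite (reg 100 - 1) (.set 9 1) recordCmd) .skip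

theorem wp_processCmd {m n l : ℕ} {I : MIP m n l} {D : ℕ} {P : Prog} {κ : ℕ∞} {σ : Mem}
    (hA : ∀ i j, (I.A i j).natAbs ≤ D)
    (hcall : ∀ (s : Fin m → Fin n) (x : Fin n → ℤ), MIP.Small m D x → ∀ ρ,
      (I.restrict s x).Loaded ρ → ∃ t ρ', Exec P ρ t ρ' ∧ (t : ℕ∞) ≤ κ ∧
        (I.restrict s x).Answered ρ')
    (hP : I.Prepared D σ) (hS : I.Sound σ) {p : ℕ} {k : ℤ} (h15 : σ.reg 15 = p) (h16 : σ.reg 16 = k)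
    (hk : |k| ≤ ((encBase m n D ^ m : ℕ) : ℤ)) (hf : 0 < σ.arr 6 (tableIdx n k n))
    {s : Fin m → Fin n} (hs : ∀ i, (s i : ℕ) = p / n ^ (i : ℕ) % n) :
    (processCmd P).wp (fun t τ => (∃ tP : ℕ, (tP : ℕ∞) ≤ κ ∧
        t ≤ 250 + 100 * (m * m + m * l + m * (n + 1) + m + n + l) + tP) ∧
      I.Sound τ ∧ I.Improved σ τ ∧ ∃ x, MIP.Small m D x ∧ ∑ j, I.colCode D j * x j = k ∧
        I.c ⬝ᵥ x = σ.arr 7 (tableIdx n k n) ∧ I.Covers τ s x) σ := by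
  rw [processCmd, Cmd.wp_seq]
  refine Cmd.wp_use (wp_readCmd hP.loaded.2.1 hP.N h16 (fun _ _ => rfl) hP.table ?_ hk hf) ?_
  · intro j hj
    have := MIP.smallBound_mul_abs_colCode_le hA ⟨j, hj⟩
    rwa [← hP.codes] at this
  rintro t₁ τ₁ hF₁ ⟨ht₁, hsm, hcode, hval⟩
  set x : Fin n → ℤ := fun j => τ₁.arr 10 (j : ℤ) with hxdef
  have hx : MIP.Small m D x := fun j => hsm j j.2
  have hcode' : ∑ j, I.colCode D j * x j = k := by
    rw [← hcode, Finset.sum_range]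
    exact Finset.sum_congr rfl fun j _ => by rw [hP.codes]
  have hval' : I.c ⬝ᵥ x = σ.arr 7 (tableIdx n k n) := by
    rw [← hval, Finset.sum_range]
    exact Finset.sum_congr rfl fun j _ => by rw [hP.loaded.2.2.2.2.2.2.1]
  rw [Cmd.wp_seq]
  refine Cmd.wp_use (wp_digitsCmd (m := m) (n := n) (p := p) ?_ ?_ ?_) ?_
  · rw [hF₁.reg 0 rfl, hP.loaded.1]
  · rw [hF₁.reg 1 rfl, hP.loaded.2.1]
  · rw [hF₁.reg 15 rfl, h15]
  rintro t₂ τ₂ hF₂ ⟨ht₂, hdig⟩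
  have hL₂ : I.Loaded τ₂ := by
    refine hP.loaded.congr (fun r hr => ?_) fun a ha => ?_
    · rw [hF₂.reg r (by interval_cases r <;> rfl), hF₁.reg r (by interval_cases r <;> rfl)]
    · rw [hF₂.arr a (by interval_cases a <;> rfl), hF₁.arr a (by interval_cases a <;> rfl)]
  rw [Cmd.wp_seq]
  refine Cmd.wp_use (wp_buildCmd hL₂ (s := s) (x := x) (fun i => ?_) (fun j => ?_)) ?_
  · rw [hdig i i.2, hs]
  · rw [hF₂.arr 10 rfl]
  rintro t₃ τ₃ hF₃ ⟨ht₃, hbuilt⟩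
  obtain ⟨tP, ρ, hexec, htP, hans⟩ := hcall s x hx _ hbuilt
  have hreg : ∀ r, r < 20 → (τ₃.withInner ρ).reg r = σ.reg r := by
    intro r hr
    have : (τ₃.withInner ρ).reg r = τ₃.reg r := by simp [Mem.withInner]; omega
    rw [this, hF₃.reg r (by interval_cases r <;> rfl), hF₂.reg r (by interval_cases r <;> rfl),
      hF₁.reg r (by interval_cases r <;> rfl)]
  have harr : ∀ a, a ≠ 9 → a ≠ 10 → a < 20 → (τ₃.withInner ρ).arr a = σ.arr a := by
    intro a h9 h10 h20
    have : (τ₃.withInner ρ).arr a = τ₃.arr a := by simp [Mem.withInner]; omega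
    rw [this, hF₃.arr a (by interval_cases a <;> rfl),
      hF₂.arr a (by interval_cases a <;> first | rfl | omega),
      hF₁.arr a (by interval_cases a <;> first | rfl | omega)]
  have hsame : SameFindings σ (τ₃.withInner ρ) :=
    ⟨fun r _ _ => hreg r (by omega), fun a _ _ => harr a (by omega) (by omega) (by omega)⟩
  have h100 : (τ₃.withInner ρ).reg 100 = ρ.reg 0 := by simp [Mem.withInner]
  rw [Cmd.wp_seq]
  refine ⟨tP, ρ, hexec, ?_⟩
  have main : (Cmd.ite (reg 100) (.ite (reg 100 - 1) (.set 9 1) recordCmd) .skip).wp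
      (fun t τ => t ≤ 120 + m * 30 + n * 40 + l * 40 ∧ I.Sound τ ∧ I.Improved σ τ ∧
        I.Covers τ s x) (τ₃.withInner ρ) := by
    rw [Cmd.wp_ite, Cmd.wp_ite]
    rcases hans with ⟨h0, hinf⟩ | ⟨h0, hden, hopt⟩ | ⟨h0, hunb⟩
    · refine ⟨fun g => ?_, fun _ => ?_⟩
      · simp [h100, h0] at g
      · rw [Cmd.skip, Cmd.wp_set]
        have hsame' : SameFindings σ
            ((τ₃.withInner ρ).setReg 49 (RExpr.eval 0 (τ₃.withInner ρ))) := by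
          refine ⟨fun r h1 h2 => ?_, fun a h1 h2 => hsame.arr a h1 h2⟩
          rw [Mem.reg_setReg, if_neg (by omega), hsame.reg r h1 h2]
        exact ⟨by simp; omega, hS.congr hsame', hsame'.improved,
          ⟨fun _ z y h => absurd h (hinf z y)⟩⟩
    · refine ⟨fun _ => ⟨fun g => ?_, fun _ => ?_⟩, fun g => ?_⟩
      · simp [h100, h0] at g
      · have h101 : (τ₃.withInner ρ).reg 101 = ρ.reg 1 := by simp [Mem.withInner]
        have h41 : (τ₃.withInner ρ).arr 41 = ρ.arr 1 := by simp [Mem.withInner]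
        have h40 : (τ₃.withInner ρ).arr 40 = ρ.arr 0 := by simp [Mem.withInner]
        have hL : I.Loaded (τ₃.withInner ρ) :=
          hP.loaded.congr (fun r hr => hreg r (by omega))
            fun a ha => harr a (by omega) (by omega) (by omega)
        have h9 : (τ₃.withInner ρ).arr 9 = τ₂.arr 9 := by
          simp [Mem.withInner, hF₃.arr 9 rfl]
        have h10 : (τ₃.withInner ρ).arr 10 = τ₁.arr 10 := by
          simp [Mem.withInner, hF₃.arr 10 rfl, hF₂.arr 10 rfl]
        refine Cmd.wp_mono _ ?_ (wp_recordCmd hL (hS.congr hsame) (s := s) (x := x)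
          (z := fun i => ρ.arr 0 (i : ℤ)) ?_ ?_ ?_ ?_ ?_ ?_)
        · rintro t τ ⟨ht, h1, h2, h3⟩
          exact ⟨by simp; omega, h1, hsame.improved.trans h2, h3⟩
        · intro i; rw [h9, hdig i i.2, hs]
        · intro j; rw [h10]
        · intro i; rw [h40]
        · exact fun j => (hx j).1
        · rw [h101]; exact hden
        · rw [h101, h41]; exact hopt
      · simp [h100, h0] at g
    · refine ⟨fun _ => ⟨fun _ => ?_, fun g => ?_⟩, fun g => ?_⟩
      · rw [Cmd.wp_set]
        set τ := (τ₃.withInner ρ).setReg 9 (RExpr.eval 1 (τ₃.withInner ρ)) with hτ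
        have h9 : 0 < τ.reg 9 := by simp [hτ]
        have hr : ∀ r, 10 ≤ r → r < 13 → τ.reg r = σ.reg r := by
          intro r h1 h2
          rw [hτ, Mem.reg_setReg, if_neg (by omega), hreg r (by omega)]
        have hbx : bestX n τ = bestX n σ := hsame.bestX_eq
        have hby : bestY l τ = bestY l σ := by
          funext k
          simp only [bestY, hr 12 (by omega) (by omega)]
          rw [← hsame.arr 12 (by omega) (by omega)]
          rfl
        refine ⟨by simp; omega, ⟨fun _ => ?_, ?_, ?_, ?_⟩, ⟨fun _ => h9, ?_⟩,
          ⟨fun h => absurd h9 h⟩⟩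
        · exact MIP.isUnbounded_of_restrict (fun j => (hx j).1) hunb
        · rw [hr 10 (by omega) (by omega), hr 12 (by omega) (by omega)]; exact hS.pos
        · rw [hr 10 (by omega) (by omega), hbx, hby]; exact hS.feasible
        · rw [hr 10 (by omega) (by omega), hbx, hby, hr 11 (by omega) (by omega),
            hr 12 (by omega) (by omega)]
          exact hS.value
        · rw [hr 10 (by omega) (by omega), hbx, hby]
          exact fun h => ⟨h, le_rfl⟩
      · simp [h100, h0] at g
      · simp [h100, h0] at g
  refine Cmd.wp_mono _ ?_ main
  rintro t τ ⟨ht, h1, h2, h3⟩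
  refine ⟨⟨tP, htP, ?_⟩, h1, h2, x, hx, hcode', hval', h3⟩
  ring_nf at ht₁ ht₂ ht₃ ht ⊢
  omega

/-- The choice of columns with number `p`. -/
def columnChoice {m n : ℕ} (hn : 1 ≤ n) (p : ℕ) : Fin m → Fin n :=
  fun i => ⟨p / n ^ (i : ℕ) % n, Nat.mod_lt _ hn⟩

/-- Run through all choices of columns and all codes of fixed values. -/
def searchCmd (P : Prog) : Cmd :=
  .set 14 (2 * reg 6 + 1) ;; .loop 20 0 (.set 14 (reg 14 * reg 1)) ;;
  .loop 13 14 (.set 15 (reg 13 / (2 * reg 6 + 1)) ;;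
    .set 16 (reg 13 - reg 15 * (2 * reg 6 + 1) - reg 6) ;;
    .ite (get 6 (reg 16 * reg 7 + reg 1)) (processCmd P) .skip)

theorem wp_searchCmd {m n l : ℕ} {I : MIP m n l} {D : ℕ} {P : Prog} {κ : ℕ∞} {σ : Mem} {K : ℕ}
    (hn : 1 ≤ n) (hK : encBase m n D ^ m = K) (hA : ∀ i j, (I.A i j).natAbs ≤ D)
    (hcall : ∀ (s : Fin m → Fin n) (x : Fin n → ℤ), MIP.Small m D x → ∀ ρ,
      (I.restrict s x).Loaded ρ → ∃ t ρ', Exec P ρ t ρ' ∧ (t : ℕ∞) ≤ κ ∧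
        (I.restrict s x).Answered ρ')
    (hP : I.Prepared D σ) (hS : I.Sound σ) :
    (searchCmd P).wp (fun t τ => (∃ tP : ℕ, (tP : ℕ∞) ≤ ((2 * K + 1) * n ^ m : ℕ) * κ ∧
        t ≤ 50 + m * 20 + (2 * K + 1) * n ^ m *
          (300 + 100 * (m * m + m * l + m * (n + 1) + m + n + l)) + tP) ∧
      I.Sound τ ∧ ∀ p < n ^ m, ∀ k : ℤ, |k| ≤ K → 0 < σ.arr 6 (tableIdx n k n) →
        ∃ x, MIP.Small m D x ∧ ∑ j, I.colCode D j * x j = k ∧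
          I.c ⬝ᵥ x = σ.arr 7 (tableIdx n k n) ∧ I.Covers τ (columnChoice hn p) x) σ := by
  rw [searchCmd, Cmd.wp_seq, Cmd.wp_set, Cmd.wp_seq]
  refine Cmd.wp_use (Cmd.wp_loop' rfl m (by simp [hP.loaded.1]) 7
    (fun k τ => τ.reg 14 = ((2 * K + 1) * n ^ k : ℕ)) (by simp [hP.K, hK]) ?_) ?_
  · intro k hk τ hi hF hI
    rw [Cmd.wp_set]
    refine ⟨by simp, ?_⟩
    have e : τ.reg 1 = n := by rw [hF.reg 1 rfl]; simp [hP.loaded.2.1]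
    simp [hI, e, pow_succ, mul_assoc]
  rintro t₁ τ₁ hF₁ ⟨ht₁, h14⟩
  set T := 250 + 100 * (m * m + m * l + m * (n + 1) + m + n + l) with hT
  have hP₁ : I.Prepared D τ₁ := by
    refine hP.congr (fun r hr => ?_) fun a ha => ?_
    · rw [hF₁.reg r (by interval_cases r <;> rfl), Mem.reg_setReg, if_neg (by omega)]
    · rw [hF₁.arr a (by interval_cases a <;> rfl), Mem.arr_setReg]
  have hS₁ : I.Sound τ₁ := by
    refine hS.congr ⟨fun r h1 h2 => ?_, fun a h1 h2 => ?_⟩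
    · rw [hF₁.reg r (by interval_cases r <;> rfl), Mem.reg_setReg, if_neg (by omega)]
    · rw [hF₁.arr a (by interval_cases a <;> rfl), Mem.arr_setReg]
  have e6 : τ₁.arr 6 = σ.arr 6 := hF₁.arr 6 rfl
  have e7 : τ₁.arr 7 = σ.arr 7 := hF₁.arr 7 rfl
  refine Cmd.wp_loop rfl ((2 * K + 1) * n ^ m) h14 (fun q t τ => (∃ tP : ℕ, (tP : ℕ∞) ≤ q * κ ∧
      t ≤ 3 + q * (T + 50) + tP) ∧ I.Sound τ ∧ ∀ q' < q,
      0 < σ.arr 6 (tableIdx n ((q' % (2 * K + 1) : ℕ) - K) n) →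
        ∃ x, MIP.Small m D x ∧ ∑ j, I.colCode D j * x j = (q' % (2 * K + 1) : ℕ) - K ∧
          I.c ⬝ᵥ x = σ.arr 7 (tableIdx n ((q' % (2 * K + 1) : ℕ) - K) n) ∧
          I.Covers τ (columnChoice hn (q' / (2 * K + 1))) x) ?_ ?_ ?_
  · refine ⟨⟨0, by simp, by simp⟩, hS₁.congr ⟨fun r h1 h2 => ?_, fun a h1 h2 => rfl⟩, by simp⟩
    rw [Mem.reg_setReg, if_neg (by omega)]
  · rintro q hq t τ h13 hF ⟨⟨tP, htP, ht⟩, hSτ, hcov⟩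
    have hreg : ∀ r, r < 8 → τ.reg r = τ₁.reg r := fun r hr =>
      hF.reg r (by interval_cases r <;> rfl)
    have harr : ∀ a, a < 9 → τ.arr a = τ₁.arr a := fun a ha =>
      hF.arr a (by interval_cases a <;> rfl)
    have hPτ : I.Prepared D τ := hP₁.congr hreg harr
    have r6 : τ.reg 6 = K := by rw [hPτ.K, hK]
    rw [Cmd.wp_seq, Cmd.wp_set, Cmd.wp_seq, Cmd.wp_set]
    set p := q / (2 * K + 1) with hp
    set k : ℤ := (q % (2 * K + 1) : ℕ) - K with hk
    have hdiv : (q : ℤ) / (2 * K + 1) = p := by rw [hp]; push_cast; rfl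
    have hmod : (q : ℤ) - p * (2 * K + 1) - K = k := by
      have h : (((2 * K + 1) * (q / (2 * K + 1)) + q % (2 * K + 1) : ℕ) : ℤ) = q := by
        rw [Nat.div_add_mod]
      rw [hk, ← h, ← hp]
      push_cast
      ring
    simp only [RExpr.eval_div, RExpr.eval_add, RExpr.eval_mul, RExpr.eval_sub, RExpr.eval_reg,
      RExpr.eval_one, RExpr.eval_two, Mem.reg_setReg, Nat.reduceEqDiff, reduceIte, h13, r6, hdiv,
      hmod]
    set τ' := (τ.setReg 15 p).setReg 16 k with hτ'
    have hsame : SameFindings τ τ' := by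
      refine ⟨fun r h1 h2 => ?_, fun a h1 h2 => rfl⟩
      rw [hτ', Mem.reg_setReg, if_neg (by omega), Mem.reg_setReg, if_neg (by omega)]
    have hPτ' : I.Prepared D τ' := by
      refine hPτ.congr (fun r hr => ?_) fun a ha => rfl
      rw [hτ', Mem.reg_setReg, if_neg (by omega), Mem.reg_setReg, if_neg (by omega)]
    have hidx : (RExpr.get 6 (reg 16 * reg 7 + reg 1)).eval τ' = σ.arr 6 (tableIdx n k n) := by
      have e1 : τ'.reg 1 = n := hPτ'.loaded.2.1
      have e2 : τ'.reg 16 = k := by simp [hτ']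
      have e3 : τ'.arr 6 = σ.arr 6 := by rw [← e6, ← harr 6 (by omega)]; rfl
      simp [e1, e2, e3, hPτ'.N, tableIdx]
    have f7 : τ'.arr 7 = σ.arr 7 := by rw [← e7, ← harr 7 (by omega)]; rfl
    have f6 : τ'.arr 6 = σ.arr 6 := by rw [← e6, ← harr 6 (by omega)]; rfl
    have hcounter : ∀ ρ : Mem, SameFindings ρ (ρ.setReg 13 (q + 1)) := by
      intro ρ
      refine ⟨fun r h1 h2 => ?_, fun a h1 h2 => rfl⟩
      rw [Mem.reg_setReg, if_neg (by omega)]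
    -- what is covered stays covered; only the program with number `q` is new
    have hstep : ∀ (u uP : ℕ) (ρ : Mem), (uP : ℕ∞) ≤ κ → u ≤ T + 46 + uP → I.Sound ρ →
        I.Improved τ' ρ → (0 < σ.arr 6 (tableIdx n k n) → ∃ x, MIP.Small m D x ∧
          ∑ j, I.colCode D j * x j = k ∧ I.c ⬝ᵥ x = σ.arr 7 (tableIdx n k n) ∧
          I.Covers ρ (columnChoice hn p) x) →
        (∃ tP : ℕ, (tP : ℕ∞) ≤ (q + 1 : ℕ) * κ ∧ t + u + 4 ≤ 3 + (q + 1) * (T + 50) + tP) ∧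
        I.Sound (ρ.setReg 13 (q + 1)) ∧ ∀ q' < q + 1,
          0 < σ.arr 6 (tableIdx n ((q' % (2 * K + 1) : ℕ) - K) n) →
          ∃ x, MIP.Small m D x ∧ ∑ j, I.colCode D j * x j = (q' % (2 * K + 1) : ℕ) - K ∧
            I.c ⬝ᵥ x = σ.arr 7 (tableIdx n ((q' % (2 * K + 1) : ℕ) - K) n) ∧
            I.Covers (ρ.setReg 13 (q + 1)) (columnChoice hn (q' / (2 * K + 1))) x := by
      intro u uP ρ huP hu hSρ hI hnew
      refine ⟨⟨tP + uP, ?_, ?_⟩, hSρ.congr (hcounter ρ), fun q' hq' hpos => ?_⟩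
      · push_cast
        rw [add_mul, one_mul]
        exact add_le_add htP huP
      · rw [Nat.succ_mul]; omega
      · rcases Nat.lt_succ_iff_lt_or_eq.1 hq' with hq' | rfl
        · obtain ⟨x, h1, h2, h3, h4⟩ := hcov q' hq' hpos
          exact ⟨x, h1, h2, h3, h4.mono (hsame.improved.trans (hI.trans (hcounter ρ).improved))⟩
        · obtain ⟨x, h1, h2, h3, h4⟩ := hnew hpos
          exact ⟨x, h1, h2, h3, h4.mono (hcounter ρ).improved⟩
    rw [Cmd.wp_ite, hidx]
    refine ⟨fun g => ?_, fun g => ?_⟩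
    · refine Cmd.wp_mono _ ?_ (wp_processCmd (κ := κ) (p := p) (k := k)
        (s := columnChoice hn p) hA hcall hPτ' (hSτ.congr hsame) (by simp [hτ']) (by simp [hτ']) ?_
        (by rw [f6]; exact g) (fun i => rfl))
      · rintro u ρ ⟨⟨uP, huP, hu⟩, h1, h2, h3⟩
        rw [f7] at h3
        refine hstep _ uP ρ huP ?_ h1 h2 fun _ => h3
        simp
        omega
      · rw [hK, abs_le, hk]
        have := Nat.mod_lt q (by omega : 0 < 2 * K + 1)
        omega
    · rw [Cmd.skip, Cmd.wp_set]
      have hsk : SameFindings τ' (τ'.setReg 49 (RExpr.eval 0 τ')) := by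
        refine ⟨fun r h1 h2 => ?_, fun a h1 h2 => rfl⟩
        rw [Mem.reg_setReg, if_neg (by omega)]
      refine hstep _ 0 _ (by simp) ?_ ((hSτ.congr hsame).congr hsk) hsk.improved
        fun h => absurd h g
      simp
  · rintro t τ - - ⟨⟨tP, htP, ht⟩, hSτ, hcov⟩
    refine ⟨⟨tP, htP, ?_⟩, hSτ, fun p hp k hk hpos => ?_⟩
    · have : T + 50 = 300 + 100 * (m * m + m * l + m * (n + 1) + m + n + l) := by omega
      rw [← this]
      simp
      omega
    · have hk' := abs_le.1 hk
      obtain ⟨r, hr⟩ := Int.eq_ofNat_of_zero_le (by omega : 0 ≤ k + K)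
      have hrlt : r < 2 * K + 1 := by omega
      have hq : (2 * K + 1) * p + r < (2 * K + 1) * n ^ m := by
        have := Nat.mul_le_mul_left (2 * K + 1) (Nat.succ_le_of_lt hp)
        rw [Nat.mul_succ] at this
        omega
      have hmod : ((2 * K + 1) * p + r) % (2 * K + 1) = r := by
        rw [Nat.mul_add_mod, Nat.mod_eq_of_lt hrlt]
      have hdiv : ((2 * K + 1) * p + r) / (2 * K + 1) = p := by
        rw [Nat.mul_add_div (by omega), Nat.div_eq_of_lt hrlt, add_zero]
      have hkr : (r : ℤ) - K = k := by omega
      have := hcov _ hq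
      rw [hmod, hdiv, hkr] at this
      exact this hpos

/-! ### The whole algorithm -/

/-- Compute the parameters and the table, and start with no findings. Register 8 becomes the optimum of
the table for the zero right-hand side. -/
def setupCmd : Cmd :=
  maxCmd ;; boundCmd ;; codeCmd ;; tableInitCmd ;; levelsCmd ;;
  .set 8 (get 7 (reg 1)) ;; .set 9 0 ;; .set 10 0

theorem wp_setupCmd {m n l : ℕ} {I : MIP m n l} {σ : Mem} (hL : I.Loaded σ) :
    setupCmd.wp (fun t τ => ∃ D : ℕ, 1 ≤ D ∧ (∀ i j, (I.A i j).natAbs ≤ D) ∧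
      (∀ D' : ℕ, 1 ≤ D' → (∀ i j, (I.A i j).natAbs ≤ D') → D ≤ D') ∧
      I.Prepared D τ ∧ τ.reg 8 = τ.arr 7 (tableIdx n 0 n) ∧ τ.reg 9 = 0 ∧ τ.reg 10 = 0 ∧
      t ≤ 300 + 100 * (m * n + m + n) +
        200 * ((2 * encBase m n D ^ m + 1) * (n + 1) * (smallBound m n D + 2))) σ := by
  obtain ⟨h0, h1, h2, hA, hrest⟩ := hL
  have hflat : ∀ D : ℕ, (∀ p < m * n, (σ.arr 0 (p : ℤ)).natAbs ≤ D) ↔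
      ∀ i j, (I.A i j).natAbs ≤ D := by
    intro D
    constructor
    · intro h i j
      have hlt : (i : ℕ) * n + j < m * n := by
        have := Nat.mul_le_mul_right n (Nat.succ_le_of_lt i.2)
        have := j.2
        rw [Nat.succ_mul] at *
        omega
      have := h _ hlt
      push_cast at this
      rwa [hA i j] at this
    · intro h p hp
      have hn : 0 < n := Nat.pos_of_ne_zero (by rintro rfl; simp at hp)
      have := hA ⟨p / n, Nat.div_lt_of_lt_mul (by rwa [mul_comm] at hp)⟩ ⟨p % n, Nat.mod_lt _ hn⟩
      have e : ((p / n : ℕ) : ℤ) * n + (p % n : ℕ) = p := by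
        have := Nat.div_add_mod p n
        rw [mul_comm] at this
        exact_mod_cast this
      simp only [e] at this
      rw [this]
      exact h _ _
  rw [setupCmd, Cmd.wp_seq]
  refine Cmd.wp_use (wp_maxCmd h0 h1) ?_
  rintro t₁ τ₁ hF₁ ⟨ht₁, D, hD, h3, hle, hmin⟩
  rw [Cmd.wp_seq]
  refine Cmd.wp_use (wp_boundCmd (m := m) (n := n) (D := D) ?_ ?_ h3) ?_
  · rw [hF₁.reg 0 rfl, h0]
  · rw [hF₁.reg 1 rfl, h1]
  rintro t₂ τ₂ hF₂ ⟨ht₂, h4, h5, h6, h7⟩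
  rw [Cmd.wp_seq]
  refine Cmd.wp_use (wp_codeCmd (m := m) (n := n) (W := encBase m n D) ?_ ?_ h5) ?_
  · rw [hF₂.reg 0 rfl, hF₁.reg 0 rfl, h0]
  · rw [hF₂.reg 1 rfl, hF₁.reg 1 rfl, h1]
  rintro t₃ τ₃ hF₃ ⟨ht₃, hcodes⟩
  rw [Cmd.wp_seq]
  refine Cmd.wp_use (wp_tableInitCmd (n := n) (K := encBase m n D ^ m) (smallBound m n D)
    (fun j => τ₃.arr 5 (j : ℤ)) (fun j => τ₃.arr 3 (j : ℤ)) ?_ ?_) ?_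
  · rw [hF₃.reg 6 rfl, h6]
  · rw [hF₃.reg 7 rfl, h7]
  rintro t₄ τ₄ hF₄ ⟨ht₄, htab⟩
  rw [Cmd.wp_seq]
  refine Cmd.wp_use (wp_levelsCmd (n := n) (u := smallBound m n D) (K := encBase m n D ^ m)
    (a := fun j => τ₃.arr 5 (j : ℤ)) (c := fun j => τ₃.arr 3 (j : ℤ)) ?_ ?_ ?_ ?_ ?_ ?_ htab) ?_
  · rw [hF₄.reg 1 rfl, hF₃.reg 1 rfl, hF₂.reg 1 rfl, hF₁.reg 1 rfl, h1]
  · rw [hF₄.reg 4 rfl, hF₃.reg 4 rfl, h4]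
  · rw [hF₄.reg 6 rfl, hF₃.reg 6 rfl, h6]
  · rw [hF₄.reg 7 rfl, hF₃.reg 7 rfl, h7]
  · intro j _; rw [hF₄.arr 5 rfl]
  · intro j _; rw [hF₄.arr 3 rfl]
  rintro t₅ τ₅ hF₅ ⟨ht₅, htab'⟩
  simp only [Cmd.wp_seq, Cmd.wp_set]
  have hin : I.Loaded τ₅ := by
    refine MIP.Loaded.congr ⟨h0, h1, h2, hA, hrest⟩ (fun r hr => ?_) fun a ha => ?_
    · rw [hF₅.reg r (by interval_cases r <;> rfl), hF₄.reg r (by interval_cases r <;> rfl),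
        hF₃.reg r (by interval_cases r <;> rfl), hF₂.reg r (by interval_cases r <;> rfl),
        hF₁.reg r (by interval_cases r <;> rfl)]
    · rw [hF₅.arr a (by interval_cases a <;> rfl), hF₄.arr a (by interval_cases a <;> rfl),
        hF₃.arr a (by interval_cases a <;> rfl), hF₂.arr a (by interval_cases a <;> rfl),
        hF₁.arr a (by interval_cases a <;> rfl)]
  have hprep : I.Prepared D τ₅ := by
    refine ⟨hin, ?_, ?_, ?_, ?_, ?_⟩
    · rw [hF₅.reg 4 rfl, hF₄.reg 4 rfl, hF₃.reg 4 rfl, h4]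
    · rw [hF₅.reg 6 rfl, hF₄.reg 6 rfl, hF₃.reg 6 rfl, h6]
    · rw [hF₅.reg 7 rfl, hF₄.reg 7 rfl, hF₃.reg 7 rfl, h7]
    · intro j
      rw [hF₅.arr 5 rfl, hF₄.arr 5 rfl, hcodes j j.2, MIP.colCode, MIP.enc]
      have : ∀ (v w : ℕ → ℤ) (k : ℕ), (∀ i < k, v i = w i) →
          horner (encBase m n D) v k = horner (encBase m n D) w k := by
        intro v w k
        induction k with
        | zero => intro _; rfl
        | succ k ih =>
          intro h
          rw [horner, horner, ih fun i hi => h i (by omega), h k (by omega)]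
      refine this _ _ m fun i hi => ?_
      rw [dif_pos hi, hF₂.arr 0 rfl, hF₁.arr 0 rfl]
      exact hA ⟨i, hi⟩ j
    · rw [hF₅.arr 5 rfl, hF₅.arr 3 rfl, hF₄.arr 5 rfl, hF₄.arr 3 rfl]
      exact htab'
  refine ⟨D, hD, (hflat D).1 hle, fun D' h h' => hmin D' h ((hflat D').2 h'), ?_, ?_, ?_, ?_, ?_⟩
  · refine hprep.congr (fun r hr => ?_) fun a ha => rfl
    rw [Mem.reg_setReg, if_neg (by omega), Mem.reg_setReg, if_neg (by omega), Mem.reg_setReg,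
      if_neg (by omega)]
  · simp [hin.2.1, tableIdx]
  · simp
  · simp
  · simp only [RExpr.cost_get, RExpr.cost_reg, RExpr.cost_zero]
    generalize encBase m n D ^ m = K at *
    generalize smallBound m n D = u at *
    ring_nf at ht₁ ht₂ ht₃ ht₄ ht₅ ⊢
    have : 0 ≤ n * K * u := Nat.zero_le _
    omega

/-- Report the findings. -/
def reportCmd : Cmd :=
  .ite (reg 9) (.set 0 2) (.ite (reg 10)
    (.ite (reg 8) (.set 0 2)
      (.loop 21 1 (.put 0 (reg 21) (get 11 (reg 21))) ;;
        .loop 21 2 (.put 1 (reg 21) (get 12 (reg 21))) ;; .set 1 (reg 12) ;; .set 0 1))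
    (.set 0 0))

theorem wp_reportCmd {m n l : ℕ} {I : MIP m n l} {σ : Mem} (hL : I.Loaded σ) (hS : I.Sound σ)
    (hinf : ¬ 0 < σ.reg 9 → ¬ 0 < σ.reg 10 → I.IsInfeasible)
    (hunb : 0 < σ.reg 10 → 0 < σ.reg 8 → I.IsUnbounded)
    (hopt : ¬ 0 < σ.reg 9 → ¬ 0 < σ.reg 8 → 0 < σ.reg 10 →
      I.IsOptimal (bestX n σ) (bestY l σ)) :
    reportCmd.wp (fun t τ => t ≤ 100 + 20 * n + 20 * l ∧ I.Answered τ) σ := by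
  simp only [reportCmd, Cmd.wp_ite, Cmd.wp_set, RExpr.eval_reg]
  refine ⟨fun h9 => ⟨by simp; omega, .inr (.inr ⟨by simp, hS.unbounded h9⟩)⟩,
    fun h9 => ⟨fun h10 => ⟨fun h8 => ⟨by simp; omega, .inr (.inr ⟨by simp, hunb h10 h8⟩)⟩,
      fun h8 => ?_⟩, fun h10 => ⟨by simp; omega, .inl ⟨by simp, hinf h9 h10⟩⟩⟩⟩
  rw [Cmd.wp_seq]
  refine Cmd.wp_use (Cmd.wp_fill rfl n hL.2.1 (fun k => σ.arr 11 k) ?_) ?_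
  · intro k hk τ hi hF
    simp [hi, hF.arr 11 rfl]
  rintro t₁ τ₁ hF₁ ⟨ht₁, H₁⟩
  rw [Cmd.wp_seq]
  refine Cmd.wp_use (Cmd.wp_fill rfl l (by rw [hF₁.reg 2 rfl, hL.2.2.1])
    (fun k => σ.arr 12 k) ?_) ?_
  · intro k hk τ hi hF
    simp [hi, hF.arr 12 rfl, hF₁.arr 12 rfl]
  rintro t₂ τ₂ hF₂ ⟨ht₂, H₂⟩
  rw [Cmd.wp_seq, Cmd.wp_set, Cmd.wp_set]
  have h12 : τ₂.reg 12 = σ.reg 12 := by rw [hF₂.reg 12 rfl, hF₁.reg 12 rfl]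
  simp at ht₁ ht₂
  refine ⟨by simp; omega, .inr (.inl ⟨by simp, ?_, ?_⟩)⟩
  · simpa [h12] using hS.pos h10
  · convert hopt h9 h8 h10 using 1
    · funext j
      simp [bestX, hF₂.arr 0 rfl, H₁ j j.2]
    · funext k
      simp [bestY, h12, H₂ k k.2]

/-- The algorithm, given an algorithm `P` for few integer variables. -/
def reduceCmd (P : Prog) : Cmd := setupCmd ;; searchCmd P ;; reportCmd

theorem wp_reduceCmd {m n l Δ : ℕ} {I : MIP m n l} {P : Prog} {κ : ℕ∞} {σ : Mem} (hn : 1 ≤ n)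
    (hΔ : 1 ≤ Δ) (hAΔ : ∀ i j, (I.A i j).natAbs ≤ Δ) (hL : I.Loaded σ)
    (hcall : ∀ D ≤ Δ, (∀ i j, (I.A i j).natAbs ≤ D) → ∀ (s : Fin m → Fin n) (x : Fin n → ℤ),
      MIP.Small m D x → ∀ ρ, (I.restrict s x).Loaded ρ → ∃ t ρ', Exec P ρ t ρ' ∧ (t : ℕ∞) ≤ κ ∧
        (I.restrict s x).Answered ρ') :
    (reduceCmd P).wp (fun t τ => I.Answered τ ∧ ∃ D ≤ Δ, ∃ tP : ℕ,
      (tP : ℕ∞) ≤ ((2 * encBase m n D ^ m + 1) * n ^ m : ℕ) * κ ∧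
      t ≤ 500 + 150 * (m * n + m + n + l) +
        200 * ((2 * encBase m n D ^ m + 1) * (n + 1) * (smallBound m n D + 2)) +
        (2 * encBase m n D ^ m + 1) * n ^ m *
          (300 + 100 * (m * m + m * l + m * (n + 1) + m + n + l)) + tP) σ := by
  rw [reduceCmd, Cmd.wp_seq]
  refine Cmd.wp_mono _ ?_ (wp_setupCmd hL)
  rintro t₁ τ₁ ⟨D, hD, hA, hmin, hP, h8, h9, h10, ht₁⟩
  have hDΔ : D ≤ Δ := hmin Δ hΔ hAΔ
  have hS : I.Sound τ₁ := ⟨by simp [h9], by simp [h10], by simp [h10], by simp [h10]⟩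
  rw [Cmd.wp_seq]
  refine Cmd.wp_use (wp_searchCmd hn rfl hA (hcall D hDΔ hA) hP hS) ?_
  rintro t₂ τ₂ hF₂ ⟨⟨tP, htP, ht₂⟩, hS₂, hcov⟩
  have hL₂ : I.Loaded τ₂ := hP.loaded.congr (fun r hr => hF₂.reg r (by interval_cases r <;> rfl))
    fun a ha => hF₂.arr a (by interval_cases a <;> rfl)
  have h8' : τ₂.reg 8 = τ₁.reg 8 := hF₂.reg 8 rfl
  have hcover : ∀ (s : Fin m → Fin n) (x : Fin n → ℤ), MIP.Small m D x → ∃ x', MIP.Small m D x' ∧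
      ∑ j, I.colCode D j * x j = ∑ j, I.colCode D j * x' j ∧ I.c ⬝ᵥ x ≤ I.c ⬝ᵥ x' ∧
      I.Covers τ₂ s x' := by
    intro s x hx
    obtain ⟨g1, g2⟩ := hP.complete hA hx
    obtain ⟨x', q1, q2, q3, q4⟩ := hcov (finFunctionFinEquiv s) (finFunctionFinEquiv s).2 _
      (hx.abs_sum_colCode_le hA) g1
    have hs : columnChoice hn (finFunctionFinEquiv s) = s := by
      funext i
      apply Fin.ext
      rw [columnChoice]
      simp only
      rw [← finFunctionFinEquiv_symm_apply_val, Equiv.symm_apply_apply]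
    rw [hs] at q4
    exact ⟨x', q1, q2.symm, by rw [q3]; exact g2, q4⟩
  have hdir : ∀ z : Fin n → ℤ, I.A *ᵥ z = 0 → ∑ j, I.colCode D j * z j = 0 := by
    intro z hz
    have : MIP.enc (encBase m n D) (I.A *ᵥ (0 : Fin n → ℤ)) = 0 := by
      rw [← MIP.sum_colCode]; simp
    rw [MIP.sum_colCode, hz, ← this, Matrix.mulVec_zero]
  refine Cmd.wp_mono _ ?_ (wp_reportCmd hL₂ hS₂ (fun h1 h2 =>
    MIP.isInfeasible_of_search hn hD hA hcover h1 h2) (fun h1 h2 => ?_) (fun h1 h2 h3 =>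
    MIP.isOptimal_of_search hn hD hA hcover ?_ h1 (hS₂.feasible h3)))
  · rintro t τ ⟨ht, hans⟩
    refine ⟨hans, D, hDΔ, tP, htP, ?_⟩
    omega
  · -- the table has a small kernel vector of positive objective
    have hpos : 0 < τ₁.arr 6 (tableIdx n 0 n) := by
      have h0 : MIP.Small m D (0 : Fin n → ℤ) := fun j => ⟨le_rfl, Int.natCast_nonneg _⟩
      simpa using (hP.complete hA h0).1
    obtain ⟨x, q1, q2, q3, -⟩ := hcov 0 (Nat.pow_pos hn) 0 (by simp) hpos
    refine MIP.isUnbounded_of_direction (hS₂.feasible h1) (z := x) ?_ (fun j => (q1 j).1) ?_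
    · rw [MIP.sum_colCode] at q2
      refine MIP.enc_injective (n := n) (D := D) (q1.abs_mulVec_le hA) (by simp) ?_
      have := hdir 0 (Matrix.mulVec_zero _)
      rw [MIP.sum_colCode, Matrix.mulVec_zero] at this
      rw [q2, this]
    · rw [q3, ← h8, ← h8']; exact h2
  · intro z hz hsm
    have := (hP.complete hA hsm).2
    rw [hdir z hz, ← h8, ← h8'] at this
    omega

end Program

/-! ### The running time -/

/-- The number of table entries and of restricted programs. If `m < n`, then `m + 1 ≤ n` bounds small
entries by `(n * Δ) ^ m`, hence codes by `(4 * (n * Δ) ^ (m + 1)) ^ m`. If `n ≤ m`, there is only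
one code. -/
theorem count_le {m n D Δ : ℕ} (hn : 1 ≤ n) (hΔ : 1 ≤ Δ) (hD : D ≤ Δ) :
    encBase m n D ^ m * (smallBound m n D + 1) * n ^ (m + 1) ≤
      2 * (2 ^ (2 * m) * Δ ^ (m ^ 3 + 3 * m ^ 2 + 2 * m) * n ^ (m ^ 3 + 5 * m ^ 2 + 6 * m + 1)) := by
  by_cases h : m < n
  · have hu : smallBound m n D ≤ (n * Δ) ^ m := by
      rw [smallBound, if_pos h]
      gcongr
      omega
    have h1 : 1 ≤ n * Δ := Nat.mul_pos hn hΔ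
    have hpow : 1 ≤ (n * Δ) ^ m := Nat.one_le_pow _ _ h1
    have hW : encBase m n D ≤ 4 * (n * Δ) ^ (m + 1) := by
      have : rhsBound m n D ≤ (n * Δ) ^ (m + 1) := by
        rw [rhsBound, pow_succ']
        gcongr
      have : 1 ≤ (n * Δ) ^ (m + 1) := Nat.one_le_pow _ _ h1
      rw [encBase]
      omega
    calc encBase m n D ^ m * (smallBound m n D + 1) * n ^ (m + 1)
        ≤ (4 * (n * Δ) ^ (m + 1)) ^ m * (2 * (n * Δ) ^ m) * n ^ (m + 1) := by
          gcongr
          omega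
      _ = 2 * (2 ^ (2 * m) * Δ ^ (m ^ 2 + 2 * m) * n ^ (m ^ 2 + 3 * m + 1)) := by
          rw [pow_mul]
          ring
      _ ≤ _ := by
          have h3 := Nat.zero_le (m ^ 3)
          have e1 : Δ ^ (m ^ 2 + 2 * m) ≤ Δ ^ (m ^ 3 + 3 * m ^ 2 + 2 * m) :=
            Nat.pow_le_pow_right hΔ (by omega)
          have e2 : n ^ (m ^ 2 + 3 * m + 1) ≤ n ^ (m ^ 3 + 5 * m ^ 2 + 6 * m + 1) :=
            Nat.pow_le_pow_right hn (by omega)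
          exact Nat.mul_le_mul_left _ (Nat.mul_le_mul (Nat.mul_le_mul_left _ e1) e2)
  · have h1 : smallBound m n D = 0 := by rw [smallBound, if_neg h]
    have h2 : encBase m n D = 1 := by rw [encBase, rhsBound, h1, mul_zero, mul_zero]
    rw [h1, h2, one_pow, one_mul, zero_add, one_mul]
    have h3 : 1 ≤ 2 ^ (2 * m) * Δ ^ (m ^ 3 + 3 * m ^ 2 + 2 * m) :=
      Nat.mul_pos (by positivity) (Nat.pow_pos hΔ)
    calc n ^ (m + 1) ≤ n ^ (m ^ 3 + 5 * m ^ 2 + 6 * m + 1) :=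
          Nat.pow_le_pow_right hn (by have := Nat.zero_le (m ^ 3); omega)
      _ ≤ (2 ^ (2 * m) * Δ ^ (m ^ 3 + 3 * m ^ 2 + 2 * m)) * n ^ (m ^ 3 + 5 * m ^ 2 + 6 * m + 1) :=
          Nat.le_mul_of_pos_left _ h3
      _ ≤ _ := Nat.le_mul_of_pos_left _ (by norm_num)

/-- The parts of the running time, `k` being the worst-case time of the given algorithm. -/
theorem total_le {m n l K u k : ℕ} (hn : 1 ≤ n) (hK : 1 ≤ K)
    (hk : 3 + m * m + m * l + m + m + l ≤ k) :
    (3 + m * n + m * l + m + n + l) + (500 + 150 * (m * n + m + n + l) +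
      200 * ((2 * K + 1) * (n + 1) * (u + 2)) + (2 * K + 1) * n ^ m *
          (300 + 100 * (m * m + m * l + m * (n + 1) + m + n + l)) + (2 * K + 1) * n ^ m * k) ≤
      10000 * (K * (u + 1) * n ^ (m + 1) * k) := by
  have hm : 1 ≤ n ^ m := Nat.one_le_pow _ _ hn
  have hnm : n ≤ n ^ m * n := Nat.le_mul_of_pos_left _ hm
  have hk3 : 3 ≤ k := by omega
  have hmk : m ≤ k := by omega
  have hlk : l ≤ k := by omega
  have hmnk : m * n ≤ k * n := Nat.mul_le_mul_right _ hmk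
  have hnk : n ≤ n * k := Nat.le_mul_of_pos_right _ (by omega)
  have hkn : k ≤ n * k := Nat.le_mul_of_pos_left _ hn
  set X := K * (u + 1) * n ^ (m + 1) * k with hX
  have hX1 : n * k ≤ X := by
    rw [hX, pow_succ]
    calc n * k = 1 * 1 * (1 * n) * k := by ring
      _ ≤ K * (u + 1) * (n ^ m * n) * k := by gcongr; omega
  have h1 : (2 * K + 1) * (n + 1) * (u + 2) ≤ 12 * X := by
    rw [hX, pow_succ]
    calc (2 * K + 1) * (n + 1) * (u + 2) ≤ (3 * K) * (2 * n) * (2 * (u + 1)) := by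
          gcongr <;> omega
      _ = 12 * (K * (u + 1) * (1 * n) * 1) := by ring
      _ ≤ 12 * (K * (u + 1) * (n ^ m * n) * k) := by gcongr; omega
  have h2 : ∀ y, y ≤ 1000 * (n * k) → (2 * K + 1) * n ^ m * y ≤ 3000 * X := by
    intro y hy
    rw [hX, pow_succ]
    calc (2 * K + 1) * n ^ m * y ≤ (3 * K) * n ^ m * (1000 * (n * k)) := by gcongr; omega
      _ = 3000 * (K * 1 * (n ^ m * n) * k) := by ring
      _ ≤ 3000 * (K * (u + 1) * (n ^ m * n) * k) := by gcongr; omega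
  have h3 := h2 (300 + 100 * (m * m + m * l + m * (n + 1) + m + n + l)) (by
    rw [Nat.mul_succ]; rw [mul_comm k n] at hmnk; omega)
  have h4 := h2 k (by omega)
  rw [mul_comm k n] at hmnk
  omega

theorem theorem4 :
    ∃ C : ℕ, ∀ P : Prog, ∃ Q : Prog,
      ∀ (m l Δ : ℕ) (M : ℕ∞), 1 ≤ Δ →
        (∀ I : MIP m m l, I.Bounded Δ M → I.SolvedBy P) →
        ∀ n : ℕ, 1 ≤ n → ∀ I : MIP m n l, I.Bounded Δ M →
          (∀ i, ((I.b i).natAbs : ℕ∞) + ((n * Δ * ((m + 2) * (m * Δ) ^ m) : ℕ) : ℕ∞) ≤ M) →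
            I.SolvedBy Q ∧
            I.time Q ≤
              ((C * (2 ^ (2 * m) * Δ ^ (m ^ 3 + 3 * m ^ 2 + 2 * m)
                  * n ^ (m ^ 3 + 5 * m ^ 2 + 6 * m + 1)) : ℕ) : ℕ∞)
                * worstCaseTime P m m l Δ M := by
  refine ⟨20000, fun P => ⟨(reduceCmd P).code, fun m l Δ M hΔ hP n hn I hI hM => ?_⟩⟩
  set κ := worstCaseTime P m m l Δ M with hκ
  have htime : ∀ J : MIP m m l, J.Bounded Δ M → J.time P ≤ κ := fun J hJ =>
    le_iSup₂_of_le J hJ le_rfl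
  have hcall : ∀ D ≤ Δ, (∀ i j, (I.A i j).natAbs ≤ D) → ∀ (s : Fin m → Fin n) (x : Fin n → ℤ),
      MIP.Small m D x → ∀ ρ, (I.restrict s x).Loaded ρ → ∃ t ρ', Exec P ρ t ρ' ∧ (t : ℕ∞) ≤ κ ∧
        (I.restrict s x).Answered ρ' := by
    intro D hD hA s x hx ρ hρ
    have hb := MIP.restrict_bounded hD hI hA hM s hx
    obtain ⟨t, ρ', h1, h2⟩ := hP _ hb ρ hρ
    refine ⟨t, ρ', h1, ?_, h2⟩
    have h3 : (t : ℕ∞) ≤ P.steps ρ := by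
      refine le_iInf fun t' => le_iInf fun ρ'' => le_iInf fun h' => ?_
      rw [(h1.unique h').1]
    have h4 : P.steps ρ ≤ ⨆ (σ : Mem) (_ : (I.restrict s x).Loaded σ), P.steps σ :=
      le_iSup₂_of_le ρ hρ le_rfl
    exact h3.trans (h4.trans (le_add_self.trans (htime _ hb)))
  have hsize : ((3 + m * m + m * l + m + m + l : ℕ) : ℕ∞) ≤ κ := by
    have hb := MIP.restrict_bounded (le_refl Δ) hI hI.1 hM (fun _ => ⟨0, hn⟩)
      (x := 0) (fun j => ⟨le_rfl, Int.natCast_nonneg _⟩)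
    exact le_self_add.trans (htime _ hb)
  set N := 20000 * (2 ^ (2 * m) * Δ ^ (m ^ 3 + 3 * m ^ 2 + 2 * m)
    * n ^ (m ^ 3 + 5 * m ^ 2 + 6 * m + 1)) with hN
  have hbound : ∀ D ≤ Δ, ∀ t tP : ℕ,
      (tP : ℕ∞) ≤ ((2 * encBase m n D ^ m + 1) * n ^ m : ℕ) * κ →
      t ≤ 500 + 150 * (m * n + m + n + l) +
        200 * ((2 * encBase m n D ^ m + 1) * (n + 1) * (smallBound m n D + 2)) +
        (2 * encBase m n D ^ m + 1) * n ^ m *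
          (300 + 100 * (m * m + m * l + m * (n + 1) + m + n + l)) + tP →
      (I.size : ℕ∞) + (t : ℕ∞) ≤ (N : ℕ∞) * κ := by
    intro D hD t tP h4 h5
    have hN0 : N ≠ 0 := by
      have := Nat.pow_pos (n := m ^ 3 + 3 * m ^ 2 + 2 * m) hΔ
      have := Nat.pow_pos (n := m ^ 3 + 5 * m ^ 2 + 6 * m + 1) hn
      positivity
    cases hk : κ with
    | top =>
      rw [ENat.mul_top (by exact_mod_cast hN0)]
      exact le_top
    | coe k =>
      rw [hk] at hsize h4
      have hsize' : 3 + m * m + m * l + m + m + l ≤ k := by exact_mod_cast hsize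
      have h4' : tP ≤ (2 * encBase m n D ^ m + 1) * n ^ m * k := by exact_mod_cast h4
      have hK : 1 ≤ encBase m n D ^ m := Nat.one_le_pow _ _ (Nat.succ_pos _)
      have h6 := total_le (u := smallBound m n D) hn hK hsize'
      have h7 := Nat.mul_le_mul_right k (count_le hn hΔ hD (m := m))
      have h8 : I.size + t ≤ N * k := by
        rw [MIP.size, hN, mul_assoc 20000]
        rw [mul_assoc 2] at h7
        omega
      exact_mod_cast h8
  have hexec : ∀ σ, I.Loaded σ → ∃ (t : ℕ) (τ : Mem), Exec (reduceCmd P).code σ t τ ∧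
      I.Answered τ ∧ (I.size : ℕ∞) + (t : ℕ∞) ≤ (N : ℕ∞) * κ := by
    intro σ hσ
    obtain ⟨t, τ₀, τ, h1, h2, h3, D, hD, tP, h4, h5⟩ := Cmd.exec_code (reduceCmd P) rfl
      (Mem.Agree.refl σ) (wp_reduceCmd hn hΔ hI.1 hσ hcall)
    refine ⟨t, τ₀, h1, ?_, hbound D hD t tP h4 h5⟩
    rw [MIP.Answered, h2.2 0 (by omega), h2.2 1 (by omega), h2.1]
    exact h3
  refine ⟨fun σ hσ => ?_, ?_⟩
  · obtain ⟨t, τ, h1, h2, -⟩ := hexec σ hσ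
    exact ⟨t, τ, h1, h2⟩
  · have h0 : (I.size : ℕ∞) ≤ (N : ℕ∞) * κ := by
      simpa using hbound Δ le_rfl 0 0 (by simp) (Nat.zero_le _)
    rw [MIP.time]
    calc (I.size : ℕ∞) + ⨆ (σ : Mem) (_ : I.Loaded σ), (reduceCmd P).code.steps σ
        ≤ I.size + ((N : ℕ∞) * κ - I.size) := by
          refine add_le_add_right (iSup₂_le fun σ hσ => ?_) _
          obtain ⟨t, τ, h1, -, h3⟩ := hexec σ hσ
          refine le_trans (iInf_le_of_le t (iInf_le_of_le τ (iInf_le_of_le h1 le_rfl))) ?_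
          exact ENat.le_sub_of_add_le_left (ENat.natCast_ne_top _) h3
      _ = (N : ℕ∞) * κ := add_tsub_cancel_of_le h0
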